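/- **Setting.** Let $\Gamma\subset\mathbb R^n\times\mathbb R^n\times\mathbb R$ be a domain (open and connected) such that every fibre $I(x,y)=\{z : (x,y,z)\in\Gamma\}$ is an (open, possibly empty) interval, and let $g\in C^2(\Gamma)$ be a generating function, i.e. $g_z<0$ in $\Gamma$. Put $\mathcal U=\{(x,g(x,y,z),g_x(x,y,z)) : (x,y,z)\in\Gamma\}$, $E=g_{x,y}-(g_z)^{-1}g_{x,z}\otimes g_y$ and $Q=-g_y/g_z$. Assume: * **A1**: for each $(x,u,p)\in\mathcal U$ there is a unique $(y,z)$ with $(x,y,z)\in\Gamma$, $g(x,y,z)=u$, $g_x(x,y,z)=p$; write $y=Y(x,u,p)$, $z=Z(x,u,p)$; * **A2**: $\det E\neq0$ in $\Gamma$; * **A1\***: for all $(y,z)$ the map $x\mapsto Q(x,y,z)$ is one-to-one on $\{x : (x,y,z)\in\Gamma\}$. Let $A(x,u,p)=g_{xx}(x,Y(x,u,p),Z(x,u,p))$ on $\mathcal U$. Condition **A3w** says that for all $\xi\in\mathbb R^n$ and $(x,u)$, the function $p\mapsto (A(x,u,p)\xi,\xi)$ is convex along every line segment orthogonal to $\xi$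 in $\{p : (x,u,p)\in\mathcal U\}$. The dual generating function $g^*$ is defined on $\Gamma^*=\{(x,y,g(x,y,z)) : (x,y,z)\in\Gamma\}$ by $g(x,y,g^*(x,y,u))=u$. Condition A3w for $g^*$ is A3w with the roles of $x$ and $y$ exchanged, that is, A3w for $(y,x,u)\mapsto g^*(x,y,u)$ on $\{(y,x,u) : (x,y,u)\in\Gamma^*\}$. For $(x_0,u_0,[p_0,p_1])\subset\mathcal U$ and $\theta\in[0,1]$ put $p_\theta=(1-\theta)p_0+\theta p_1$, $y_\theta=Y(x_0,u_0,p_\theta)$, $z_\theta=Z(x_0,u_0,p_\theta)$, $h_\theta(x)=g(x,y_\theta,z_\theta)-g(x,y_0,z_0)$ and $S_\theta=\{x\in\Omega_0 : h_\theta(x)<0\}$, where $\Omega_0$ is the set of the $x$ with $(x,u_0,[p_0,p_1])\subset\mathcal U$ (restricted to those $x$ at which $h_\theta$ is defined). A set $\Omega\subset\mathbb R^n$ is $g$-convex with respect to $(y_0,z_0)$ if $\Omega\times\{(y_0,z_0)\}\subset\Gamma$ and $Q(\cdot,y_0,z_0)(\Omega)$ is convex; a set $S$ is locally $g$-convex at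 $x_0$ if $S\cap\mathcal N_0$ is $g$-convex for some open neighbourhood $\mathcal N_0$ of $x_0$. **Theorem 2.1.** Let $g\in C^2(\Gamma)$ be a generating function satisfying A1, A2 and A1\*. Then A3w is invariant under duality: $g$ satisfies A3w if and only if $g^*$ does. Moreover, A3w is equivalent to each of the following two conditions: * **A3w(1)**: for all $(x_0,u_0,[p_0,p_1])\subset\mathcal U$, the set $S_1$ is locally $g$-convex at $x_0$ with respect to $(y_0,z_0)$; * **A3w(2)**: for all $(x_0,u_0,[p_0,p_1])\subset\mathcal U$ there is a neighbourhood $\mathcal N_0$ of $x_0$ such that, for all $x\in\mathcal N_0$ and $\theta\in[0,1]$, one has $(x,y_\theta,z_\theta)\in\Gamma$ and $$g(x,y_\theta,z_\theta)\le\max\{g(x,y_0,z_0),\,g(x,y_1,z_1)\}.$$ -/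

import Mathlib

noncomputable section

namespace GenFun

/-- Euclidean space `ℝⁿ`. -/
abbrev Pt (n : ℕ) : Type := EuclideanSpace ℝ (Fin n)

variable {n : ℕ}

/-! ### First and second order derivatives of a function `g(x, y, z)` -/

/-- The gradient `g_x` with respect to the first variable. -/
def gx (g : Pt n → Pt n → ℝ → ℝ) (x y : Pt n) (z : ℝ) : Pt n :=
  gradient (fun x' => g x' y z) x

/-- The gradient `g_y` with respect to the second variable. -/
def gy (g : Pt n → Pt n → ℝ → ℝ) (x y : Pt n) (z : ℝ) : Pt n :=
  gradient (fun y' => g x y' z) y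

/-- The derivative `g_z` with respect to the scalar variable. -/
def gz (g : Pt n → Pt n → ℝ → ℝ) (x y : Pt n) (z : ℝ) : ℝ :=
  deriv (fun z' => g x y z') z

/-- The Hessian `g_xx`, as the linear map whose matrix in the standard basis is
`[∂²g/∂x_i∂x_j]`. -/
def gxx (g : Pt n → Pt n → ℝ → ℝ) (x y : Pt n) (z : ℝ) : Pt n →L[ℝ] Pt n :=
  fderiv ℝ (fun x' => gx g x' y z) x

/-- The mixed second derivatives `g_{x,y}`, as the linear map whose matrix in the standard basis is
`[∂²g/∂x_i∂y_j]`. -/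
def gxy (g : Pt n → Pt n → ℝ → ℝ) (x y : Pt n) (z : ℝ) : Pt n →L[ℝ] Pt n :=
  fderiv ℝ (fun y' => gx g x y' z) y

/-- The mixed second derivatives `g_{x,z}`. -/
def gxz (g : Pt n → Pt n → ℝ → ℝ) (x y : Pt n) (z : ℝ) : Pt n :=
  deriv (fun z' => gx g x y z') z

/-- `E = g_{x,y} - (g_z)⁻¹ g_{x,z} ⊗ g_y`, as a linear map; `a ⊗ b` has the matrix `[a_i b_j]`, that
is, it maps `η` to `⟪b, η⟫ a`. -/
def matE (g : Pt n → Pt n → ℝ → ℝ) (x y : Pt n) (z : ℝ) : Pt n →L[ℝ] Pt n :=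
  gxy g x y z - (gz g x y z)⁻¹ • (innerSL ℝ (gy g x y z)).smulRight (gxz g x y z)

/-- The mapping `Q = -g_y / g_z`. -/
def Q (g : Pt n → Pt n → ℝ → ℝ) (x y : Pt n) (z : ℝ) : Pt n :=
  -((gz g x y z)⁻¹ • gy g x y z)

/-! ### Generating functions and the structural conditions -/

/-- `g` is a `C²` generating function on the domain `Γ ⊂ ℝⁿ × ℝⁿ × ℝ`: the fibres
`I(x, y) = {z | (x, y, z) ∈ Γ}` are (open, possibly empty) intervals, `g ∈ C²(Γ)` and `g_z < 0`
in `Γ`. -/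
structure IsGenerating (g : Pt n → Pt n → ℝ → ℝ) (Γ : Set (Pt n × Pt n × ℝ)) : Prop where
  isOpen : IsOpen Γ
  isConnected : IsConnected Γ
  ordConnected : ∀ x y : Pt n, {z : ℝ | (x, y, z) ∈ Γ}.OrdConnected
  contDiffOn : ContDiffOn ℝ 2 (fun w : Pt n × Pt n × ℝ => g w.1 w.2.1 w.2.2) Γ
  gz_neg : ∀ x y z, (x, y, z) ∈ Γ → gz g x y z < 0

/-- `𝒰 = {(x, g(x, y, z), g_x(x, y, z)) | (x, y, z) ∈ Γ}`. -/
def setU (g : Pt n → Pt n → ℝ → ℝ) (Γ : Set (Pt n × Pt n × ℝ)) : Set (Pt n × ℝ × Pt n) :=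
  {w | ∃ x y z, (x, y, z) ∈ Γ ∧ w = (x, g x y z, gx g x y z)}

/-- `(y, z)` solves `g(x, y, z) = u`, `g_x(x, y, z) = p`, with `(x, y, z) ∈ Γ`. -/
def Generates (g : Pt n → Pt n → ℝ → ℝ) (Γ : Set (Pt n × Pt n × ℝ))
    (x : Pt n) (u : ℝ) (p : Pt n) (w : Pt n × ℝ) : Prop :=
  (x, w.1, w.2) ∈ Γ ∧ g x w.1 w.2 = u ∧ gx g x w.1 w.2 = p

/-- Condition A1. -/
def A1 (g : Pt n → Pt n → ℝ → ℝ) (Γ : Set (Pt n × Pt n × ℝ)) : Prop :=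
  ∀ x u p, (x, u, p) ∈ setU g Γ → ∃! w : Pt n × ℝ, Generates g Γ x u p w

/-- Condition A2. -/
def A2 (g : Pt n → Pt n → ℝ → ℝ) (Γ : Set (Pt n × Pt n × ℝ)) : Prop :=
  ∀ x y z, (x, y, z) ∈ Γ → (matE g x y z).det ≠ 0

/-- Condition A1*: the mapping `Q(·, y, z)` is one-to-one. -/
def A1star (g : Pt n → Pt n → ℝ → ℝ) (Γ : Set (Pt n × Pt n × ℝ)) : Prop :=
  ∀ y z, Set.InjOn (fun x => Q g x y z) {x | (x, y, z) ∈ Γ}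

/-- The solution `(Y, Z)(x, u, p)` of the generating equations. On `𝒰` it exists and, under
condition A1, is unique. -/
def YZ (g : Pt n → Pt n → ℝ → ℝ) (Γ : Set (Pt n × Pt n × ℝ))
    (x : Pt n) (u : ℝ) (p : Pt n) : Pt n × ℝ :=
  Classical.epsilon (Generates g Γ x u p)

/-- `Y(x, u, p)`. -/
def Y (g : Pt n → Pt n → ℝ → ℝ) (Γ : Set (Pt n × Pt n × ℝ))
    (x : Pt n) (u : ℝ) (p : Pt n) : Pt n := (YZ g Γ x u p).1

/-- `Z(x, u, p)`. -/
def Z (g : Pt n → Pt n → ℝ → ℝ) (Γ : Set (Pt n × Pt n × ℝ))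
    (x : Pt n) (u : ℝ) (p : Pt n) : ℝ := (YZ g Γ x u p).2

/-- The matrix function `A(x, u, p) = g_xx(x, Y(x, u, p), Z(x, u, p))`. -/
def matA (g : Pt n → Pt n → ℝ → ℝ) (Γ : Set (Pt n × Pt n × ℝ))
    (x : Pt n) (u : ℝ) (p : Pt n) : Pt n →L[ℝ] Pt n :=
  gxx g x (Y g Γ x u p) (Z g Γ x u p)

/-- `(x₀, u₀, [p₀, p₁]) ⊂ 𝒰`. -/
def SegmentIn (g : Pt n → Pt n → ℝ → ℝ) (Γ : Set (Pt n × Pt n × ℝ))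
    (x₀ : Pt n) (u₀ : ℝ) (p₀ p₁ : Pt n) : Prop :=
  ∀ p ∈ segment ℝ p₀ p₁, (x₀, u₀, p) ∈ setU g Γ

/-- Condition A3w: `(Aξ, ξ)(x, u, ·)` is convex along the line segments in
`𝒰(x, u) = {p | (x, u, p) ∈ 𝒰}` that are orthogonal to `ξ`. -/
def A3w (g : Pt n → Pt n → ℝ → ℝ) (Γ : Set (Pt n × Pt n × ℝ)) : Prop :=
  ∀ (ξ x : Pt n) (u : ℝ) (p₀ p₁ : Pt n), SegmentIn g Γ x u p₀ p₁ → inner ℝ ξ (p₁ - p₀) = 0 →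
    ConvexOn ℝ (segment ℝ p₀ p₁) (fun p => inner ℝ (matA g Γ x u p ξ) ξ)

/-! ### Duality -/

/-- The dual generating function `g*`, with `g(x, y, g*(x, y, u)) = u` for
`(x, y, u) ∈ Γ* = {(x, y, g(x, y, z)) | (x, y, z) ∈ Γ}`. -/
def gstar (g : Pt n → Pt n → ℝ → ℝ) (Γ : Set (Pt n × Pt n × ℝ)) (x y : Pt n) (u : ℝ) : ℝ :=
  Function.invFunOn (fun z => g x y z) {z | (x, y, z) ∈ Γ} u

/-- `g*` as a generating function, in which `y` plays the part of the first variable, `x` that of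
the second, and `u` that of the scalar variable. -/
def dualFun (g : Pt n → Pt n → ℝ → ℝ) (Γ : Set (Pt n × Pt n × ℝ)) : Pt n → Pt n → ℝ → ℝ :=
  fun y x u => gstar g Γ x y u

/-- The domain `Γ*` of the dual generating function, with its variables in the order
`(y, x, u)`. -/
def dualSet (g : Pt n → Pt n → ℝ → ℝ) (Γ : Set (Pt n × Pt n × ℝ)) : Set (Pt n × Pt n × ℝ) :=
  {w | ∃ x y z, (x, y, z) ∈ Γ ∧ w = (y, x, g x y z)}

/-! ### Local convexity -/

/-- `Ω` is `g`-convex with respect to `(y₀, z₀)`. -/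
def GConvex (g : Pt n → Pt n → ℝ → ℝ) (Γ : Set (Pt n × Pt n × ℝ)) (Ω : Set (Pt n))
    (y₀ : Pt n) (z₀ : ℝ) : Prop :=
  (∀ x ∈ Ω, (x, y₀, z₀) ∈ Γ) ∧ Convex ℝ ((fun x => Q g x y₀ z₀) '' Ω)

/-- `S` is locally `g`-convex at `x₀` with respect to `(y₀, z₀)`: its intersection with some open
neighbourhood of `x₀` is `g`-convex. -/
def LocallyGConvexAt (g : Pt n → Pt n → ℝ → ℝ) (Γ : Set (Pt n × Pt n × ℝ)) (S : Set (Pt n))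
    (x₀ y₀ : Pt n) (z₀ : ℝ) : Prop :=
  ∃ N : Set (Pt n), IsOpen N ∧ x₀ ∈ N ∧ GConvex g Γ (S ∩ N) y₀ z₀

/-- `p_θ = (1 - θ) p₀ + θ p₁`. -/
def pθ (p₀ p₁ : Pt n) (θ : ℝ) : Pt n := (1 - θ) • p₀ + θ • p₁

/-- `y_θ = Y(x₀, u₀, p_θ)`. -/
def yθ (g : Pt n → Pt n → ℝ → ℝ) (Γ : Set (Pt n × Pt n × ℝ))
    (x₀ : Pt n) (u₀ : ℝ) (p₀ p₁ : Pt n) (θ : ℝ) : Pt n := Y g Γ x₀ u₀ (pθ p₀ p₁ θ)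

/-- `z_θ = Z(x₀, u₀, p_θ)`. -/
def zθ (g : Pt n → Pt n → ℝ → ℝ) (Γ : Set (Pt n × Pt n × ℝ))
    (x₀ : Pt n) (u₀ : ℝ) (p₀ p₁ : Pt n) (θ : ℝ) : ℝ := Z g Γ x₀ u₀ (pθ p₀ p₁ θ)

/-- `h_θ(x) = g(x, y_θ, z_θ) - g(x, y_0, z_0)`. -/
def hθ (g : Pt n → Pt n → ℝ → ℝ) (Γ : Set (Pt n × Pt n × ℝ))
    (x₀ : Pt n) (u₀ : ℝ) (p₀ p₁ : Pt n) (θ : ℝ) (x : Pt n) : ℝ :=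
  g x (yθ g Γ x₀ u₀ p₀ p₁ θ) (zθ g Γ x₀ u₀ p₀ p₁ θ) -
    g x (yθ g Γ x₀ u₀ p₀ p₁ 0) (zθ g Γ x₀ u₀ p₀ p₁ 0)

/-- The section `S_θ = {x ∈ Ω₀ | h_θ(x) < 0}`, with `Ω₀ = {x | (x, u₀, [p₀, p₁]) ⊂ 𝒰}`; the
conditions that `(x, y_θ, z_θ)` and `(x, y_0, z_0)` lie in `Γ` say that `h_θ` is defined at `x`. -/
def section_Sθ (g : Pt n → Pt n → ℝ → ℝ) (Γ : Set (Pt n × Pt n × ℝ))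
    (x₀ : Pt n) (u₀ : ℝ) (p₀ p₁ : Pt n) (θ : ℝ) : Set (Pt n) :=
  {x | SegmentIn g Γ x u₀ p₀ p₁ ∧
    (x, yθ g Γ x₀ u₀ p₀ p₁ θ, zθ g Γ x₀ u₀ p₀ p₁ θ) ∈ Γ ∧
    (x, yθ g Γ x₀ u₀ p₀ p₁ 0, zθ g Γ x₀ u₀ p₀ p₁ 0) ∈ Γ ∧
    hθ g Γ x₀ u₀ p₀ p₁ θ x < 0}

/-- Condition A3w(1): `S_1` is locally `g`-convex at `x₀` with respect to `(y_0, z_0)`. -/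
def A3w1 (g : Pt n → Pt n → ℝ → ℝ) (Γ : Set (Pt n × Pt n × ℝ)) : Prop :=
  ∀ (x₀ : Pt n) (u₀ : ℝ) (p₀ p₁ : Pt n), SegmentIn g Γ x₀ u₀ p₀ p₁ →
    LocallyGConvexAt g Γ (section_Sθ g Γ x₀ u₀ p₀ p₁ 1) x₀
      (yθ g Γ x₀ u₀ p₀ p₁ 0) (zθ g Γ x₀ u₀ p₀ p₁ 0)

/-- Condition A3w(2): near `x₀`, uniformly in `θ ∈ [0, 1]`,
`g(x, y_θ, z_θ) ≤ max {g(x, y_0, z_0), g(x, y_1, z_1)}`, all the points involved being in `Γ`. -/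
def A3w2 (g : Pt n → Pt n → ℝ → ℝ) (Γ : Set (Pt n × Pt n × ℝ)) : Prop :=
  ∀ (x₀ : Pt n) (u₀ : ℝ) (p₀ p₁ : Pt n), SegmentIn g Γ x₀ u₀ p₀ p₁ →
    ∃ N : Set (Pt n), IsOpen N ∧ x₀ ∈ N ∧ ∀ x ∈ N, ∀ θ ∈ Set.Icc (0 : ℝ) 1,
      (x, yθ g Γ x₀ u₀ p₀ p₁ θ, zθ g Γ x₀ u₀ p₀ p₁ θ) ∈ Γ ∧
      g x (yθ g Γ x₀ u₀ p₀ p₁ θ) (zθ g Γ x₀ u₀ p₀ p₁ θ) ≤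
        max (g x (yθ g Γ x₀ u₀ p₀ p₁ 0) (zθ g Γ x₀ u₀ p₀ p₁ 0))
          (g x (yθ g Γ x₀ u₀ p₀ p₁ 1) (zθ g Γ x₀ u₀ p₀ p₁ 1))

end GenFun

end

namespace GenFun
open Set Filter Topology Metric
open scoped RealInnerProductSpace

/-! ### Comparison in one variable; touching by quadratics. -/

section Calculus

/-! Everything passes through one condition, `FocalQuasiconvex`: for `x₁` near `x₀` the function `p
↦ g(x₁, Y(x₀, u₀, p), Z(x₀, u₀, p))` is quasiconvex near each segment in `𝒰(x₀, u₀)`, uniformly in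
`x₀`, `u₀`, `x₁`.

A3w implies it (`IsRegular.focalQuasiconvex`). For smooth `g` this would follow by differentiating
`A` twice in `p`. Here `A` is only continuous, so convexity of `A` is used through finite convex
combinations. Write `G x p` for the function above. If `G x₁` is not quasiconvex, it is touched from
above at some `p` by a quadratic function that is negative in a direction tangent to the level set.
This yields `n` points `p_j` near `p`, on the level of `p`, whose mean has a strictly larger value.
On the other hand, the `n` functions `G · p_j` agree along a curve `σ` from `x₀` to `x₁`. There the
gradients `P_j` have the same product with the velocity `ξ`, so they span a hyperplane orthogonal to
`ξ`. Whenever the gradient belonging to the mean meets this hyperplane, it is a convex combination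
of the `P_j`, and A3w controls its derivative along `σ`. Hence the value at the mean cannot exceed
the common value (`LocalModel.le_along_curve`), a contradiction.

`FocalQuasiconvex` contains A3w(2). It also gives a separation property
(`IsRegular.Q_notMem_segment`): if `g(·, y₁, z₁) = g(·, y₀, z₀)` at `x`, then `Q(x, y₀, z₀)` is on
no segment joining the images under `Q` of two nearby points with `g(·, y₁, z₁) < g(·, y₀, z₀)`. The
reason is that quasiconvexity places all such images strictly on one side of a hyperplane through
`Q(x, y₀, z₀)`. Convexity of sections, A3w(1), follows by the intermediate value theorem; read in
terms of `g*`, the same property is the inequality of A3w(2) for `g*` at midpoints of short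
segments.

Conversely, that inequality at one `θ` gives the inequality of A3w at `θ`, by comparing second order
terms along a parabola (`IsRegular.inner_matA_le`). A3w(1) gives the inequality because the sections
from `p_θ` towards `p₀` and towards `p₁` lie in opposite half-spaces. The remaining direction of
duality holds because `g**` agrees with `g` on `Γ`. -/

theorem nonpos_of_deriv_neg_at_zeros {k : ℝ → ℝ} {b : ℝ} (hk : ContinuousOn k (Icc 0 b))
    (h0 : k 0 ≤ 0)
    (hz : ∀ t ∈ Ico 0 b, k t = 0 → ∃ k' < 0, HasDerivWithinAt k k' (Ici t) t) :
    ∀ t ∈ Icc 0 b, k t ≤ 0 := by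
  intro t ht
  by_contra! hpos
  set A : Set ℝ := Icc 0 t ∩ k ⁻¹' Iic 0 with hA
  have hsub : Icc 0 t ⊆ Icc 0 b := Icc_subset_Icc_right ht.2
  have hAc : IsCompact A := by
    refine isCompact_Icc.of_isClosed_subset ?_ inter_subset_left
    exact (hk.mono hsub).preimage_isClosed_of_isClosed isClosed_Icc isClosed_Iic
  have hAne : A.Nonempty := ⟨0, ⟨le_rfl, ht.1⟩, h0⟩
  -- The last time `s` before `t` with `k ≤ 0`: there `k` vanishes and is positive just afterwards,
  -- which a negative right derivative excludes.
  obtain ⟨s, hsA, hs⟩ := hAc.exists_isGreatest hAne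
  have hst : s < t := by
    refine lt_of_le_of_ne hsA.1.2 ?_
    rintro rfl
    exact absurd hsA.2 (by simpa using hpos)
  have hafter : ∀ r ∈ Ioc s t, 0 < k r := by
    intro r hr
    by_contra! hr0
    exact absurd (hs ⟨⟨hsA.1.1.trans hr.1.le, hr.2⟩, hr0⟩) (not_le.2 hr.1)
  have hcs : ContinuousWithinAt k (Ioc s t) s :=
    (hk s (hsub hsA.1)).mono fun r hr => ⟨hsA.1.1.trans hr.1.le, hr.2.trans ht.2⟩
  have hks : k s = 0 := by
    refine le_antisymm hsA.2 ?_
    have : (𝓝[Ioc s t] s).NeBot := by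
      rw [← mem_closure_iff_nhdsWithin_neBot, closure_Ioc hst.ne]
      exact ⟨le_rfl, hst.le⟩
    exact ge_of_tendsto hcs (eventually_mem_nhdsWithin.mono fun r hr => (hafter r hr).le)
  obtain ⟨k', hk', hd⟩ := hz s ⟨hsA.1.1, hst.trans_le ht.2⟩ hks
  rw [← hasDerivWithinAt_Ioi_iff_Ici, hasDerivWithinAt_iff_tendsto_slope' self_notMem_Ioi] at hd
  have hsl' := hd.eventually (gt_mem_nhds hk')
  have hmem : ∀ᶠ r in 𝓝[>] s, r ∈ Ioc s t := Ioc_mem_nhdsGT hst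
  obtain ⟨r, hr1, hr2⟩ := (hsl'.and hmem).exists
  rw [slope_def_field, hks, sub_zero] at hr1
  exact absurd (div_pos (hafter r hr2) (sub_pos.2 hr2.1)) (not_lt.2 hr1.le)

/-- Gronwall's argument: `w` stays below `η exp((C + 1) t)` for every `η > 0`, and `η → 0`. The rate
`C + 1` instead of `C` makes the comparison strict at a contact. -/
theorem nonpos_of_deriv_le_mul_abs {w w' : ℝ → ℝ} {b C : ℝ}
    (hw : ∀ t ∈ Icc 0 b, HasDerivAt w (w' t) t) (h0 : w 0 ≤ 0)
    (hle : ∀ t ∈ Icc 0 b, w' t ≤ C * |w t|) : ∀ t ∈ Icc 0 b, w t ≤ 0 := by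
  intro t ht
  have key : ∀ η > 0, w t ≤ η * Real.exp ((C + 1) * t) := by
    intro η hη
    refine image_le_of_deriv_right_lt_deriv_boundary (f := w) (f' := w') (a := 0) (b := b)
      (B := fun t => η * Real.exp ((C + 1) * t))
      (B' := fun t => η * (Real.exp ((C + 1) * t) * (C + 1)))
      (fun x hx => (hw x hx).continuousAt.continuousWithinAt)
      (fun x hx => (hw x (Ico_subset_Icc_self hx)).hasDerivWithinAt) ?_ ?_ ?_ ht
    · simp only [mul_zero, Real.exp_zero, mul_one]; linarith
    · intro x
      have h1 : HasDerivAt (fun t => (C + 1) * t) (C + 1) x := by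
        simpa using (hasDerivAt_id x).const_mul (C + 1)
      exact h1.exp.const_mul η
    · intro x hx hxe
      have hp : 0 < η * Real.exp ((C + 1) * x) := by positivity
      have := hle x (Ico_subset_Icc_self hx)
      rw [hxe, abs_of_pos hp] at this
      nlinarith
  have hT : Tendsto (fun η : ℝ => η * Real.exp ((C + 1) * t)) (𝓝[>] 0) (𝓝 0) := by
    have : Tendsto (fun η : ℝ => η * Real.exp ((C + 1) * t)) (𝓝 0)
        (𝓝 (0 * Real.exp ((C + 1) * t))) := by
      exact (continuous_id.mul continuous_const).tendsto 0
    rw [zero_mul] at this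
    exact this.mono_left nhdsWithin_le_nhds
  exact ge_of_tendsto hT (eventually_mem_nhdsWithin.mono fun η hη => key η hη)

variable {E : Type*} [NormedAddCommGroup E] [InnerProductSpace ℝ E]

/-- Where `a` vanishes, the product rule needs only continuity of `ξ`. It will be applied to the
velocity `ξ` of a curve that is merely `C¹`. -/
theorem hasDerivAt_inner_of_eq_zero {a ξ : ℝ → E} {a' : E} {t : ℝ} (ha : HasDerivAt a a' t)
    (h0 : a t = 0) (hξ : ContinuousAt ξ t) :
    HasDerivAt (fun s => ⟪a s, ξ s⟫) ⟪a', ξ t⟫ t := by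
  rw [hasDerivAt_iff_tendsto_slope] at ha ⊢
  have h1 : Tendsto (fun s => ⟪slope a t s, ξ s⟫) (𝓝[≠] t) (𝓝 ⟪a', ξ t⟫) :=
    ha.inner (hξ.tendsto.mono_left nhdsWithin_le_nhds)
  refine h1.congr fun s => ?_
  simp [slope_def_module, h0, inner_smul_left]

set_option maxHeartbeats 1000000 in
/-- A differentiable function without critical points that is not quasiconvex is touched from above by a quadratic
function which is negative in a direction tangent to the level set. -/
theorem exists_touching_of_not_quasiconvexOn [FiniteDimensional ℝ E] {K : Set E} (hKo : IsOpen K)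
    (hKc : Convex ℝ K) {f : E → ℝ} {f' : E → E}
    (hf : ∀ p ∈ K, HasFDerivAt f (innerSL ℝ (f' p)) p) {c : ℝ} (hc : 0 < c)
    (hfc : ∀ p ∈ K, c ≤ ‖f' p‖) (hq : ¬ QuasiconvexOn ℝ K f) :
    ∃ p ∈ K, ∃ q : E → ℝ, Continuous q ∧ (∀ (r : ℝ) η, q (r • η) = r ^ 2 * q η) ∧
      (∀ᶠ p' in 𝓝 p, f p' ≤ f p + ⟪f' p, p' - p⟫ + q (p' - p)) ∧
      ∃ e, ‖e‖ = 1 ∧ ⟪f' p, e⟫ = 0 ∧ q e < 0 := by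
  rw [quasiconvexOn_iff_le_max] at hq
  push Not at hq
  obtain ⟨a, ha, b, hb, s, t, hs, ht, hst, hlt⟩ := hq hKc
  set c0 := s • a + t • b with hc0
  obtain ⟨r, hr⟩ : ∃ r, max (f a) (f b) = r := ⟨_, rfl⟩
  rw [hr] at hlt
  have hfa : f a ≤ r := hr ▸ le_max_left _ _
  have hfb : f b ≤ r := hr ▸ le_max_right _ _
  obtain ⟨μ, hμ⟩ : ∃ μ, μ = f c0 - r := ⟨_, rfl⟩
  have hμ0 : 0 < μ := by rw [hμ]; linarith
  have hab : a ≠ b := by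
    rintro rfl
    rw [hc0, ← add_smul, hst, one_smul] at hlt
    linarith
  set l := ‖b - a‖ with hl
  have hl0 : 0 < l := norm_pos_iff.2 (sub_ne_zero.2 hab.symm)
  set e := l⁻¹ • (b - a) with he
  have hle : l • e = b - a := by rw [he, smul_smul, mul_inv_cancel₀ hl0.ne', one_smul]
  have hee : ⟪e, e⟫ = 1 := by
    rw [he, inner_smul_left, inner_smul_right, real_inner_self_eq_norm_sq, ← hl]
    simp; field_simp
  clear_value e
  have hseg : segment ℝ a b ⊆ K := hKc.segment_subset ha hb
  have hcomp : IsCompact (segment ℝ a b) := by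
    rw [segment_eq_image ℝ a b]
    exact isCompact_Icc.image (by fun_prop)
  obtain ⟨w1, hw1, hw1K⟩ := hcomp.exists_cthickening_subset_open hKo hseg
  have hcont : ContinuousOn f K := fun p hp => (hf p hp).continuousAt.continuousWithinAt
  have hnear : ∀ p ∈ K, f p ≤ r → ∃ δ > 0, ∀ w : E, ‖w‖ ≤ δ → f (p + w) < r + μ / 2 := by
    intro p hp hpr
    have h1 : ∀ᶠ p' in 𝓝 p, f p' < r + μ / 2 :=
      (hf p hp).continuousAt.eventually (gt_mem_nhds (by linarith))
    obtain ⟨δ, hδ, hδ'⟩ := Metric.eventually_nhds_iff.1 h1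
    refine ⟨δ / 2, by positivity, fun w hw => hδ' ?_⟩
    rw [dist_eq_norm, add_sub_cancel_left]; linarith
  obtain ⟨δa, hδa, hna⟩ := hnear a ha hfa
  obtain ⟨δb, hδb, hnb⟩ := hnear b hb hfb
  -- The width of a tube around `[a, b]` that stays in `K` and whose end discs have `f < r + μ / 2`.
  set w0 := min w1 (min δa δb) with hw0
  have hw0p : 0 < w0 := by positivity
  have hcth : IsCompact (cthickening w1 (segment ℝ a b)) := hcomp.cthickening
  obtain ⟨Fb, hFb⟩ := (hcth.image_of_continuousOn (hcont.mono hw1K)).bddAbove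
  -- Steep enough that the penalty `M w0²` excludes a maximum on the lateral boundary of the tube.
  set M := (|Fb - f c0| + μ) / w0 ^ 2 with hM
  have hM0 : 0 < M := by positivity
  have hMw : M * w0 ^ 2 = |Fb - f c0| + μ := by rw [hM]; field_simp
  -- The bound by `μ / 4` excludes maxima on the end discs; the bound by `c ^ 2` keeps the quadratic
  -- negative after `e` is projected onto the tangent space.
  obtain ⟨ε, hε0, hε1, hεμ, hεc⟩ : ∃ ε > 0, ε ≤ 1 ∧ ε * l ^ 2 < μ / 4 ∧
      4 * (M + 1) * ε * l ^ 2 < c ^ 2 := by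
    have h1 : Tendsto (fun ε : ℝ => ε * l ^ 2) (𝓝[>] 0) (𝓝 0) := by
      have : Tendsto (fun ε : ℝ => ε * l ^ 2) (𝓝 0) (𝓝 (0 * l ^ 2)) :=
        (continuous_id.mul continuous_const).tendsto 0
      rw [zero_mul] at this
      exact this.mono_left nhdsWithin_le_nhds
    have h2 : Tendsto (fun ε : ℝ => 4 * (M + 1) * ε * l ^ 2) (𝓝[>] 0) (𝓝 0) := by
      have : Tendsto (fun ε : ℝ => 4 * (M + 1) * ε * l ^ 2) (𝓝 0) (𝓝 (4 * (M + 1) * 0 * l ^ 2)) :=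
        ((continuous_const.mul continuous_id).mul continuous_const).tendsto 0
      rw [mul_zero, zero_mul] at this
      exact this.mono_left nhdsWithin_le_nhds
    obtain ⟨ε, ⟨h3, h4⟩, h5, h6⟩ := (((h1.eventually (gt_mem_nhds (show (0:ℝ) < μ / 4 by linarith))).and
      (h2.eventually (gt_mem_nhds (show (0:ℝ) < c ^ 2 by positivity)))).and
        (Ioc_mem_nhdsGT (show (0:ℝ) < 1 by norm_num))).exists
    exact ⟨ε, h5, h6, h3, h4⟩
  -- That is, `M` times the square of the part orthogonal to `e`, minus `ε ⟪η, e⟫²`.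
  set q : E → ℝ := fun η => M * ‖η‖ ^ 2 - (M + ε) * ⟪η, e⟫ ^ 2 with hqdef
  have hqc : Continuous q := by fun_prop
  have hqr : ∀ (r : ℝ) η, q (r • η) = r ^ 2 * q η := by
    intro r η
    simp only [hqdef, norm_smul, inner_smul_left, mul_pow, Real.norm_eq_abs, sq_abs]
    simp; ring
  have hsplit : ∀ η : E, ‖η‖ ^ 2 = ⟪η, e⟫ ^ 2 + ‖η - ⟪η, e⟫ • e‖ ^ 2 := by
    intro η
    have h1 : ‖e‖ ^ 2 = 1 := by rw [← real_inner_self_eq_norm_sq, hee]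
    rw [norm_sub_sq_real, inner_smul_right, norm_smul, mul_pow, h1, Real.norm_eq_abs, sq_abs]
    ring
  have hqsplit : ∀ η : E, q η = M * ‖η - ⟪η, e⟫ • e‖ ^ 2 - ε * ⟪η, e⟫ ^ 2 := by
    intro η
    simp only [hqdef]; rw [hsplit η]; ring
  set S : Set E := {p | ⟪p - a, e⟫ ∈ Icc 0 l ∧ ‖p - a - ⟪p - a, e⟫ • e‖ ≤ w0} with hS
  have hpdec : ∀ p, p = (a + ⟪p - a, e⟫ • e) + (p - a - ⟪p - a, e⟫ • e) := by
    intro p; abel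
  have haxis : ∀ θ ∈ Icc 0 l, a + θ • e ∈ segment ℝ a b := by
    intro θ hθ
    rw [segment_eq_image']
    refine ⟨θ / l, ⟨div_nonneg hθ.1 hl0.le, (div_le_one hl0).2 hθ.2⟩, ?_⟩
    simp only
    rw [← hle, smul_smul, div_mul_cancel₀ _ hl0.ne']
  have hSw : S ⊆ cthickening w1 (segment ℝ a b) := by
    intro p hp
    refine mem_cthickening_of_dist_le p _ w1 _ (haxis _ hp.1) ?_
    rw [dist_eq_norm]
    calc ‖p - (a + ⟪p - a, e⟫ • e)‖ = ‖p - a - ⟪p - a, e⟫ • e‖ := by congr 1; abel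
      _ ≤ w0 := hp.2
      _ ≤ w1 := min_le_left _ _
  have hScl : IsClosed S := by
    have h1 : Continuous fun p : E => ⟪p - a, e⟫ := by fun_prop
    have h2 : Continuous fun p : E => ‖p - a - ⟪p - a, e⟫ • e‖ := by fun_prop
    exact (isClosed_Icc.preimage h1).inter (isClosed_le h2 continuous_const)
  have hScomp : IsCompact S := hcth.of_isClosed_subset hScl hSw
  have hSK : S ⊆ K := hSw.trans hw1K
  set J : E → ℝ := fun p => f p - q (p - a) with hJ
  have hc0a : c0 - a = (t * l) • e := by
    rw [mul_smul, hle, hc0, show s = 1 - t by linarith]; module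
  have hc0e : ⟪c0 - a, e⟫ = t * l := by rw [hc0a, inner_smul_left, hee]; simp
  have hc0S : c0 ∈ S := by
    refine ⟨?_, ?_⟩
    · rw [hc0e]; constructor
      · positivity
      · exact mul_le_of_le_one_left hl0.le (by linarith)
    · rw [hc0e, ← hc0a, sub_self, norm_zero]; exact hw0p.le
  have hJc0 : f c0 ≤ J c0 := by
    simp only [hJ]
    rw [hqsplit, hc0e, ← hc0a, sub_self, norm_zero]
    have h1 := mul_nonneg hε0.le (sq_nonneg (t * l))
    rw [zero_pow two_ne_zero, mul_zero]
    linarith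
  obtain ⟨p, hpS, hpmax⟩ := hScomp.exists_isMaxOn ⟨c0, hc0S⟩
    (show ContinuousOn J S from (hcont.mono hSK).sub
      (hqc.comp (continuous_id.sub continuous_const)).continuousOn)
  have hJp : f c0 ≤ J p := hJc0.trans (hpmax hc0S)
  have hpK := hSK hpS
  have hθ2 : ⟪p - a, e⟫ ^ 2 ≤ l ^ 2 := pow_le_pow_left₀ hpS.1.1 hpS.1.2 2
  have hεθ : ε * ⟪p - a, e⟫ ^ 2 < μ / 4 :=
    (mul_le_mul_of_nonneg_left hθ2 hε0.le).trans_lt hεμ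
  have hJle : J p ≤ f p + μ / 4 - M * ‖p - a - ⟪p - a, e⟫ • e‖ ^ 2 := by
    simp only [hJ]; rw [hqsplit]; linarith
  -- The maximum of `J` is at least `f c0 = r + μ`. On the end discs `J < r + μ / 2 + μ / 4`, and on
  -- the lateral boundary the penalty makes `J` smaller still than `f c0`.
  have hstrict : ⟪p - a, e⟫ ∈ Ioo 0 l ∧ ‖p - a - ⟪p - a, e⟫ • e‖ < w0 := by
    have hwn : 0 ≤ M * ‖p - a - ⟪p - a, e⟫ • e‖ ^ 2 := by positivity
    refine ⟨⟨lt_of_le_of_ne hpS.1.1 ?_, lt_of_le_of_ne hpS.1.2 ?_⟩, lt_of_le_of_ne hpS.2 ?_⟩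
    · intro h0
      have h1 := hna (p - a - ⟪p - a, e⟫ • e)
        (hpS.2.trans ((min_le_right _ _).trans (min_le_left _ _)))
      rw [← h0, zero_smul, sub_zero, add_sub_cancel] at h1
      linarith
    · intro h0
      have h1 := hnb (p - a - ⟪p - a, e⟫ • e)
        (hpS.2.trans ((min_le_right _ _).trans (min_le_right _ _)))
      rw [h0, hle] at h1
      rw [show b + (p - a - (b - a)) = p by abel] at h1
      linarith
    · intro h0
      have h1 : f p ≤ Fb := hFb ⟨p, hSw hpS, rfl⟩
      rw [h0, hMw] at hJle
      have := le_abs_self (Fb - f c0)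
      linarith
  have hSnhds : S ∈ 𝓝 p := by
    have h1 : ∀ᶠ p' in 𝓝 p, ⟪p' - a, e⟫ ∈ Ioo 0 l :=
      (show Continuous fun p' : E => ⟪p' - a, e⟫ by fun_prop).continuousAt.eventually
        (isOpen_Ioo.mem_nhds hstrict.1)
    have h2 : ∀ᶠ p' in 𝓝 p, ‖p' - a - ⟪p' - a, e⟫ • e‖ < w0 :=
      (show Continuous fun p' : E => ‖p' - a - ⟪p' - a, e⟫ • e‖ by
        fun_prop).continuousAt.eventually (gt_mem_nhds hstrict.2)
    filter_upwards [h1, h2] with p' h1 h2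
    exact ⟨Ioo_subset_Icc_self h1, h2.le⟩
  have hloc : IsLocalMax J p := hpmax.isLocalMax hSnhds
  set B : E →L[ℝ] ℝ := (2 * M) • innerSL ℝ (p - a) - (2 * (M + ε) * ⟪p - a, e⟫) • innerSL ℝ e
    with hB
  have hBapp : ∀ η, B η = 2 * M * ⟪p - a, η⟫ - 2 * (M + ε) * ⟪p - a, e⟫ * ⟪η, e⟫ := by
    intro η
    simp only [hB, _root_.sub_apply, _root_.smul_apply,
      innerSL_apply_apply, smul_eq_mul, real_inner_comm e η]
  -- The expansion of a quadratic form is exact. The local maximality of `J` is therefore already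
  -- the touching inequality, once `f' p` is identified with `B`.
  have hexp : ∀ p', q (p' - a) = q (p - a) + B (p' - p) + q (p' - p) := by
    intro p'
    obtain ⟨η, rfl⟩ : ∃ η, p' = p + η := ⟨p' - p, by abel⟩
    rw [hBapp]
    simp only [hqdef, add_sub_cancel_left]
    rw [show p + η - a = (p - a) + η by abel, norm_add_sq_real, inner_add_left]
    ring
  have hderq : HasFDerivAt (fun p' => q (p' - a)) B p := by
    rw [hasFDerivAt_iff_isLittleO]
    have h1 : (fun p' => q (p' - a) - q (p - a) - B (p' - p)) = fun p' => q (p' - p) := by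
      funext p'; rw [hexp p']; ring
    rw [h1]
    have h2 : (fun p' : E => q (p' - p)) =O[𝓝 p] fun p' => ‖p' - p‖ ^ 2 := by
      refine Asymptotics.IsBigO.of_bound (M + (M + ε) * ‖e‖ ^ 2) (Eventually.of_forall fun p' => ?_)
      have h3 : |⟪p' - p, e⟫| ≤ ‖p' - p‖ * ‖e‖ := abs_real_inner_le_norm _ _
      have h4 : ⟪p' - p, e⟫ ^ 2 ≤ (‖p' - p‖ * ‖e‖) ^ 2 := by
        rw [← sq_abs]; exact pow_le_pow_left₀ (abs_nonneg _) h3 2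
      have h5 : 0 ≤ M + ε := by linarith
      have h6 : 0 ≤ M * ‖p' - p‖ ^ 2 := by positivity
      have h7 : 0 ≤ (M + ε) * ⟪p' - p, e⟫ ^ 2 := by positivity
      have h8 : 0 ≤ (M + ε) * (‖p' - p‖ * ‖e‖) ^ 2 := by positivity
      rw [Real.norm_eq_abs, Real.norm_eq_abs, abs_of_nonneg (by positivity : 0 ≤ ‖p' - p‖ ^ 2), abs_le]
      have h9 := mul_le_mul_of_nonneg_left h4 h5
      have h10 : (M + (M + ε) * ‖e‖ ^ 2) * ‖p' - p‖ ^ 2 =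
          M * ‖p' - p‖ ^ 2 + (M + ε) * (‖p' - p‖ * ‖e‖) ^ 2 := by ring
      rw [h10]
      simp only [hqdef]
      constructor <;> linarith
    refine h2.trans_isLittleO ?_
    have := (Asymptotics.isLittleO_norm_pow_id (E' := E) one_lt_two).comp_tendsto
      (show Tendsto (fun p' => p' - p) (𝓝 p) (𝓝 0) by
        simpa using (continuous_id.sub continuous_const).tendsto (x := p) (f := fun p' => p' - p))
    simpa [Function.comp_def] using this
  have hzero := hloc.hasFDerivAt_eq_zero ((hf p hpK).sub hderq)
  have hgrad : ∀ η, ⟪f' p, η⟫ = B η := by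
    intro η
    have := congrArg (fun L : E →L[ℝ] ℝ => L η) hzero
    simp only [_root_.sub_apply, innerSL_apply_apply, _root_.zero_apply] at this
    linarith
  have hh0 : 0 < ‖f' p‖ := hc.trans_le (hfc p hpK)
  have hge : ⟪f' p, e⟫ = -2 * ε * ⟪p - a, e⟫ := by
    rw [hgrad, hBapp, hee]; ring
  -- `e` is only nearly tangent to the level set. The squared cosine `s2` of its angle with `f' p`
  -- is of order `ε²`, whereas `q` stays negative on the projection as long as `(M + ε) s2 < ε`.
  set s1 := ⟪e, f' p⟫ / ‖f' p‖ ^ 2 with hs1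
  set e1 := e - s1 • f' p with he1
  have horth : ⟪f' p, e1⟫ = 0 := by
    rw [he1, inner_sub_right, inner_smul_right, real_inner_self_eq_norm_sq, hs1,
      div_mul_cancel₀ _ (by positivity), real_inner_comm, sub_self]
  have hs2 : s1 * ⟪f' p, e⟫ = ⟪f' p, e⟫ ^ 2 / ‖f' p‖ ^ 2 := by
    rw [hs1, real_inner_comm]; ring
  set s2 := ⟪f' p, e⟫ ^ 2 / ‖f' p‖ ^ 2 with hs2'
  have he1e : ⟪e1, e⟫ = 1 - s2 := by
    rw [he1, inner_sub_left, inner_smul_left, hee]; simp [hs2]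
  have he1n : ‖e1‖ ^ 2 = 1 - s2 := by
    rw [← real_inner_self_eq_norm_sq]
    conv_lhs => rw [he1]
    rw [inner_sub_left, inner_smul_left, horth, real_inner_comm, he1e]; simp
  have hs2n : 0 ≤ s2 := by positivity
  have hs2le : (M + ε) * s2 < ε := by
    have h1 : s2 ≤ (2 * ε * l) ^ 2 / c ^ 2 := by
      rw [hs2', hge]
      have h2 : (-2 * ε * ⟪p - a, e⟫) ^ 2 ≤ (2 * ε * l) ^ 2 := by
        have : (2 * ε) ^ 2 * ⟪p - a, e⟫ ^ 2 ≤ (2 * ε) ^ 2 * l ^ 2 :=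
          mul_le_mul_of_nonneg_left hθ2 (by positivity)
        rw [show (-2 * ε * ⟪p - a, e⟫) ^ 2 = (2 * ε) ^ 2 * ⟪p - a, e⟫ ^ 2 by ring,
          show (2 * ε * l) ^ 2 = (2 * ε) ^ 2 * l ^ 2 by ring]
        exact this
      exact div_le_div₀ (by positivity) h2 (by positivity) (pow_le_pow_left₀ hc.le (hfc p hpK) 2)
    have h3 : (M + ε) * s2 ≤ (M + 1) * ((2 * ε * l) ^ 2 / c ^ 2) :=
      mul_le_mul (by linarith) h1 hs2n (by linarith)
    have h4 : (M + 1) * ((2 * ε * l) ^ 2 / c ^ 2) = ε * ((4 * (M + 1) * ε * l ^ 2) / c ^ 2) := by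
      ring
    have h5 : (4 * (M + 1) * ε * l ^ 2) / c ^ 2 < 1 := (div_lt_one (by positivity)).2 hεc
    rw [h4] at h3
    exact h3.trans_lt (mul_lt_of_lt_one_right hε0 h5)
  have hs2lt : s2 < 1 := by
    by_contra! h1
    have := le_mul_of_one_le_right (show 0 ≤ M + ε by linarith) h1
    linarith
  have hqe1 : q e1 < 0 := by
    simp only [hqdef]
    rw [he1n, he1e]
    have h1 : M * (1 - s2) - (M + ε) * (1 - s2) ^ 2 = (1 - s2) * ((M + ε) * s2 - ε) := by ring
    rw [h1]
    exact mul_neg_of_pos_of_neg (by linarith) (by linarith)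
  have he1pos : 0 < ‖e1‖ := by
    rw [norm_pos_iff]
    intro h0
    rw [h0, norm_zero] at he1n
    norm_num at he1n; linarith
  refine ⟨p, hpK, q, hqc, hqr, ?_, ‖e1‖⁻¹ • e1, ?_, ?_, ?_⟩
  · filter_upwards [hloc] with p' hp'
    simp only [hJ] at hp'
    rw [hexp p'] at hp'
    rw [hgrad]; linarith
  · rw [norm_smul, norm_inv, norm_norm, inv_mul_cancel₀ he1pos.ne']
  · rw [inner_smul_right, horth, mul_zero]
  · rw [hqr]; exact mul_neg_of_pos_of_neg (by positivity) hqe1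

end Calculus
end GenFun


namespace GenFun
open Set Filter Topology Metric
open scoped RealInnerProductSpace NNReal

/-! ### Simplices, uniform differentiability, and curves given by near-identity maps. -/

section Calculus
variable {E : Type*} [NormedAddCommGroup E] [InnerProductSpace ℝ E]

theorem exists_orthonormalBasis_of_orthonormal_pair [FiniteDimensional ℝ E] {a c : E}
    (ha : ‖a‖ = 1) (hc : ‖c‖ = 1) (hac : ⟪a, c⟫ = 0) :
    ∃ (u : Finset E) (b : OrthonormalBasis u ℝ E) (i j : u), i ≠ j ∧ b i = a ∧ b j = c := by
  have hne : a ≠ c := by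
    rintro rfl
    rw [real_inner_self_eq_norm_sq, ha] at hac
    norm_num at hac
  have ho : Orthonormal ℝ ((↑) : ({a, c} : Set E) → E) := by
    refine ⟨?_, ?_⟩
    · rintro ⟨x, rfl | rfl⟩ <;> assumption
    · rintro ⟨x, rfl | rfl⟩ ⟨y, rfl | rfl⟩ hxy
      · exact absurd rfl hxy
      · exact hac
      · rw [real_inner_comm]; exact hac
      · exact absurd rfl hxy
  obtain ⟨u, b, hu, hb⟩ := ho.exists_orthonormalBasis_extension
  refine ⟨u, b, ⟨a, hu (by simp)⟩, ⟨c, hu (by simp)⟩, ?_, ?_, ?_⟩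
  · simpa using hne
  · rw [hb]
  · rw [hb]

/-- Degenerate case: `s i₁ = b i₁`, `s i₀ = -b i₁` and the other vectors zero, where the sum is `2 q
(b i₁) < 0`. Giving the other vectors a small length `δ > 0` makes the simplex nondegenerate and, by
continuity, keeps the sign. -/
theorem exists_simplex_sum_neg {ι : Type*} [Fintype ι] [DecidableEq ι]
    (b : OrthonormalBasis ι ℝ E) {i₀ i₁ : ι} (hi : i₀ ≠ i₁) {q : E → ℝ} (hq : Continuous q)
    (hqr : ∀ (r : ℝ) η, q (r • η) = r ^ 2 * q η) (hneg : q (b i₁) < 0) :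
    ∃ (d : ι → ℝ) (s : ι → E), (∀ j, 0 < d j) ∧ (∀ j, j ≠ i₀ → s j = d j • b j) ∧
      ∑ j, s j = 0 ∧ (∀ j, ⟪b i₀, s j⟫ = 0) ∧ ∑ j, q (s j) < 0 := by
  set d : ℝ → ι → ℝ := fun δ j => if j = i₁ then 1 else δ with hd
  set s : ℝ → ι → E := fun δ j =>
    if j = i₀ then -∑ k ∈ Finset.univ.erase i₀, d δ k • b k else d δ j • b j with hs
  have hdc : ∀ j, Continuous fun δ => d δ j := by
    intro j
    by_cases hj : j = i₁
    · simp only [hd, hj, if_true]; exact continuous_const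
    · simp only [hd, hj, if_false]; exact continuous_id
  have hsc : ∀ j, Continuous fun δ => s δ j := by
    intro j
    by_cases hj : j = i₀
    · simp only [hs, hj, if_true]
      exact (continuous_finsetSum _ fun k _ => (hdc k).smul continuous_const).neg
    · simp only [hs, hj, if_false]
      exact (hdc j).smul continuous_const
  have hF : Continuous fun δ => ∑ j, q (s δ j) :=
    continuous_finsetSum _ fun j _ => hq.comp (hsc j)
  have hq0 : q 0 = 0 := by simpa using hqr 0 0
  have hqn : ∀ η, q (-η) = q η := by intro η; simpa using hqr (-1) η
  have hF0 : ∑ j, q (s 0 j) < 0 := by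
    have h1 : ∑ k ∈ Finset.univ.erase i₀, d 0 k • b k = b i₁ := by
      rw [Finset.sum_eq_single_of_mem i₁ (by simp [hi.symm])]
      · simp [hd]
      · intro k _ hk; simp [hd, hk]
    rw [← Finset.add_sum_erase _ _ (Finset.mem_univ i₀)]
    have h2 : ∑ j ∈ Finset.univ.erase i₀, q (s 0 j) = q (b i₁) := by
      rw [Finset.sum_eq_single_of_mem i₁ (by simp [hi.symm])]
      · simp [hs, hd, hi.symm]
      · intro k hk hk1
        have hk0 : k ≠ i₀ := (Finset.mem_erase.1 hk).1
        simp [hs, hd, hk1, hk0, hq0]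
    have h3 : s 0 i₀ = -b i₁ := by
      simp only [hs, if_true]; rw [h1]
    rw [h2, h3, hqn]; linarith
  have hev : ∀ᶠ δ in 𝓝[>] (0:ℝ), ∑ j, q (s δ j) < 0 :=
    (hF.continuousAt.eventually (gt_mem_nhds hF0)).filter_mono nhdsWithin_le_nhds
  obtain ⟨δ, hδ, hδ0⟩ := (hev.and eventually_mem_nhdsWithin).exists
  refine ⟨d δ, s δ, ?_, ?_, ?_, ?_, hδ⟩
  · intro j
    by_cases hj : j = i₁
    · simp [hd, hj]
    · simpa [hd, hj] using hδ0
  · intro j hj; simp [hs, hj]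
  · rw [← Finset.add_sum_erase _ _ (Finset.mem_univ i₀)]
    have : ∑ j ∈ Finset.univ.erase i₀, s δ j = ∑ k ∈ Finset.univ.erase i₀, d δ k • b k :=
      Finset.sum_congr rfl fun k hk => by simp [hs, (Finset.mem_erase.1 hk).1]
    rw [this]; simp [hs]
  · intro j
    by_cases hj : j = i₀
    · simp only [hs, hj, if_true, inner_neg_right, inner_sum, neg_eq_zero]
      refine Finset.sum_eq_zero fun k hk => ?_
      rw [inner_smul_right, b.inner_eq_zero (Finset.mem_erase.1 hk).1.symm, mul_zero]
    · simp only [hs, hj, if_false]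
      rw [inner_smul_right, b.inner_eq_zero (Ne.symm hj), mul_zero]

/-- Strict differentiability in the second variable, with one radius for all `x ∈ C`: the tube lemma
around `C × {p}` bounds the oscillation of the derivative, and the mean value inequality does the
rest. -/
theorem uniform_differentiability {X Y F : Type*} [NormedAddCommGroup X] [NormedSpace ℝ X]
    [NormedAddCommGroup Y] [NormedSpace ℝ Y] [NormedAddCommGroup F] [NormedSpace ℝ F]
    {f : X × Y → F} {B : Set X} {K : Set Y} (hB : IsOpen B) (hK : IsOpen K)
    (hf : ContDiffOn ℝ 1 f (B ×ˢ K)) {C : Set X} (hC : IsCompact C) (hCB : C ⊆ B) {p : Y}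
    (hp : p ∈ K) {η : ℝ} (hη : 0 < η) :
    ∃ r > 0, ball p r ⊆ K ∧ ∀ x ∈ C, ∀ a ∈ ball p r, ∀ b ∈ ball p r,
      ‖f (x, a) - f (x, b) - fderiv ℝ f (x, p) (0, a - b)‖ ≤ η * ‖a - b‖ := by
  have hO : IsOpen (B ×ˢ K) := hB.prod hK
  have hcd : ContinuousOn (fderiv ℝ f) (B ×ˢ K) := hf.continuousOn_fderiv_of_isOpen hO le_rfl
  have hcd2 : ContinuousOn (fun w : X × Y => fderiv ℝ f (w.1, w.2) - fderiv ℝ f (w.1, p))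
      (B ×ˢ K) := by
    refine (hcd.comp (by fun_prop) fun w hw => hw).sub (hcd.comp (by fun_prop) ?_)
    exact fun w hw => ⟨hw.1, hp⟩
  have hopen : IsOpen ((B ×ˢ K) ∩
      (fun w : X × Y => fderiv ℝ f (w.1, w.2) - fderiv ℝ f (w.1, p)) ⁻¹' ball 0 η) :=
    hcd2.isOpen_inter_preimage hO isOpen_ball
  obtain ⟨u, v, hu, hv, hCu, hpv, huv⟩ := generalized_tube_lemma hC (isCompact_singleton (x := p))
    hopen (by
      rintro ⟨x, y⟩ ⟨hx, rfl⟩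
      exact ⟨⟨hCB hx, hp⟩, by simpa using hη⟩)
  obtain ⟨r, hr, hrv⟩ := Metric.isOpen_iff.1 (hv.inter hK) p ⟨hpv rfl, hp⟩
  refine ⟨r, hr, fun y hy => (hrv hy).2, ?_⟩
  · intro x hx a ha b hb
    have hmem : ∀ y ∈ ball p r, (x, y) ∈ B ×ˢ K ∧
        ‖fderiv ℝ f (x, y) - fderiv ℝ f (x, p)‖ < η := by
      intro y hy
      have := huv (show (x, y) ∈ u ×ˢ v from ⟨hCu hx, (hrv hy).1⟩)
      exact ⟨this.1, by simpa using this.2⟩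
    set L : Y →L[ℝ] X × Y := ContinuousLinearMap.inr ℝ X Y
    have hder : ∀ y ∈ ball p r, HasFDerivWithinAt (fun y => f (x, y))
        ((fderiv ℝ f (x, y)).comp L) (ball p r) y := by
      intro y hy
      have h1 : HasFDerivAt f (fderiv ℝ f (x, y)) (x, y) :=
        ((hf.contDiffAt (hO.mem_nhds (hmem y hy).1)).differentiableAt one_ne_zero).hasFDerivAt
      exact (h1.comp y (hasFDerivAt_prodMk_right x y)).hasFDerivWithinAt
    have := (convex_ball p r).norm_image_sub_le_of_norm_hasFDerivWithin_le'
      (φ := (fderiv ℝ f (x, p)).comp L) (C := η) hder (fun y hy => ?_) hb ha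
    · simpa [L] using this
    · rw [← ContinuousLinearMap.sub_comp]
      refine (ContinuousLinearMap.opNorm_comp_le _ _).trans ?_
      calc _ ≤ η * 1 := mul_le_mul (hmem y hy).2.le (ContinuousLinearMap.norm_inr_le_one ℝ X Y)
            (norm_nonneg _) hη.le
        _ = η := mul_one η

/-- The curve is `σ t = Ψ⁻¹ (t • Ψ x₁)`. The quantitative inverse function theorem ensures that
`Ψ⁻¹` is defined on the whole segment from `0` to `Ψ x₁`. -/
theorem exists_curve_of_near_identity [FiniteDimensional ℝ E] [Nontrivial E] {x₀ x₁ : E} {ρ : ℝ}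
    {Ψ : E → E} {T : E → E →L[ℝ] E} (hΨ : ContDiffOn ℝ 1 Ψ (ball x₀ ρ))
    (hT : ∀ x ∈ ball x₀ ρ, HasFDerivAt Ψ (T x) x)
    (hT1 : ∀ x ∈ ball x₀ ρ, ∀ y, ‖T x y - y‖ ≤ 1 / 4 * ‖y‖)
    (h0 : Ψ x₀ = 0) (hx₁ : x₁ ∈ ball x₀ ρ) (hw : ‖Ψ x₁‖ < ρ / 2) :
    ∃ σ ξ : ℝ → E, σ 0 = x₀ ∧ σ 1 = x₁ ∧ ∀ t ∈ Icc (0:ℝ) 1, σ t ∈ ball x₀ ρ ∧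
      HasDerivAt σ (ξ t) t ∧ ContinuousAt ξ t ∧ Ψ (σ t) = t • Ψ x₁ ∧ T (σ t) (ξ t) = Ψ x₁ := by
  have hρ : 0 < ρ := pos_of_mem_ball hx₁
  have happ : ApproximatesLinearOn Ψ ((ContinuousLinearEquiv.refl ℝ E : E ≃L[ℝ] E) : E →L[ℝ] E)
      (ball x₀ ρ) (1 / 4) := by
    intro x hx y hy
    have := (convex_ball x₀ ρ).norm_image_sub_le_of_norm_hasFDerivWithin_le'
      (φ := ((ContinuousLinearEquiv.refl ℝ E : E ≃L[ℝ] E) : E →L[ℝ] E)) (C := 1 / 4)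
      (fun z hz => (hT z hz).hasFDerivWithinAt) (fun z hz => ?_) hy hx
    · simpa using this
    · exact ContinuousLinearMap.opNorm_le_bound _ (by norm_num) fun y => by simpa using hT1 z hz y
  have hN : ‖(((ContinuousLinearEquiv.refl ℝ E).symm : E ≃L[ℝ] E) : E →L[ℝ] E)‖₊ = 1 := by
    ext
    simp
  have hc : Subsingleton E ∨
      (1 / 4 : ℝ≥0) < ‖(((ContinuousLinearEquiv.refl ℝ E).symm : E ≃L[ℝ] E) : E →L[ℝ] E)‖₊⁻¹ := by
    right
    rw [hN]; norm_num
  set Φ := happ.toOpenPartialHomeomorph Ψ (ball x₀ ρ) hc isOpen_ball with hΦ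
  have hΦc : (Φ : E → E) = Ψ := rfl
  have hΦs : Φ.source = ball x₀ ρ := rfl
  have htar : ∀ t ∈ Icc (0:ℝ) 1, t • Ψ x₁ ∈ Φ.target := by
    intro t ht
    -- The image contains the ball of radius `(1 - 1 / 4) (2 / 3) ρ = ρ / 2` about `0`.
    have hsub := happ.closedBall_subset_target (f := Ψ) hc isOpen_ball (b := x₀) (ε := 2 / 3 * ρ)
      (by positivity) (closedBall_subset_ball (by linarith))
    refine hsub ?_
    rw [h0, mem_closedBall, dist_zero_right, norm_smul, hN]
    have h1 : ‖t‖ ≤ 1 := by rw [Real.norm_eq_abs, abs_le]; constructor <;> linarith [ht.1, ht.2]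
    have h2 : ‖t‖ * ‖Ψ x₁‖ ≤ ‖Ψ x₁‖ := mul_le_of_le_one_left (norm_nonneg _) h1
    push_cast
    linarith
  have hsymm : ∀ y ∈ Φ.target, Φ.symm y ∈ ball x₀ ρ ∧ Ψ (Φ.symm y) = y := by
    intro y hy
    exact ⟨hΦs ▸ Φ.map_target hy, Φ.right_inv hy⟩
  have hinj : ∀ x ∈ ball x₀ ρ, Function.Injective (T x) := by
    intro x hx
    refine (injective_iff_map_eq_zero (T x)).2 fun y hy => ?_
    have h1 := hT1 x hx y
    rw [hy, zero_sub, norm_neg] at h1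
    exact norm_le_zero_iff.1 (by linarith [norm_nonneg y])
  have hcd : ∀ y ∈ Φ.target, ContDiffAt ℝ 1 Φ.symm y := by
    intro y hy
    have hm := (hsymm y hy).1
    set e : E ≃L[ℝ] E :=
      (LinearEquiv.ofInjectiveEndo (T (Φ.symm y) : E →ₗ[ℝ] E) (hinj _ hm)).toContinuousLinearEquiv
    refine Φ.contDiffAt_symm (f₀' := e) hy ?_ ?_
    · have : (e : E →L[ℝ] E) = T (Φ.symm y) := by
        ext z; rfl
      rw [this]
      exact hT _ hm
    · exact hΨ.contDiffAt (isOpen_ball.mem_nhds hm)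
  set σ : ℝ → E := fun t => Φ.symm (t • Ψ x₁) with hσ
  have hσcd : ∀ t ∈ Icc (0:ℝ) 1, ContDiffAt ℝ 1 σ t := by
    intro t ht
    exact (hcd _ (htar t ht)).comp t (by fun_prop)
  refine ⟨σ, deriv σ, ?_, ?_, fun t ht => ⟨(hsymm _ (htar t ht)).1, ?_, ?_, ?_, ?_⟩⟩
  · have : Φ.symm (Φ x₀) = x₀ := Φ.left_inv (by rw [hΦs]; exact mem_ball_self hρ)
    rw [hΦc, h0] at this
    simpa [hσ] using this
  · have : Φ.symm (Φ x₁) = x₁ := Φ.left_inv (by rw [hΦs]; exact hx₁)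
    rw [hΦc] at this
    simpa [hσ] using this
  · exact ((hσcd t ht).differentiableAt one_ne_zero).hasDerivAt
  · have h1 : ContinuousAt (fderiv ℝ σ) t := ((hσcd t ht).fderiv_right (m := 0) le_rfl).continuousAt
    exact h1.clm_apply continuousAt_const
  · exact (hsymm _ (htar t ht)).2
  · have h1 : HasDerivAt σ (deriv σ t) t := ((hσcd t ht).differentiableAt one_ne_zero).hasDerivAt
    have h2 : HasDerivAt (fun s => Ψ (σ s)) (T (σ t) (deriv σ t)) t :=
      (hT _ (hsymm _ (htar t ht)).1).comp_hasDerivAt t h1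
    have h3 : HasDerivAt (fun s : ℝ => s • Ψ x₁) (Ψ x₁) t := by
      simpa using (hasDerivAt_id t).smul_const (Ψ x₁)
    refine h2.unique (h3.congr_of_eventuallyEq ?_)
    have h4 : ∀ᶠ s in 𝓝 t, s • Ψ x₁ ∈ Φ.target :=
      (show ContinuousAt (fun s : ℝ => s • Ψ x₁) t by fun_prop).eventually
        (Φ.open_target.mem_nhds (htar t ht))
    filter_upwards [h4] with s hs
    exact (hsymm _ hs).2

end Calculus
end GenFun


namespace GenFun
open Set Filter Topology Metric
open scoped RealInnerProductSpace NNReal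

/-! ### Convex combinations of gradients, the local model, and the sign of the derivative at a zero.
-/

section Calculus
variable {E : Type*} [NormedAddCommGroup E] [InnerProductSpace ℝ E]

/-- The map `z ↦ ∑ ⟪b j, z⟫ • r j` is adjoint to the map in the hypothesis, hence equally close to
the identity. It is thus invertible, with inverse of norm at most `4 / 3`. -/
theorem exists_coeff_of_near_identity [FiniteDimensional ℝ E] {ι : Type*} [Fintype ι]
    (b : OrthonormalBasis ι ℝ E) {r : ι → E}
    (hr : ∀ y, ‖∑ j, ⟪r j, y⟫ • b j - y‖ ≤ 1 / 4 * ‖y‖) (a : E) :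
    ∃ β : ι → ℝ, a = ∑ j, β j • r j ∧ ∀ j, |β j| ≤ 4 / 3 * ‖a‖ := by
  set S : E →L[ℝ] E := ∑ j, (innerSL ℝ (b j)).smulRight (r j) with hS
  have hSz : ∀ z, S z = ∑ j, ⟪b j, z⟫ • r j := by
    intro z; simp [hS, sum_apply]
  have hS1 : ∀ z, ‖S z - z‖ ≤ 1 / 4 * ‖z‖ := by
    intro z
    have h0 : ∀ y, ⟪S z - z, y⟫ = ⟪z, ∑ j, ⟪r j, y⟫ • b j - y⟫ := by
      intro y
      rw [inner_sub_right, inner_sum, inner_sub_left, hSz, sum_inner]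
      congr 1
      refine Finset.sum_congr rfl fun j _ => ?_
      rw [inner_smul_left, inner_smul_right, real_inner_comm z]
      simp; ring
    have h1 := h0 (S z - z)
    have h2 : ‖S z - z‖ * ‖S z - z‖ ≤ ‖z‖ * (1 / 4 * ‖S z - z‖) := by
      rw [← real_inner_self_eq_norm_mul_norm, h1]
      exact (real_inner_le_norm _ _).trans (mul_le_mul_of_nonneg_left (hr _) (norm_nonneg _))
    rcases (norm_nonneg (S z - z)).eq_or_lt with h0 | h0
    · rw [← h0]; positivity
    · exact le_of_mul_le_mul_right (by linarith) h0
  have hnorm : ∀ z, ‖z‖ ≤ 4 / 3 * ‖S z‖ := by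
    intro z
    have h1 := hS1 z
    have h2 : ‖z‖ ≤ ‖S z‖ + ‖S z - z‖ := by
      calc ‖z‖ = ‖S z - (S z - z)‖ := by congr 1; abel
        _ ≤ _ := norm_sub_le _ _
    linarith
  have hinj : Function.Injective (S : E →ₗ[ℝ] E) := by
    refine (injective_iff_map_eq_zero _).2 fun z hz => ?_
    have h1 := hnorm z
    rw [show S z = 0 from hz, norm_zero, mul_zero] at h1
    exact norm_le_zero_iff.1 h1
  obtain ⟨z, hz⟩ := (LinearMap.injective_iff_surjective.1 hinj) a
  have hz' : S z = a := hz
  refine ⟨fun j => ⟪b j, z⟫, by rw [← hz', hSz], fun j => ?_⟩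
  calc |⟪b j, z⟫| ≤ ‖b j‖ * ‖z‖ := abs_real_inner_le_norm _ _
    _ = ‖z‖ := by rw [b.orthonormal.1 j, one_mul]
    _ ≤ 4 / 3 * ‖a‖ := hz' ▸ hnorm z

/-- Since `∑ (P j - m) = 0`, the mean of `γ` may be subtracted from all `γ j`. The resulting weights
sum to `1`, and each is at least `1 / N - 1 / (2N) - 1 / (2N) = 0`, where `N` is the number of
points. -/
theorem exists_convex_combination_near_mean {ι : Type*} [Fintype ι] [Nonempty ι] {P : ι → E}
    {γ : ι → ℝ} (hγ : ∀ j, |γ j| ≤ 1 / (2 * Fintype.card ι)) {m z : E}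
    (hm : m = (Fintype.card ι : ℝ)⁻¹ • ∑ j, P j) (hz : z = m + ∑ j, γ j • (P j - m)) :
    ∃ μ : ι → ℝ, (∀ j, 0 ≤ μ j) ∧ ∑ j, μ j = 1 ∧ z = ∑ j, μ j • P j := by
  obtain ⟨N, hN⟩ : ∃ N : ℝ, N = Fintype.card ι := ⟨_, rfl⟩
  have hNpos : 0 < N := by rw [hN]; exact_mod_cast Fintype.card_pos
  rw [← hN] at hγ hm
  refine ⟨fun j => N⁻¹ + γ j - N⁻¹ * ∑ k, γ k, fun j => ?_, ?_, ?_⟩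
  · have h1 : ∑ k, γ k ≤ 1 / 2 := by
      calc ∑ k, γ k ≤ ∑ _k : ι, 1 / (2 * N) :=
            Finset.sum_le_sum fun k _ => (le_abs_self _).trans (hγ k)
        _ = 1 / 2 := by
            rw [Finset.sum_const, Finset.card_univ, nsmul_eq_mul, ← hN]; field_simp
    have h2 := (abs_le.1 (hγ j)).1
    have h3 : N⁻¹ * ∑ k, γ k ≤ N⁻¹ * (1 / 2) := mul_le_mul_of_nonneg_left h1 (by positivity)
    have h4 : (1 : ℝ) / (2 * N) = N⁻¹ * (1 / 2) := by field_simp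
    rw [h4] at h2
    linarith
  · rw [Finset.sum_sub_distrib, Finset.sum_add_distrib, Finset.sum_const, Finset.sum_const,
      Finset.card_univ, nsmul_eq_mul, nsmul_eq_mul, ← hN]
    field_simp; ring
  · have h1 : ∑ j, (N⁻¹ + γ j - N⁻¹ * ∑ k, γ k) • P j =
        N⁻¹ • ∑ j, P j + ∑ j, γ j • P j - (∑ k, γ k) • (N⁻¹ • ∑ j, P j) := by
      simp only [sub_smul, add_smul, Finset.sum_sub_distrib, Finset.sum_add_distrib,
        Finset.smul_sum, smul_smul, mul_comm]
    rw [h1, ← hm, hz]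
    simp only [smul_sub, Finset.sum_sub_distrib, Finset.sum_smul]
    abel

/-- Local data for the comparison argument. Here `G x p` is the value at `x` of the function with
gradient `p` at `x₀`, and `R x u p` is the gradient at `x` of the function with the same parameter
whose value at `x` is `u`; its derivative along a level is `A`, and `A` satisfies A3w on `K'`. -/
structure LocalModel (x₀ : E) (u₀ ρ C : ℝ) (U : Set ℝ) (K K' : Set E) (G : E → E → ℝ)
    (R : E → ℝ → E → E) (A : E → ℝ → E → E →L[ℝ] E) : Prop where
  isOpen_U : IsOpen U
  isOpen_K : IsOpen K
  convex_K : Convex ℝ K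
  contDiffOn_G : ContDiffOn ℝ 1 (fun w : E × E => G w.1 w.2) (ball x₀ ρ ×ˢ K)
  contDiffOn_R : ContDiffOn ℝ 1 (fun w : E × ℝ × E => R w.1 w.2.1 w.2.2) (ball x₀ ρ ×ˢ U ×ˢ K)
  G_mem : ∀ x ∈ ball x₀ ρ, ∀ p ∈ K, G x p ∈ U
  hasFDerivAt_G : ∀ x ∈ ball x₀ ρ, ∀ p ∈ K,
    HasFDerivAt (fun x' => G x' p) (innerSL ℝ (R x (G x p) p)) x
  G_base : ∀ p ∈ K, G x₀ p = u₀
  R_base : ∀ p ∈ K, R x₀ u₀ p = p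
  grad_close : ∀ x ∈ ball x₀ ρ, ∀ p ∈ K, ∀ p' ∈ K,
    ‖R x (G x p) p - R x (G x p') p' - (p - p')‖ ≤ 1 / 8 * ‖p - p'‖
  R_close : ∀ x ∈ ball x₀ ρ, ∀ u ∈ U, ∀ p ∈ K, ∀ p' ∈ K,
    ‖R x u p - R x u p' - (p - p')‖ ≤ 1 / 8 * ‖p - p'‖
  R_lip : ∀ x ∈ ball x₀ ρ, ∀ p ∈ K, ∀ u ∈ U, ∀ u' ∈ U, ‖R x u p - R x u' p‖ ≤ C * |u - u'|
  R_mem : ∀ x ∈ ball x₀ ρ, ∀ u ∈ U, ∀ p ∈ K, R x u p ∈ K'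
  fderiv_R : ∀ x ∈ ball x₀ ρ, ∀ u ∈ U, ∀ p ∈ K, ∀ ξ,
    fderiv ℝ (fun w : E × ℝ × E => R w.1 w.2.1 w.2.2) (x, u, p) (ξ, ⟪R x u p, ξ⟫, 0) =
      A x u (R x u p) ξ
  convexOn : ∀ x ∈ ball x₀ ρ, ∀ u ∈ U, ∀ (ξ : E) (c : ℝ),
    ConvexOn ℝ (K' ∩ {p | ⟪p, ξ⟫ = c}) fun p => ⟪A x u p ξ, ξ⟫

namespace LocalModel

variable {x₀ : E} {u₀ ρ C : ℝ} {U : Set ℝ} {K K' : Set E} {G : E → E → ℝ} {R : E → ℝ → E → E}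
  {A : E → ℝ → E → E →L[ℝ] E} (H : LocalModel x₀ u₀ ρ C U K K' G R A)
include H

theorem differentiableAt_R {x : E} {u : ℝ} {p : E} (hx : x ∈ ball x₀ ρ) (hu : u ∈ U) (hp : p ∈ K) :
    DifferentiableAt ℝ (fun w : E × ℝ × E => R w.1 w.2.1 w.2.2) (x, u, p) :=
  (H.contDiffOn_R.contDiffAt ((isOpen_ball.prod (H.isOpen_U.prod H.isOpen_K)).mem_nhds
    ⟨hx, hu, hp⟩)).differentiableAt one_ne_zero

theorem hasDerivAt_G_curve {σ : ℝ → E} {ξ : E} {t : ℝ} (hσ : HasDerivAt σ ξ t)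
    (ht : σ t ∈ ball x₀ ρ) {p : E} (hp : p ∈ K) :
    HasDerivAt (fun s => G (σ s) p) ⟪R (σ t) (G (σ t) p) p, ξ⟫ t :=
  ((H.hasFDerivAt_G _ ht p hp).comp_hasDerivAt t hσ).congr_deriv (by simp)

/-- The hypothesis on `m` says that at `t` the level changes exactly as the value of the function of
fixed parameter does; this is the direction in which the derivative of `R` is `A`. Motion of the
parameter contributes separately. -/
theorem hasDerivAt_R_curve {σ : ℝ → E} {ξ : E} {t : ℝ} (hσ : HasDerivAt σ ξ t)
    (ht : σ t ∈ ball x₀ ρ) {m : ℝ → ℝ} (hmU : m t ∈ U) {π : ℝ → E} {π' : E} (hπ : HasDerivAt π π' t)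
    (hπK : π t ∈ K) (hm : HasDerivAt m ⟪R (σ t) (m t) (π t), ξ⟫ t) :
    HasDerivAt (fun s => R (σ s) (m s) (π s)) (A (σ t) (m t) (R (σ t) (m t) (π t)) ξ +
      fderiv ℝ (fun w : E × ℝ × E => R w.1 w.2.1 w.2.2) (σ t, m t, π t) (0, 0, π')) t := by
  have h1 := (H.differentiableAt_R ht hmU hπK).hasFDerivAt
  have h2 : HasDerivAt (fun s => (σ s, m s, π s)) (ξ, ⟪R (σ t) (m t) (π t), ξ⟫, π') t :=
    hσ.prodMk (hm.prodMk hπ)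
  have h3 := h1.comp_hasDerivAt (f := fun s => (σ s, m s, π s)) t h2
  have h4 : (ξ, ⟪R (σ t) (m t) (π t), ξ⟫, π') =
      (ξ, ⟪R (σ t) (m t) (π t), ξ⟫, (0 : E)) + (0, 0, π') := by simp
  rw [h4, map_add, H.fderiv_R _ ht _ hmU _ hπK] at h3
  exact h3

theorem hasDerivAt_grad_curve {σ : ℝ → E} {ξ : E} {t : ℝ} (hσ : HasDerivAt σ ξ t)
    (ht : σ t ∈ ball x₀ ρ) {p : E} (hp : p ∈ K) :
    HasDerivAt (fun s => R (σ s) (G (σ s) p) p)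
      (A (σ t) (G (σ t) p) (R (σ t) (G (σ t) p) p) ξ) t := by
  have h := H.hasDerivAt_R_curve hσ ht (m := fun s => G (σ s) p) (H.G_mem _ ht p hp)
    (hasDerivAt_const t p) hp (H.hasDerivAt_G_curve hσ ht hp)
  rwa [show ((0, 0, 0) : E × ℝ × E) = 0 from rfl, map_zero, add_zero] at h

theorem fderiv_R_close {x : E} {u : ℝ} {p : E} (hx : x ∈ ball x₀ ρ) (hu : u ∈ U) (hp : p ∈ K)
    (y : E) :
    ‖fderiv ℝ (fun w : E × ℝ × E => R w.1 w.2.1 w.2.2) (x, u, p) (0, 0, y) - y‖ ≤ 1 / 8 * ‖y‖ := by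
  have h1 : HasFDerivAt (fun p' => R x u p' - p')
      ((fderiv ℝ (fun w : E × ℝ × E => R w.1 w.2.1 w.2.2) (x, u, p)).comp
        ((ContinuousLinearMap.inr ℝ E (ℝ × E)).comp (ContinuousLinearMap.inr ℝ ℝ E)) -
        ContinuousLinearMap.id ℝ E) p := by
    refine HasFDerivAt.sub ?_ (hasFDerivAt_id p)
    have h2 : HasFDerivAt (fun p' : E => (x, u, p'))
        ((ContinuousLinearMap.inr ℝ E (ℝ × E)).comp (ContinuousLinearMap.inr ℝ ℝ E)) p :=
      (hasFDerivAt_prodMk_right x (u, p)).comp p (hasFDerivAt_prodMk_right u p)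
    exact (H.differentiableAt_R hx hu hp).hasFDerivAt.comp p h2
  have h2 : LipschitzOnWith (1 / 8) (fun p' => R x u p' - p') K := by
    refine LipschitzOnWith.of_dist_le_mul fun a ha c hc => ?_
    rw [dist_eq_norm, dist_eq_norm]
    have := H.R_close x hx u hu a ha c hc
    rw [show R x u a - R x u c - (a - c) = R x u a - a - (R x u c - c) by abel] at this
    simpa using this
  have h3 := h1.le_of_lipschitzOn (H.isOpen_K.mem_nhds hp) h2
  have h4 := ContinuousLinearMap.le_of_opNorm_le _ h3 y
  simpa using h4

/-- At a zero, `R (σ t) (m t) (π t)` lies in the hyperplane orthogonal to `ξ t` that contains the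
gradients `P_j` of the functions `G · (p j)`. Being close to their mean, it is a convex combination
`∑ μ j • P_j`. Along the curve it moves by `A` at this point, the combination by `∑ μ j • A(P_j)`,
and convexity of `A` across `ξ t` compares the two. The drift `-ε b i₀` of `π` makes the inequality
strict. -/
theorem deriv_neg_at_zero [FiniteDimensional ℝ E] {ι : Type*} [Fintype ι] [Nonempty ι]
    (b : OrthonormalBasis ι ℝ E) {i₀ : ι} {p : ι → E} (hp : ∀ j, p j ∈ K) {c : ι → ℝ}
    (hc : ∀ j, 0 < c j) {r : ι → E} {σ ξ : ℝ → E} {m : ℝ → ℝ} {π : ℝ → E} {t ω ε : ℝ}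
    (ht0 : 0 ≤ t) (ht1 : t < 1)
    (hσ : ∀ s ∈ Icc (0:ℝ) 1, σ s ∈ ball x₀ ρ) (hσξ : HasDerivAt σ (ξ t) t) (hξ : ContinuousAt ξ t)
    (hGm : ∀ s ∈ Icc (0:ℝ) 1, ∀ j, G (σ s) (p j) = m s)
    {Pm : ℝ → E} (hPm : ∀ s, Pm s = (Fintype.card ι : ℝ)⁻¹ • ∑ j, R (σ s) (G (σ s) (p j)) (p j))
    (hPξ : ∀ s ∈ Icc (0:ℝ) 1, ∀ j, ⟪R (σ s) (G (σ s) (p j)) (p j), ξ s⟫ = ⟪Pm s, ξ s⟫)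
    (hm' : HasDerivAt m ⟪Pm t, ξ t⟫ t)
    (hr0 : ⟪r i₀, ξ t⟫ = ω) (hω : 0 < ω) (hε : 0 < ε)
    (hrj : ∀ j, j ≠ i₀ → c j • r j = R (σ t) (G (σ t) (p j)) (p j) - Pm t)
    (hr : ∀ y, ‖∑ j, ⟪r j, y⟫ • b j - y‖ ≤ 1 / 4 * ‖y‖)
    (hξω : ‖ξ t - ω • b i₀‖ ≤ 1 / 3 * ω)
    (hπ : HasDerivAt π (-(ε • b i₀)) t) (hπK : π t ∈ K)
    (hsmall : ∀ j, ‖R (σ t) (m t) (π t) - Pm t‖ ≤ 3 * c j / (8 * Fintype.card ι))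
    (hz : ⟪R (σ t) (m t) (π t) - Pm t, ξ t⟫ = 0) :
    ∃ k' < 0, HasDerivWithinAt (fun s => ⟪R (σ s) (m s) (π s) - Pm s, ξ s⟫) k' (Ici t) t := by
  have htI : t ∈ Icc (0:ℝ) 1 := ⟨ht0, ht1.le⟩
  have hx := hσ t htI
  have hmU : m t ∈ U := by
    rw [← hGm t htI i₀]; exact H.G_mem _ hx _ (hp i₀)
  obtain ⟨β, hβ, hβn⟩ := exists_coeff_of_near_identity b hr (R (σ t) (m t) (π t) - Pm t)
  have hrξ : ∀ j, j ≠ i₀ → ⟪r j, ξ t⟫ = 0 := by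
    intro j hj
    have h1 : ⟪c j • r j, ξ t⟫ = 0 := by rw [hrj j hj, inner_sub_left, hPξ t htI j, sub_self]
    rw [inner_smul_left] at h1
    exact (mul_eq_zero.1 h1).resolve_left (by simpa using (hc j).ne')
  -- All rows except `r i₀` are orthogonal to `ξ t`, so the vanishing of the product with `ξ t`
  -- removes the coefficient of `r i₀`.
  have hβ0 : β i₀ = 0 := by
    rw [hβ, sum_inner, Finset.sum_eq_single i₀] at hz
    · rw [inner_smul_left, hr0] at hz
      simpa [hω.ne'] using hz
    · intro j _ hj; rw [inner_smul_left, hrξ j hj, mul_zero]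
    · intro h; exact absurd (Finset.mem_univ _) h
  have hN : (0:ℝ) < Fintype.card ι := by exact_mod_cast Fintype.card_pos
  have hγ : ∀ j, |β j / c j| ≤ 1 / (2 * Fintype.card ι) := by
    intro j
    rw [abs_div, abs_of_pos (hc j), div_le_iff₀ (hc j)]
    refine (hβn j).trans ?_
    have := hsmall j
    calc 4 / 3 * ‖R (σ t) (m t) (π t) - Pm t‖ ≤ 4 / 3 * (3 * c j / (8 * Fintype.card ι)) := by
          linarith
      _ = 1 / (2 * Fintype.card ι) * c j := by field_simp; ring
  have hcomb : R (σ t) (m t) (π t) = Pm t +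
      ∑ j, (β j / c j) • (R (σ t) (G (σ t) (p j)) (p j) - Pm t) := by
    have h1 : R (σ t) (m t) (π t) = Pm t + ∑ j, β j • r j := by rw [← hβ]; abel
    rw [h1]
    congr 1
    refine Finset.sum_congr rfl fun j _ => ?_
    by_cases hj : j = i₀
    · rw [hj, hβ0]; simp
    · rw [← hrj j hj, smul_smul, div_mul_cancel₀ _ (hc j).ne']
  obtain ⟨μ, hμ0, hμ1, hμ⟩ := exists_convex_combination_near_mean hγ (hPm t) hcomb
  have hmR : HasDerivAt m ⟪R (σ t) (m t) (π t), ξ t⟫ t := by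
    rw [inner_sub_left, sub_eq_zero] at hz
    rwa [hz]
  have hd1 := H.hasDerivAt_R_curve hσξ hx hmU hπ hπK hmR
  have hd2 : HasDerivAt (fun s => ∑ j, μ j • R (σ s) (G (σ s) (p j)) (p j))
      (∑ j, μ j • A (σ t) (m t) (R (σ t) (m t) (p j)) (ξ t)) t := by
    refine HasDerivAt.fun_sum fun j _ => ?_
    have := H.hasDerivAt_grad_curve hσξ hx (hp j)
    rw [hGm t htI j] at this
    exact this.const_smul (μ j)
  have hd3 := hasDerivAt_inner_of_eq_zero (hd1.sub hd2)
    (by simp only [Pi.sub_apply]; rw [hμ, sub_self]) hξ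
  refine ⟨_, ?_, hd3.hasDerivWithinAt.congr_of_eventuallyEq ?_ ?_⟩
  · have hJ : ⟪A (σ t) (m t) (R (σ t) (m t) (π t)) (ξ t), ξ t⟫ ≤
        ∑ j, μ j * ⟪A (σ t) (m t) (R (σ t) (m t) (p j)) (ξ t), ξ t⟫ := by
      have h1 := (H.convexOn (σ t) hx (m t) hmU (ξ t) ⟪Pm t, ξ t⟫).map_sum_le
        (t := Finset.univ) (w := μ) (p := fun j => R (σ t) (m t) (p j)) (fun j _ => hμ0 j) hμ1
        (fun j _ => ⟨H.R_mem _ hx _ hmU _ (hp j), by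
          have := hPξ t htI j
          rwa [hGm t htI j] at this⟩)
      have h2 : ∑ j, μ j • R (σ t) (m t) (p j) = R (σ t) (m t) (π t) := by
        rw [hμ]
        exact Finset.sum_congr rfl fun j _ => by rw [hGm t htI j]
      simpa [h2] using h1
    -- The product is at least `ω (1 - 1 / 3 - 1 / 6)`.
    have hP : 0 < ⟪fderiv ℝ (fun w : E × ℝ × E => R w.1 w.2.1 w.2.2) (σ t, m t, π t)
        (0, 0, b i₀), ξ t⟫ := by
      set y := fderiv ℝ (fun w : E × ℝ × E => R w.1 w.2.1 w.2.2) (σ t, m t, π t) (0, 0, b i₀)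
      have h1 : ‖y - b i₀‖ ≤ 1 / 8 := by
        simpa [b.orthonormal.1 i₀] using H.fderiv_R_close hx hmU hπK (b i₀)
      have h2 : ⟪y, ξ t⟫ = ω + ⟪b i₀, ξ t - ω • b i₀⟫ + ⟪y - b i₀, ξ t⟫ := by
        rw [inner_sub_right, inner_sub_left, inner_smul_right, real_inner_self_eq_norm_sq,
          b.orthonormal.1 i₀]
        ring
      have h3 : |⟪b i₀, ξ t - ω • b i₀⟫| ≤ 1 / 3 * ω := by
        refine (abs_real_inner_le_norm _ _).trans ?_
        rw [b.orthonormal.1 i₀, one_mul]; exact hξω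
      have h4 : ‖ξ t‖ ≤ 4 / 3 * ω := by
        calc ‖ξ t‖ = ‖(ξ t - ω • b i₀) + ω • b i₀‖ := by congr 1; abel
          _ ≤ ‖ξ t - ω • b i₀‖ + ‖ω • b i₀‖ := norm_add_le _ _
          _ ≤ 1 / 3 * ω + ω := by
            rw [norm_smul, b.orthonormal.1 i₀, mul_one, Real.norm_eq_abs, abs_of_pos hω]
            linarith
          _ = 4 / 3 * ω := by ring
      have h5 : |⟪y - b i₀, ξ t⟫| ≤ 1 / 8 * (4 / 3 * ω) :=
        (abs_real_inner_le_norm _ _).trans (mul_le_mul h1 h4 (norm_nonneg _) (by norm_num))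
      rw [h2]
      have := (abs_le.1 h3).1
      have := (abs_le.1 h5).1
      linarith
    have h6 : ((0, 0, -(ε • b i₀)) : E × ℝ × E) = -ε • (0, 0, b i₀) := by simp
    rw [h6, map_smul, inner_sub_left, inner_add_left, inner_smul_left, sum_inner]
    simp only [inner_smul_left, conj_trivial]
    have := mul_pos hε hP
    linarith
  · have h1 : ∀ᶠ s in 𝓝[≥] t, s ∈ Icc t 1 := Icc_mem_nhdsGE ht1
    filter_upwards [h1] with s hs
    have hsI : s ∈ Icc (0:ℝ) 1 := ⟨ht0.trans hs.1, hs.2⟩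
    simp only [Pi.sub_apply]
    rw [inner_sub_left, inner_sub_left, sum_inner]
    congr 1
    simp only [inner_smul_left, conj_trivial, hPξ s hsI]
    rw [← Finset.sum_mul, hμ1, one_mul]
  · simp only [Pi.sub_apply]
    rw [inner_sub_left, inner_sub_left, sum_inner]
    congr 1
    simp only [inner_smul_left, conj_trivial, hPξ t htI]
    rw [← Finset.sum_mul, hμ1, one_mul]

end LocalModel
end Calculus
end GenFun


namespace GenFun
open Set Filter Topology Metric
open scoped RealInnerProductSpace NNReal

/-! ### Comparison of the value at the mean with the common value. -/

section Calculus
variable {E : Type*} [NormedAddCommGroup E] [InnerProductSpace ℝ E]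

namespace LocalModel

variable {x₀ : E} {u₀ ρ C : ℝ} {U : Set ℝ} {K K' : Set E} {G : E → E → ℝ} {R : E → ℝ → E → E}
  {A : E → ℝ → E → E →L[ℝ] E} (H : LocalModel x₀ u₀ ρ C U K K' G R A)
include H

theorem contDiffOn_G_left {p : E} (hp : p ∈ K) : ContDiffOn ℝ 1 (fun x => G x p) (ball x₀ ρ) :=
  H.contDiffOn_G.comp (f := fun x : E => (x, p)) (by fun_prop) fun _ hx => ⟨hx, hp⟩

theorem continuousAt_R {x : E} {u : ℝ} {p : E} (hx : x ∈ ball x₀ ρ) (hu : u ∈ U) (hp : p ∈ K) :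
    ContinuousAt (fun w : E × ℝ × E => R w.1 w.2.1 w.2.2) (x, u, p) :=
  (H.differentiableAt_R hx hu hp).continuousAt

/-- With the drifting parameter `q - ε t b i₀`, the product `⟪R - P, ξ⟫` starts at zero and has
negative right derivative at each zero before the final time, so it stays nonpositive. As `ε → 0`,
the gradient belonging to `q`, taken at the level `m`, satisfies `⟪R (σ t) (m t) q - P (σ t), ξ t⟫ ≤
0`. Returning from the level `m` to the level `G (σ t) q` costs a multiple of `|G (σ t) q - m t|`,
which Gronwall's argument absorbs. -/
theorem le_along_curve [FiniteDimensional ℝ E] {ι : Type*} [Fintype ι] [Nonempty ι]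
    (b : OrthonormalBasis ι ℝ E) {i₀ : ι} {p : ι → E} (hp : ∀ j, p j ∈ K) {q : E} (hq : q ∈ K)
    {c : ι → ℝ} (hc : ∀ j, 0 < c j) {r : E → ι → E} {σ ξ : ℝ → E} {m : ℝ → ℝ} {ω : ℝ}
    (hω : 0 < ω) {P : E → E}
    (hP : ∀ x, P x = (Fintype.card ι : ℝ)⁻¹ • ∑ j, R x (G x (p j)) (p j))
    (hmean : q = (Fintype.card ι : ℝ)⁻¹ • ∑ j, p j) (h0 : σ 0 = x₀)
    (hσ : ∀ t ∈ Icc (0:ℝ) 1, σ t ∈ ball x₀ ρ ∧ HasDerivAt σ (ξ t) t ∧ ContinuousAt ξ t)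
    (hGm : ∀ t ∈ Icc (0:ℝ) 1, ∀ j, G (σ t) (p j) = m t)
    (hm : ∀ t ∈ Icc (0:ℝ) 1, HasDerivAt m ⟪P (σ t), ξ t⟫ t)
    (hPξ : ∀ t ∈ Icc (0:ℝ) 1, ∀ j, ⟪R (σ t) (G (σ t) (p j)) (p j), ξ t⟫ = ⟪P (σ t), ξ t⟫)
    (hr0 : ∀ t ∈ Icc (0:ℝ) 1, ⟪r (σ t) i₀, ξ t⟫ = ω)
    (hrj : ∀ t ∈ Icc (0:ℝ) 1, ∀ j, j ≠ i₀ →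
      c j • r (σ t) j = R (σ t) (G (σ t) (p j)) (p j) - P (σ t))
    (hr : ∀ t ∈ Icc (0:ℝ) 1, ∀ y, ‖∑ j, ⟪r (σ t) j, y⟫ • b j - y‖ ≤ 1 / 4 * ‖y‖)
    (hξω : ∀ t ∈ Icc (0:ℝ) 1, ‖ξ t - ω • b i₀‖ ≤ 1 / 3 * ω)
    (hsmall : ∀ t ∈ Icc (0:ℝ) 1, ∀ j,
      ‖R (σ t) (m t) q - P (σ t)‖ ≤ c j / (4 * Fintype.card ι)) :
    G (σ 1) q ≤ m 1 := by
  have hN : (0:ℝ) < Fintype.card ι := by exact_mod_cast Fintype.card_pos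
  have hmU : ∀ t ∈ Icc (0:ℝ) 1, m t ∈ U := fun t ht => by
    rw [← hGm t ht i₀]; exact H.G_mem _ (hσ t ht).1 _ (hp i₀)
  have hx₀ : x₀ ∈ ball x₀ ρ := h0 ▸ (hσ 0 ⟨le_rfl, zero_le_one⟩).1
  have hm0 : m 0 = u₀ := by
    rw [← hGm 0 ⟨le_rfl, zero_le_one⟩ i₀, h0, H.G_base _ (hp i₀)]
  have hP0 : P x₀ = q := by
    rw [hP, hmean]
    congr 1
    exact Finset.sum_congr rfl fun j _ => by rw [H.G_base _ (hp j), H.R_base _ (hp j)]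
  have hPc : ∀ t ∈ Icc (0:ℝ) 1, ContinuousAt (fun s => P (σ s)) t := by
    intro t ht
    simp only [hP]
    refine ContinuousAt.const_smul ?_ _
    refine tendsto_finsetSum _ fun j _ => ?_
    exact (H.hasDerivAt_grad_curve (hσ t ht).2.1 (hσ t ht).1 (hp j)).continuousAt
  obtain ⟨δ, hδ, hδK⟩ := Metric.isOpen_iff.1 H.isOpen_K q hq
  -- The drift changes `R` by at most `9 / 8 ε`, so `ε < c j / (9N)` costs `c j / (8N)`. Together
  -- with the `c j / (4N)` of `hsmall` this is the `3 c j / (8N)` admitted by `deriv_neg_at_zero`.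
  have hev : ∀ᶠ ε in 𝓝[>] (0:ℝ), ∀ t ∈ Icc (0:ℝ) 1, q - (ε * t) • b i₀ ∈ K ∧ ∀ j,
      ‖R (σ t) (m t) (q - (ε * t) • b i₀) - P (σ t)‖ ≤ 3 * c j / (8 * Fintype.card ι) := by
    have h1 : ∀ᶠ ε in 𝓝[>] (0:ℝ), ε < δ :=
      mem_of_superset (Ioo_mem_nhdsGT hδ) fun _ h => h.2
    have h2 : ∀ j, ∀ᶠ ε in 𝓝[>] (0:ℝ), ε < c j / (9 * Fintype.card ι) := fun j =>
      mem_of_superset (Ioo_mem_nhdsGT (div_pos (hc j) (by positivity))) fun _ h => h.2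
    filter_upwards [h1, eventually_all.2 h2, eventually_mem_nhdsWithin] with ε h1 h2 hε t ht
    have hε : 0 < ε := hε
    have hn : ‖(ε * t) • b i₀‖ ≤ ε := by
      rw [norm_smul, b.orthonormal.1 i₀, mul_one, Real.norm_eq_abs,
        abs_of_nonneg (mul_nonneg hε.le ht.1)]
      exact mul_le_of_le_one_right hε.le ht.2
    have hK : q - (ε * t) • b i₀ ∈ K := by
      refine hδK ?_
      rw [mem_ball, dist_eq_norm, sub_sub_cancel_left, norm_neg]
      exact hn.trans_lt h1
    refine ⟨hK, fun j => ?_⟩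
    have h3 := H.R_close _ (hσ t ht).1 _ (hmU t ht) _ hK _ hq
    have h4 := hsmall t ht j
    have h5 : ‖R (σ t) (m t) (q - (ε * t) • b i₀) - R (σ t) (m t) q‖ ≤ 9 / 8 * ε := by
      set w := q - (ε * t) • b i₀ - q with hw
      have hwn : ‖w‖ ≤ ε := by rw [hw, sub_sub_cancel_left, norm_neg]; exact hn
      calc _ = ‖(R (σ t) (m t) (q - (ε * t) • b i₀) - R (σ t) (m t) q - w) + w‖ := by
            congr 1; abel
        _ ≤ 1 / 8 * ‖w‖ + ‖w‖ := (norm_add_le _ _).trans (by linarith)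
        _ ≤ 9 / 8 * ε := by linarith
    have h6 : 9 / 8 * ε ≤ c j / (8 * Fintype.card ι) := by
      have := (h2 j).le
      calc 9 / 8 * ε ≤ 9 / 8 * (c j / (9 * Fintype.card ι)) := by linarith
        _ = c j / (8 * Fintype.card ι) := by field_simp
    calc _ = ‖(R (σ t) (m t) (q - (ε * t) • b i₀) - R (σ t) (m t) q) +
            (R (σ t) (m t) q - P (σ t))‖ := by congr 1; abel
      _ ≤ c j / (8 * Fintype.card ι) + c j / (4 * Fintype.card ι) :=
          (norm_add_le _ _).trans (add_le_add (h5.trans h6) h4)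
      _ = 3 * c j / (8 * Fintype.card ι) := by field_simp; ring
  have hRc : ∀ (ε t : ℝ), t ∈ Icc (0:ℝ) 1 → q - (ε * t) • b i₀ ∈ K →
      ContinuousAt (fun w : ℝ × ℝ => R (σ w.2) (m w.2) (q - (w.1 * w.2) • b i₀)) (ε, t) := by
    intro ε t ht hK
    have h1 := H.continuousAt_R (hσ t ht).1 (hmU t ht) hK
    refine ContinuousAt.comp (f := fun w : ℝ × ℝ => (σ w.2, m w.2, q - (w.1 * w.2) • b i₀))
      (x := (ε, t)) h1 ?_
    refine ContinuousAt.prodMk ?_ (ContinuousAt.prodMk ?_ (by fun_prop))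
    · exact ContinuousAt.comp (f := Prod.snd) (g := σ) (x := (ε, t))
        (hσ t ht).2.1.continuousAt continuousAt_snd
    · exact ContinuousAt.comp (f := Prod.snd) (g := m) (x := (ε, t))
        (hm t ht).continuousAt continuousAt_snd
  have hk : ∀ᶠ ε in 𝓝[>] (0:ℝ), ∀ t ∈ Icc (0:ℝ) 1,
      ⟪R (σ t) (m t) (q - (ε * t) • b i₀) - P (σ t), ξ t⟫ ≤ 0 := by
    filter_upwards [hev, eventually_mem_nhdsWithin] with ε hεt hε
    have hε : 0 < ε := hε
    refine nonpos_of_deriv_neg_at_zeros ?_ ?_ ?_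
    · intro t ht
      refine ContinuousAt.continuousWithinAt ?_
      refine ContinuousAt.inner (ContinuousAt.sub ?_ (hPc t ht)) (hσ t ht).2.2
      exact ContinuousAt.comp (f := fun t : ℝ => (ε, t)) (x := t) (hRc ε t ht (hεt t ht).1)
        (by fun_prop)
    · simp only [mul_zero, zero_smul, sub_zero]
      rw [h0, hm0, H.R_base _ hq, hP0, sub_self, inner_zero_left]
    · intro t ht hz
      have htI := Ico_subset_Icc_self ht
      refine H.deriv_neg_at_zero (π := fun t => q - (ε * t) • b i₀) (Pm := fun t => P (σ t))
        b hp hc ht.1 ht.2 (fun s hs => (hσ s hs).1)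
        (hσ t htI).2.1 (hσ t htI).2.2 hGm (fun s => hP _) hPξ (hm t htI) (hr0 t htI) hω hε
        (hrj t htI) (hr t htI) (hξω t htI) ?_ (hεt t htI).1 (hεt t htI).2 hz
      have h1 : HasDerivAt (fun t : ℝ => ε * t) ε t := by
        simpa using (hasDerivAt_id t).const_mul ε
      exact (h1.smul_const (b i₀)).const_sub q
  have hD : ∀ t ∈ Icc (0:ℝ) 1, ⟪R (σ t) (m t) q - P (σ t), ξ t⟫ ≤ 0 := by
    intro t ht
    have h1 : ContinuousAt (fun ε : ℝ =>
        ⟪R (σ t) (m t) (q - (ε * t) • b i₀) - P (σ t), ξ t⟫) 0 := by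
      refine ContinuousAt.inner (ContinuousAt.sub ?_ continuousAt_const) continuousAt_const
      exact ContinuousAt.comp (f := fun ε : ℝ => ((ε, t) : ℝ × ℝ)) (x := (0:ℝ))
        (g := fun w : ℝ × ℝ => R (σ t) (m t) (q - (w.1 * w.2) • b i₀))
        (ContinuousAt.comp (f := fun w : ℝ × ℝ => (σ t, m t, q - (w.1 * w.2) • b i₀))
          (x := ((0:ℝ), t)) (H.continuousAt_R (hσ t ht).1 (hmU t ht) (by simpa using hq))
          (by fun_prop)) (by fun_prop)
    have h2 := h1.tendsto.mono_left (nhdsWithin_le_nhds (s := Ioi 0))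
    simp only [zero_mul, zero_smul, sub_zero] at h2
    exact le_of_tendsto h2 (hk.mono fun ε h => h t ht)
  have hξn : ∀ t ∈ Icc (0:ℝ) 1, ‖ξ t‖ ≤ 4 / 3 * ω := by
    intro t ht
    calc ‖ξ t‖ = ‖(ξ t - ω • b i₀) + ω • b i₀‖ := by congr 1; abel
      _ ≤ ‖ξ t - ω • b i₀‖ + ‖ω • b i₀‖ := norm_add_le _ _
      _ ≤ 1 / 3 * ω + ω := by
        rw [norm_smul, b.orthonormal.1 i₀, mul_one, Real.norm_eq_abs, abs_of_pos hω]
        linarith [hξω t ht]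
      _ = 4 / 3 * ω := by ring
  have hfin := nonpos_of_deriv_le_mul_abs (b := 1) (C := |C| * (4 / 3 * ω))
    (w := fun t => G (σ t) q - m t)
    (w' := fun t => ⟪R (σ t) (G (σ t) q) q, ξ t⟫ - ⟪P (σ t), ξ t⟫)
    (fun t ht => (H.hasDerivAt_G_curve (hσ t ht).2.1 (hσ t ht).1 hq).sub (hm t ht))
    (by rw [h0, hm0, H.G_base _ hq, sub_self])
    (fun t ht => by
      have h1 : ⟪R (σ t) (G (σ t) q) q, ξ t⟫ - ⟪P (σ t), ξ t⟫ =
          ⟪R (σ t) (m t) q - P (σ t), ξ t⟫ +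
            ⟪R (σ t) (G (σ t) q) q - R (σ t) (m t) q, ξ t⟫ := by
        rw [inner_sub_left, inner_sub_left]; ring
      rw [h1]
      have h2 := hD t ht
      have h3 : ⟪R (σ t) (G (σ t) q) q - R (σ t) (m t) q, ξ t⟫ ≤
          (|C| * |G (σ t) q - m t|) * (4 / 3 * ω) := by
        refine (real_inner_le_norm _ _).trans (mul_le_mul ?_ (hξn t ht) (norm_nonneg _)
          (by positivity))
        refine (H.R_lip _ (hσ t ht).1 _ hq _ (H.G_mem _ (hσ t ht).1 _ hq) _ (hmU t ht)).trans ?_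
        exact mul_le_mul_of_nonneg_right (le_abs_self C) (abs_nonneg _)
      calc _ ≤ 0 + (|C| * |G (σ t) q - m t|) * (4 / 3 * ω) := add_le_add h2 h3
        _ = |C| * (4 / 3 * ω) * |G (σ t) q - m t| := by ring)
    1 ⟨zero_le_one, le_rfl⟩
  simpa using hfin

/-- Supplies the curve for `le_along_curve`. The conditions that all `G · (p j)` agree leave one
free coordinate, for which `⟪b i₀, x - x₀⟫` is taken; with the scaled differences from the mean it
forms a near-identity map. -/
theorem le_of_simplex [FiniteDimensional ℝ E] [Nontrivial E] {ι : Type*} [Fintype ι] [Nonempty ι]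
    (b : OrthonormalBasis ι ℝ E) {i₀ : ι} {p : ι → E} (hp : ∀ j, p j ∈ K) {q : E} (hq : q ∈ K)
    (hmean : q = (Fintype.card ι : ℝ)⁻¹ • ∑ j, p j) {c : ι → ℝ} (hc : ∀ j, 0 < c j)
    {ρ₁ : ℝ} (hρ₁ : ρ₁ ≤ ρ) {P : E → E}
    (hP : ∀ x, P x = (Fintype.card ι : ℝ)⁻¹ • ∑ j, R x (G x (p j)) (p j)) {r : E → ι → E}
    (hr0 : ∀ x, r x i₀ = b i₀)
    (hrj : ∀ x, ∀ j, j ≠ i₀ → r x j = (c j)⁻¹ • (R x (G x (p j)) (p j) - P x))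
    (hr : ∀ x ∈ ball x₀ ρ₁, ∀ y, ‖∑ j, ⟪r x j, y⟫ • b j - y‖ ≤ 1 / 4 * ‖y‖)
    (hsmall : ∀ x ∈ ball x₀ ρ₁, ∀ u, (∀ j, G x (p j) = u) → ∀ j,
      ‖R x u q - P x‖ ≤ c j / (4 * Fintype.card ι))
    {x₁ : E} (hx₁ : x₁ ∈ ball x₀ ρ₁) {u₁ : ℝ} (hu₁ : ∀ j, G x₁ (p j) = u₁)
    (hpos : 0 < ⟪b i₀, x₁ - x₀⟫) (hlt : ⟪b i₀, x₁ - x₀⟫ < ρ₁ / 2) : G x₁ q ≤ u₁ := by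
  classical
  have hN : (0:ℝ) < Fintype.card ι := by exact_mod_cast Fintype.card_pos
  have hball : ball x₀ ρ₁ ⊆ ball x₀ ρ := ball_subset_ball hρ₁
  have hx₀ : x₀ ∈ ball x₀ ρ₁ := mem_ball_self (pos_of_mem_ball hx₁)
  obtain ⟨ω, hω⟩ : ∃ ω, ω = ⟪b i₀, x₁ - x₀⟫ := ⟨_, rfl⟩
  rw [← hω] at hpos hlt
  set Gm : E → ℝ := fun x => (Fintype.card ι : ℝ)⁻¹ * ∑ j, G x (p j) with hGm
  -- At `x₀` and at `x₁` all coordinates except `i₀` vanish. The preimage of the segment between the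
  -- two images is thus a curve along which all `G · (p j)` agree.
  set ψ : ι → E → ℝ := fun j x =>
    if j = i₀ then ⟪b i₀, x - x₀⟫ else (c j)⁻¹ * (G x (p j) - Gm x) with hψ
  set Ψ : E → E := fun x => ∑ j, ψ j x • b j with hΨ
  have hcoef : ∀ (a : ι → ℝ) k, ⟪b k, ∑ j, a j • b j⟫ = a k := fun a k =>
    b.orthonormal.inner_right_fintype a k
  have hGmeq : ∀ x u, (∀ j, G x (p j) = u) → Gm x = u := by
    intro x u h
    simp only [hGm, h, Finset.sum_const, Finset.card_univ, nsmul_eq_mul]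
    field_simp
  have hGmd : ∀ x ∈ ball x₀ ρ, HasFDerivAt Gm (innerSL ℝ (P x)) x := by
    intro x hx
    have h1 : HasFDerivAt (fun x => ∑ j, G x (p j))
        (∑ j, innerSL ℝ (R x (G x (p j)) (p j))) x :=
      HasFDerivAt.fun_sum fun j _ => H.hasFDerivAt_G x hx _ (hp j)
    have h2 := h1.const_mul (Fintype.card ι : ℝ)⁻¹
    refine h2.congr_fderiv ?_
    rw [hP, map_smul, map_sum]
  have hψd : ∀ x ∈ ball x₀ ρ, ∀ j, HasFDerivAt (ψ j) (innerSL ℝ (r x j)) x := by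
    intro x hx j
    by_cases hj : j = i₀
    · subst hj
      simp only [hψ, if_true, hr0]
      have := (innerSL ℝ (b j)).hasFDerivAt.comp x ((hasFDerivAt_id x).sub_const x₀)
      exact this
    · simp only [hψ, hj, if_false, hrj x j hj]
      have := ((H.hasFDerivAt_G x hx _ (hp j)).sub (hGmd x hx)).const_mul (c j)⁻¹
      refine this.congr_fderiv ?_
      rw [map_smul, map_sub]
  have hψcd : ∀ j, ContDiffOn ℝ 1 (ψ j) (ball x₀ ρ₁) := by
    intro j
    by_cases hj : j = i₀
    · subst hj
      simp only [hψ, if_true]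
      exact (contDiff_const.inner ℝ (contDiff_id.sub contDiff_const)).contDiffOn
    · simp only [hψ, hj, if_false]
      refine contDiffOn_const.mul (((H.contDiffOn_G_left (hp j)).mono hball).sub ?_)
      refine contDiffOn_const.mul (ContDiffOn.sum fun k _ => ?_)
      exact (H.contDiffOn_G_left (hp k)).mono hball
  set T : E → E →L[ℝ] E := fun x => ∑ j, (innerSL ℝ (r x j)).smulRight (b j) with hT
  have hTapp : ∀ x y, T x y = ∑ j, ⟪r x j, y⟫ • b j := by
    intro x y; simp [hT, sum_apply]
  have hΨd : ∀ x ∈ ball x₀ ρ₁, HasFDerivAt Ψ (T x) x := by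
    intro x hx
    exact HasFDerivAt.fun_sum fun j _ => (hψd x (hball hx) j).smul_const (b j)
  have hΨcd : ContDiffOn ℝ 1 Ψ (ball x₀ ρ₁) :=
    ContDiffOn.sum fun j _ => (hψcd j).smul contDiffOn_const
  have hψ0 : ∀ x u, (∀ j, G x (p j) = u) → ∀ j, j ≠ i₀ → ψ j x = 0 := by
    intro x u h j hj
    simp only [hψ, hj, if_false]
    rw [h j, hGmeq x u h, sub_self, mul_zero]
  have hΨ0 : Ψ x₀ = 0 := by
    refine Finset.sum_eq_zero fun j _ => ?_
    by_cases hj : j = i₀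
    · subst hj; simp [hψ]
    · rw [hψ0 x₀ u₀ (fun j => H.G_base _ (hp j)) j hj, zero_smul]
  have hΨ1 : Ψ x₁ = ω • b i₀ := by
    simp only [hΨ]
    rw [Finset.sum_eq_single i₀]
    · simp [hψ, hω]
    · intro j _ hj; rw [hψ0 x₁ u₁ hu₁ j hj, zero_smul]
    · intro h; exact absurd (Finset.mem_univ _) h
  have hΨ1n : ‖Ψ x₁‖ = ω := by
    rw [hΨ1, norm_smul, b.orthonormal.1 i₀, mul_one, Real.norm_eq_abs, abs_of_pos hpos]
  obtain ⟨σ, ξ, hσ0, hσ1, hσ⟩ := exists_curve_of_near_identity hΨcd hΨd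
    (fun x hx y => by rw [hTapp]; exact hr x hx y) hΨ0 hx₁ (by rw [hΨ1n]; exact hlt)
  have hψσ : ∀ t ∈ Icc (0:ℝ) 1, ∀ j, j ≠ i₀ → ψ j (σ t) = 0 := by
    intro t ht j hj
    have h1 : ⟪b j, Ψ (σ t)⟫ = ψ j (σ t) := hcoef (fun j => ψ j (σ t)) j
    rw [← h1, (hσ t ht).2.2.2.1, hΨ1, smul_smul, inner_smul_right, b.inner_eq_zero hj, mul_zero]
  have hGσ : ∀ t ∈ Icc (0:ℝ) 1, ∀ j, G (σ t) (p j) = Gm (σ t) := by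
    intro t ht
    have h1 : ∀ j, j ≠ i₀ → G (σ t) (p j) = Gm (σ t) := by
      intro j hj
      have h2 := hψσ t ht j hj
      simp only [hψ, hj, if_false] at h2
      have h3 := (mul_eq_zero.1 h2).resolve_left (inv_ne_zero (hc j).ne')
      linarith
    -- The index `i₀` has no coordinate of its own: its difference from the mean vanishes because
    -- all differences sum to zero.
    have h2 : ∑ j, (G (σ t) (p j) - Gm (σ t)) = 0 := by
      rw [Finset.sum_sub_distrib, Finset.sum_const, Finset.card_univ, nsmul_eq_mul]
      simp only [hGm]
      field_simp; ring
    rw [Finset.sum_eq_single i₀ (fun j _ hj => by rw [h1 j hj, sub_self])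
      (fun h => absurd (Finset.mem_univ _) h)] at h2
    intro j
    by_cases hj : j = i₀
    · subst hj; linarith
    · exact h1 j hj
  have hrξ : ∀ t ∈ Icc (0:ℝ) 1, ∀ j, ⟪r (σ t) j, ξ t⟫ = ⟪b j, ω • b i₀⟫ := by
    intro t ht j
    rw [← hΨ1, ← (hσ t ht).2.2.2.2, hTapp, hcoef]
  have hrc : ∀ x, ∀ j, j ≠ i₀ → c j • r x j = R x (G x (p j)) (p j) - P x := by
    intro x j hj
    rw [hrj x j hj, smul_smul, mul_inv_cancel₀ (hc j).ne', one_smul]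
  have hPξ : ∀ t ∈ Icc (0:ℝ) 1, ∀ j,
      ⟪R (σ t) (G (σ t) (p j)) (p j), ξ t⟫ = ⟪P (σ t), ξ t⟫ := by
    intro t ht
    have h1 : ∀ j, j ≠ i₀ → ⟪R (σ t) (G (σ t) (p j)) (p j) - P (σ t), ξ t⟫ = 0 := by
      intro j hj
      rw [← hrc _ j hj, inner_smul_left, hrξ t ht, inner_smul_right, b.inner_eq_zero hj]
      simp
    have h2 : ∑ j, ⟪R (σ t) (G (σ t) (p j)) (p j) - P (σ t), ξ t⟫ = 0 := by
      rw [← sum_inner, Finset.sum_sub_distrib, Finset.sum_const, Finset.card_univ, hP,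
        ← Nat.cast_smul_eq_nsmul ℝ, smul_smul, mul_inv_cancel₀ hN.ne', one_smul, sub_self,
        inner_zero_left]
    rw [Finset.sum_eq_single i₀ (fun j _ hj => h1 j hj)
      (fun h => absurd (Finset.mem_univ _) h)] at h2
    intro j
    have h3 : ⟪R (σ t) (G (σ t) (p j)) (p j) - P (σ t), ξ t⟫ = 0 := by
      by_cases hj : j = i₀
      · subst hj; exact h2
      · exact h1 j hj
    rw [inner_sub_left] at h3
    linarith
  have := H.le_along_curve b (i₀ := i₀) hp hq hc (r := r) (σ := σ) (ξ := ξ)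
    (m := fun t => Gm (σ t)) hpos hP hmean hσ0
    (fun t ht => ⟨hball (hσ t ht).1, (hσ t ht).2.1, (hσ t ht).2.2.1⟩) hGσ
    (fun t ht => ((hGmd _ (hball (hσ t ht).1)).comp_hasDerivAt t (hσ t ht).2.1).congr_deriv
      (by simp)) hPξ
    (fun t ht => by
      rw [hrξ t ht, inner_smul_right, real_inner_self_eq_norm_sq, b.orthonormal.1]; simp)
    (fun t _ j hj => hrc _ j hj) (fun t ht => hr _ (hσ t ht).1)
    (fun t ht => by
      have h1 := hr _ (hσ t ht).1 (ξ t)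
      rw [← hTapp, (hσ t ht).2.2.2.2, hΨ1] at h1
      have h2 : ‖ξ t‖ ≤ ‖ω • b i₀‖ + ‖ω • b i₀ - ξ t‖ := by
        calc ‖ξ t‖ = ‖ω • b i₀ - (ω • b i₀ - ξ t)‖ := by congr 1; abel
          _ ≤ _ := norm_sub_le _ _
      rw [← hΨ1, hΨ1n, hΨ1] at h2
      rw [norm_sub_rev]
      linarith)
    (fun t ht j => hsmall _ (hσ t ht).1 _ (hGσ t ht) j)
  rw [hσ1, hGmeq x₁ u₁ hu₁] at this
  exact this

end LocalModel
end Calculus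
end GenFun


namespace GenFun
open Set Filter Topology Metric
open scoped RealInnerProductSpace NNReal

/-! ### Estimates for simplices of small size, and points on a level set. -/

section Calculus
variable {E : Type*} [NormedAddCommGroup E] [InnerProductSpace ℝ E]

theorem eventually_lt_of_deriv_pos {f : E → ℝ} {f' : E →L[ℝ] ℝ} {p w : E}
    (hf : HasFDerivAt f f' p) (hw : 0 < f' w) : ∀ᶠ r in 𝓝[>] (0:ℝ), f p < f (p + r • w) := by
  have h1 : HasDerivAt (fun r : ℝ => p + r • w) w 0 := by
    simpa using ((hasDerivAt_id (0:ℝ)).smul_const w).const_add p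
  have h0 : p + (0:ℝ) • w = p := by simp
  have h2 : HasDerivAt (fun r : ℝ => f (p + r • w)) (f' w) 0 := by
    refine HasFDerivAt.comp_hasDerivAt (f := fun r : ℝ => p + r • w) 0 ?_ h1
    rw [h0]; exact hf
  have h3 := h2.hasDerivWithinAt (s := Ioi 0)
  rw [hasDerivWithinAt_iff_tendsto_slope' self_notMem_Ioi] at h3
  filter_upwards [h3.eventually (lt_mem_nhds hw), eventually_mem_nhdsWithin] with r hr hr0
  have hr0 : 0 < r := hr0
  rw [slope_def_field, sub_zero, h0] at hr
  have := (div_pos_iff_of_pos_right hr0).1 hr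
  linarith

/-- The linear parts cancel, because `∑ (p j - q) = 0`; only the errors of linearization remain. -/
theorem mean_sub_le {F : Type*} [NormedAddCommGroup F] [NormedSpace ℝ F] {ι : Type*} [Fintype ι]
    [Nonempty ι] {f : E → F} {L : E →L[ℝ] F} {p : ι → E} {q : E}
    (hq : q = (Fintype.card ι : ℝ)⁻¹ • ∑ j, p j) {ε : ℝ}
    (h : ∀ j, ‖f (p j) - f q - L (p j - q)‖ ≤ ε) :
    ‖(Fintype.card ι : ℝ)⁻¹ • ∑ j, f (p j) - f q‖ ≤ ε := by
  have hN : (0:ℝ) < Fintype.card ι := by exact_mod_cast Fintype.card_pos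
  have h1 : ∑ j, (p j - q) = 0 := by
    rw [Finset.sum_sub_distrib, Finset.sum_const, Finset.card_univ, hq,
      ← Nat.cast_smul_eq_nsmul ℝ, smul_smul, mul_inv_cancel₀ hN.ne', one_smul, sub_self]
  have h2 : (Fintype.card ι : ℝ)⁻¹ • ∑ j, f (p j) - f q =
      (Fintype.card ι : ℝ)⁻¹ • ∑ j, (f (p j) - f q - L (p j - q)) := by
    rw [Finset.sum_sub_distrib, ← map_sum, h1, map_zero, sub_zero, Finset.sum_sub_distrib,
      Finset.sum_const, Finset.card_univ, smul_sub, ← Nat.cast_smul_eq_nsmul ℝ, smul_smul,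
      inv_mul_cancel₀ hN.ne', one_smul]
  rw [h2, norm_smul, norm_inv, Real.norm_natCast]
  calc _ ≤ (Fintype.card ι : ℝ)⁻¹ * ∑ _j : ι, ε :=
        mul_le_mul_of_nonneg_left ((norm_sum_le _ _).trans (Finset.sum_le_sum fun j _ => h j))
          (by positivity)
    _ = ε := by rw [Finset.sum_const, Finset.card_univ, nsmul_eq_mul]; field_simp

/-- The deviation from the identity is the adjoint of `M`, with its component along `b i₀` dropped,
plus the error of the rows. Each part contributes at most `1 / 8`. -/
theorem near_identity_rows [FiniteDimensional ℝ E] {ι : Type*} [Fintype ι] [Nonempty ι]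
    [DecidableEq ι] (b : OrthonormalBasis ι ℝ E) {i₀ : ι} {M : E →L[ℝ] E}
    (hM : ∀ y, ‖M y‖ ≤ 1 / 8 * ‖y‖) {r : ι → E} (h0 : r i₀ = b i₀)
    (h : ∀ j, j ≠ i₀ → ‖r j - b j - M (b j)‖ ≤ 1 / (8 * Fintype.card ι)) (y : E) :
    ‖∑ j, ⟪r j, y⟫ • b j - y‖ ≤ 1 / 4 * ‖y‖ := by
  have hN : (0:ℝ) < Fintype.card ι := by exact_mod_cast Fintype.card_pos
  have hMn : ‖ContinuousLinearMap.adjoint M‖ ≤ 1 / 8 := by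
    rw [LinearIsometryEquiv.norm_map]
    exact ContinuousLinearMap.opNorm_le_bound _ (by norm_num) hM
  have h1 : ∑ j, ⟪r j, y⟫ • b j - y =
      ∑ j ∈ Finset.univ.erase i₀, ⟪b j, ContinuousLinearMap.adjoint M y⟫ • b j +
        ∑ j ∈ Finset.univ.erase i₀, ⟪r j - b j - M (b j), y⟫ • b j := by
    conv_lhs =>
      arg 2
      rw [← b.sum_repr' y]
    rw [← Finset.sum_sub_distrib, ← Finset.sum_add_distrib,
      ← Finset.add_sum_erase _ _ (Finset.mem_univ i₀), h0, sub_self, zero_add]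
    refine Finset.sum_congr rfl fun j _ => ?_
    rw [ContinuousLinearMap.adjoint_inner_right, ← sub_smul, ← add_smul, inner_sub_left,
      inner_sub_left]
    congr 1; ring
  have h2 : ‖∑ j ∈ Finset.univ.erase i₀, ⟪b j, ContinuousLinearMap.adjoint M y⟫ • b j‖ ≤
      1 / 8 * ‖y‖ := by
    obtain ⟨w, hw⟩ : ∃ w, w = ContinuousLinearMap.adjoint M y := ⟨_, rfl⟩
    rw [← hw]
    have h3 : ‖w‖ ≤ 1 / 8 * ‖y‖ := hw ▸ ContinuousLinearMap.le_of_opNorm_le _ hMn y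
    refine le_trans ?_ h3
    set z := ∑ j ∈ Finset.univ.erase i₀, ⟪b j, w⟫ • b j with hz
    have h4 : w = ⟪b i₀, w⟫ • b i₀ + z := by
      conv_lhs => rw [← b.sum_repr' w]
      rw [hz, Finset.add_sum_erase _ (fun j => ⟪b j, w⟫ • b j) (Finset.mem_univ i₀)]
    have h5 : ⟪b i₀, z⟫ = 0 := by
      rw [hz, inner_sum]
      refine Finset.sum_eq_zero fun j hj => ?_
      rw [inner_smul_right, b.inner_eq_zero (Finset.mem_erase.1 hj).1.symm, mul_zero]
    have h6 : ‖w‖ ^ 2 = ⟪b i₀, w⟫ ^ 2 + ‖z‖ ^ 2 := by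
      conv_lhs => rw [h4]
      rw [norm_add_sq_real, inner_smul_left, h5, norm_smul, b.orthonormal.1 i₀]
      simp
    exact le_of_sq_le_sq (by nlinarith [sq_nonneg ⟪b i₀, w⟫]) (norm_nonneg _)
  have h3 : ‖∑ j ∈ Finset.univ.erase i₀, ⟪r j - b j - M (b j), y⟫ • b j‖ ≤ 1 / 8 * ‖y‖ := by
    refine (norm_sum_le _ _).trans ?_
    calc _ ≤ ∑ _j ∈ Finset.univ.erase i₀, 1 / (8 * (Fintype.card ι : ℝ)) * ‖y‖ := by
          refine Finset.sum_le_sum fun j hj => ?_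
          rw [norm_smul, b.orthonormal.1 j, mul_one]
          exact (abs_real_inner_le_norm _ _).trans
            (mul_le_mul_of_nonneg_right (h j (Finset.mem_erase.1 hj).1) (norm_nonneg _))
      _ ≤ ∑ _j : ι, 1 / (8 * (Fintype.card ι : ℝ)) * ‖y‖ :=
          Finset.sum_le_sum_of_subset_of_nonneg (Finset.erase_subset _ _)
            fun _ _ _ => by positivity
      _ = 1 / 8 * ‖y‖ := by
          rw [Finset.sum_const, Finset.card_univ, nsmul_eq_mul]; field_simp
  rw [h1]
  refine (norm_add_le _ _).trans ?_
  linarith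

/-- To first order `f (p + r (s j ± κ e))` differs from `f p` by `± r κ ⟪h, e⟫`, so the intermediate
value theorem finds the level of `p` in between. -/
theorem exists_level_points [FiniteDimensional ℝ E] {ι : Type*} [Fintype ι] [Nonempty ι] {K : Set E}
    (hK : IsOpen K) {f : E → ℝ} (hf : ContinuousOn f K) {p h e : E} (hp : p ∈ K)
    (hfp : HasFDerivAt f (innerSL ℝ h) p) (he : 0 < ⟪h, e⟫) (hen : ‖e‖ = 1) {s : ι → E}
    (hs : ∀ j, ⟪h, s j⟫ = 0) {κ : ℝ} (hκ : 0 < κ) :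
    ∀ᶠ r in 𝓝[>] (0:ℝ), ∃ α : ι → ℝ, (∀ j, |α j| ≤ κ) ∧
      ∀ j, f (p + r • (s j + α j • e)) = f p := by
  have hone : ∀ j, ∀ᶠ r in 𝓝[>] (0:ℝ), ∃ a : ℝ, |a| ≤ κ ∧ f (p + r • (s j + a • e)) = f p := by
    intro j
    have h1 := eventually_lt_of_deriv_pos (w := s j + κ • e) hfp (by
      simp only [innerSL_apply_apply, inner_add_right, inner_smul_right, hs j]
      rw [zero_add]; exact mul_pos hκ he)
    have h2 := eventually_lt_of_deriv_pos (w := s j + (-κ) • e) hfp.neg (by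
      simp only [_root_.neg_apply, innerSL_apply_apply, inner_add_right, inner_smul_right, hs j]
      rw [zero_add, neg_mul, neg_neg]; exact mul_pos hκ he)
    obtain ⟨δ, hδ, hδK⟩ := Metric.isOpen_iff.1 hK p hp
    have h3 : ∀ᶠ r in 𝓝[>] (0:ℝ), r * (‖s j‖ + κ) < δ := by
      have : Tendsto (fun r : ℝ => r * (‖s j‖ + κ)) (𝓝 0) (𝓝 (0 * (‖s j‖ + κ))) :=
        (continuous_id.mul continuous_const).tendsto 0
      rw [zero_mul] at this
      exact (this.eventually (gt_mem_nhds hδ)).filter_mono nhdsWithin_le_nhds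
    filter_upwards [h1, h2, h3, eventually_mem_nhdsWithin] with r h1 h2 h3 hr
    have hr : 0 < r := hr
    have hmem : ∀ a ∈ Icc (-κ) κ, p + r • (s j + a • e) ∈ K := by
      intro a ha
      refine hδK ?_
      rw [mem_ball, dist_eq_norm, add_sub_cancel_left, norm_smul, Real.norm_eq_abs, abs_of_pos hr]
      refine lt_of_le_of_lt (mul_le_mul_of_nonneg_left ?_ hr.le) h3
      refine (norm_add_le _ _).trans (add_le_add le_rfl ?_)
      rw [norm_smul, hen, mul_one, Real.norm_eq_abs]
      exact abs_le.2 ha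
    have hc : ContinuousOn (fun a : ℝ => f (p + r • (s j + a • e))) (Icc (-κ) κ) :=
      hf.comp (by fun_prop) hmem
    obtain ⟨a, ha, hfa⟩ := intermediate_value_Icc (by linarith) hc
      (show f p ∈ Icc (f (p + r • (s j + (-κ) • e))) (f (p + r • (s j + κ • e))) from
        ⟨by simpa using h2.le, h1.le⟩)
    exact ⟨a, abs_le.2 ha, hfa⟩
  filter_upwards [eventually_all.2 hone] with r hr
  choose α h1 h2 using hr
  exact ⟨α, h1, h2⟩

end Calculus
end GenFun


namespace GenFun
open Set Filter Topology Metric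
open scoped RealInnerProductSpace NNReal

/-! ### Quasiconvexity in the local model. -/

section Calculus
variable {E : Type*} [NormedAddCommGroup E] [InnerProductSpace ℝ E]

namespace LocalModel

variable {x₀ : E} {u₀ ρ C : ℝ} {U : Set ℝ} {K K' : Set E} {G : E → E → ℝ} {R : E → ℝ → E → E}
  {A : E → ℝ → E → E →L[ℝ] E} (H : LocalModel x₀ u₀ ρ C U K K' G R A)
include H

/-- Integrates `grad_close` from `x₀`, where `G` does not depend on the parameter. -/
theorem abs_G_sub_sub_inner_le {x : E} (hx : x ∈ ball x₀ ρ) {p p' : E} (hp : p ∈ K)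
    (hp' : p' ∈ K) : |G x p - G x p' - ⟪p - p', x - x₀⟫| ≤ 1 / 8 * ‖p - p'‖ * ‖x - x₀‖ := by
  have hx₀ : x₀ ∈ ball x₀ ρ := mem_ball_self (pos_of_mem_ball hx)
  have h1 := (convex_ball x₀ ρ).norm_image_sub_le_of_norm_hasFDerivWithin_le'
    (f := fun x => G x p - G x p') (φ := innerSL ℝ (p - p')) (C := 1 / 8 * ‖p - p'‖)
    (fun z hz => ((H.hasFDerivAt_G z hz p hp).sub (H.hasFDerivAt_G z hz p' hp')).hasFDerivWithinAt)
    (fun z hz => by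
      rw [← map_sub, ← map_sub, innerSL_apply_norm]
      exact H.grad_close z hz p hp p' hp') hx₀ hx
  rw [H.G_base p hp, H.G_base p' hp', sub_self, sub_zero] at h1
  rwa [innerSL_apply_apply, Real.norm_eq_abs] at h1

theorem exists_gradient [FiniteDimensional ℝ E] {x : E} (hx : x ∈ ball x₀ ρ) {p : E} (hp : p ∈ K) :
    ∃ h : E, HasFDerivAt (G x) (innerSL ℝ h) p ∧ ‖h - (x - x₀)‖ ≤ 1 / 8 * ‖x - x₀‖ := by
  have h1 : DifferentiableAt ℝ (G x) p := by
    have h2 : DifferentiableAt ℝ (fun w : E × E => G w.1 w.2) (x, p) :=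
      (H.contDiffOn_G.contDiffAt ((isOpen_ball.prod H.isOpen_K).mem_nhds
        ⟨hx, hp⟩)).differentiableAt one_ne_zero
    exact DifferentiableAt.comp (f := fun p : E => (x, p)) p h2 (by fun_prop)
  set h := (InnerProductSpace.toDual ℝ E).symm (fderiv ℝ (G x) p) with hh
  have h2 : innerSL ℝ h = fderiv ℝ (G x) p := by
    ext y; simp [hh]
  refine ⟨h, h2 ▸ h1.hasFDerivAt, ?_⟩
  have h3 : HasFDerivAt (fun p' => G x p' - innerSL ℝ (x - x₀) p')
      (innerSL ℝ (h - (x - x₀))) p := by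
    rw [show innerSL ℝ (h - (x - x₀)) = innerSL ℝ h - innerSL ℝ (x - x₀) from map_sub _ _ _, h2]
    exact h1.hasFDerivAt.sub (innerSL ℝ (x - x₀)).hasFDerivAt
  have h4 : LipschitzOnWith (1 / 8 * ‖x - x₀‖₊) (fun p' => G x p' - innerSL ℝ (x - x₀) p') K := by
    refine LipschitzOnWith.of_dist_le_mul fun a ha c hc => ?_
    rw [dist_eq_norm, dist_eq_norm, Real.norm_eq_abs]
    have := H.abs_G_sub_sub_inner_le hx ha hc
    simp only [innerSL_apply_apply]
    rw [show G x a - ⟪x - x₀, a⟫ - (G x c - ⟪x - x₀, c⟫) = G x a - G x c - ⟪a - c, x - x₀⟫ by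
      rw [real_inner_comm (x - x₀) (a - c), inner_sub_right]; ring]
    refine this.trans (le_of_eq ?_)
    push_cast
    simp; ring
  have h5 := h3.le_of_lipschitzOn (H.isOpen_K.mem_nhds hp) h4
  rw [innerSL_apply_norm] at h5
  simpa using h5

theorem contDiffOn_grad :
    ContDiffOn ℝ 1 (fun w : E × E => R w.1 (G w.1 w.2) w.2) (ball x₀ ρ ×ˢ K) :=
  H.contDiffOn_R.comp (f := fun w : E × E => (w.1, G w.1 w.2, w.2))
    (contDiffOn_fst.prodMk (H.contDiffOn_G.prodMk contDiffOn_snd))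
    fun _ hw => ⟨hw.1, H.G_mem _ hw.1 _ hw.2, hw.2⟩

theorem fderiv_grad_close {x : E} (hx : x ∈ ball x₀ ρ) {p : E} (hp : p ∈ K) (y : E) :
    ‖fderiv ℝ (fun w : E × E => R w.1 (G w.1 w.2) w.2) (x, p) (0, y) - y‖ ≤ 1 / 8 * ‖y‖ := by
  have h0 : DifferentiableAt ℝ (fun w : E × E => R w.1 (G w.1 w.2) w.2) (x, p) :=
    (H.contDiffOn_grad.contDiffAt ((isOpen_ball.prod H.isOpen_K).mem_nhds
      ⟨hx, hp⟩)).differentiableAt one_ne_zero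
  have h1 : HasFDerivAt (fun p' => R x (G x p') p' - p')
      ((fderiv ℝ (fun w : E × E => R w.1 (G w.1 w.2) w.2) (x, p)).comp
        (ContinuousLinearMap.inr ℝ E E) - ContinuousLinearMap.id ℝ E) p := by
    refine HasFDerivAt.sub ?_ (hasFDerivAt_id p)
    exact HasFDerivAt.comp (f := fun p : E => (x, p)) p h0.hasFDerivAt
      (hasFDerivAt_prodMk_right x p)
  have h2 : LipschitzOnWith (1 / 8) (fun p' => R x (G x p') p' - p') K := by
    refine LipschitzOnWith.of_dist_le_mul fun a ha c hc => ?_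
    rw [dist_eq_norm, dist_eq_norm]
    have := H.grad_close x hx a ha c hc
    rw [show R x (G x a) a - R x (G x c) c - (a - c) =
      R x (G x a) a - a - (R x (G x c) c - c) by abel] at this
    simpa using this
  have h3 := h1.le_of_lipschitzOn (H.isOpen_K.mem_nhds hp) h2
  have h4 := ContinuousLinearMap.le_of_opNorm_le _ h3 y
  simpa using h4

/-- For small `r` a simplex of size `r` meets the smallness conditions of `le_of_simplex` with `c j
= r * d j`: gradient differences are linear in the parameter up to `o(r)`, uniformly in `x`, and
their linear part is nearly the identity. The sizes `α j` need only be bounded by a fixed `κ₀`,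
independent of `r`. -/
theorem le_of_small_simplex [FiniteDimensional ℝ E] [Nontrivial E] {ι : Type*} [Fintype ι]
    [Nonempty ι] (b : OrthonormalBasis ι ℝ E) {i₀ : ι} {p : E} (hp : p ∈ K) {d : ι → ℝ} {s : ι → E}
    (hd : ∀ j, 0 < d j) (hs : ∀ j, j ≠ i₀ → s j = d j • b j) (hsum : ∑ j, s j = 0)
    {x₁ : E} (hx₁ : x₁ ∈ ball x₀ (ρ / 8)) (hpos : 0 < ⟪b i₀, x₁ - x₀⟫) :
    ∃ κ₀ > 0, ∀ᶠ r in 𝓝[>] (0:ℝ), ∀ α : ι → ℝ, (∀ j, |α j| ≤ κ₀) → ∀ u₁,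
      (∀ j, G x₁ (p + r • (s j + α j • b i₀)) = u₁) →
      p + (r * ((Fintype.card ι : ℝ)⁻¹ * ∑ j, α j)) • b i₀ ∈ K ∧
      G x₁ (p + (r * ((Fintype.card ι : ℝ)⁻¹ * ∑ j, α j)) • b i₀) ≤ u₁ := by
  classical
  have hρ8 : 0 < ρ / 8 := pos_of_mem_ball hx₁
  have hρ : 0 < ρ := by linarith
  obtain ⟨N, hN⟩ : ∃ N : ℝ, N = Fintype.card ι := ⟨_, rfl⟩
  have hN1 : 1 ≤ N := by rw [hN]; exact_mod_cast Nat.one_le_iff_ne_zero.2 Fintype.card_ne_zero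
  have hN0 : 0 < N := by linarith
  rw [← hN]
  obtain ⟨i₂, -, hi₂⟩ := Finset.exists_min_image Finset.univ d ⟨i₀, Finset.mem_univ _⟩
  obtain ⟨δ, hδ⟩ : ∃ δ, δ = d i₂ := ⟨_, rfl⟩
  have hδ0 : 0 < δ := hδ ▸ hd i₂
  have hδd : ∀ j, δ ≤ d j := fun j => hδ ▸ hi₂ j (Finset.mem_univ j)
  obtain ⟨S, hS⟩ : ∃ S : ℝ, S = ∑ j, ‖s j‖ := ⟨_, rfl⟩
  have hS0 : 0 ≤ S := hS ▸ Finset.sum_nonneg fun j _ => norm_nonneg _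
  have hsS : ∀ j, ‖s j‖ ≤ S := fun j =>
    hS ▸ Finset.single_le_sum (f := fun j => ‖s j‖) (fun k _ => norm_nonneg _) (Finset.mem_univ j)
  set D := S + 2 with hD
  have hD0 : 0 < D := by linarith
  set κ₀ := min 1 (δ / (64 * N)) with hκ₀
  have hκ0 : 0 < κ₀ := by positivity
  have hκ1 : κ₀ ≤ 1 := min_le_left _ _
  have hκδ : κ₀ ≤ δ / (64 * N) := min_le_right _ _
  -- All points of the simplex and its mean are within `r D` of each other and of `p`. After
  -- division by `r d j ≥ r δ`, `η` and `κ₀` each use at most half of the tolerance `1 / (8N)` of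
  -- `near_identity_rows`. The factor `|C| + 1` pays for changing the level from `G x q` to `u`.
  set η := δ / (32 * N * (|C| + 1) * D) with hη
  have hη0 : 0 < η := by positivity
  have hηD : η * D * (|C| + 1) = δ / (32 * N) := by rw [hη]; field_simp
  have hηD1 : η * D ≤ δ / (32 * N) := by
    rw [← hηD]
    exact le_mul_of_one_le_right (by positivity) (by linarith [abs_nonneg C])
  have hcb : closedBall x₀ (ρ / 2) ⊆ ball x₀ ρ := closedBall_subset_ball (by linarith)
  obtain ⟨r₁, hr₁, hr₁K, hP⟩ := uniform_differentiability isOpen_ball H.isOpen_K H.contDiffOn_grad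
    (isCompact_closedBall x₀ (ρ / 2)) hcb hp hη0
  obtain ⟨r₂, hr₂, -, hG⟩ := uniform_differentiability isOpen_ball H.isOpen_K H.contDiffOn_G
    (isCompact_closedBall x₀ (ρ / 2)) hcb hp hη0
  have hbn : ∀ j, ‖b j‖ = 1 := b.orthonormal.1
  have hrr : ∀ᶠ r in 𝓝[>] (0:ℝ), r < min r₁ r₂ / D :=
    mem_of_superset (Ioo_mem_nhdsGT (by positivity)) fun _ h => h.2
  refine ⟨κ₀, hκ0, ?_⟩
  filter_upwards [hrr, eventually_mem_nhdsWithin] with r hr hr0 α hα u₁ hu₁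
  have hr0 : 0 < r := hr0
  rw [lt_div_iff₀ hD0] at hr
  have hrD1 : r * D < r₁ := hr.trans_le (min_le_left _ _)
  have hrD2 : r * D < r₂ := hr.trans_le (min_le_right _ _)
  set a := N⁻¹ * ∑ j, α j with ha
  have haκ : |a| ≤ κ₀ := by
    rw [ha, abs_mul, abs_of_pos (inv_pos.2 hN0)]
    calc N⁻¹ * |∑ j, α j| ≤ N⁻¹ * ∑ _j : ι, κ₀ := by
          refine mul_le_mul_of_nonneg_left ?_ (by positivity)
          exact (Finset.abs_sum_le_sum_abs _ _).trans (Finset.sum_le_sum fun j _ => hα j)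
      _ = κ₀ := by
          rw [Finset.sum_const, Finset.card_univ, nsmul_eq_mul, ← hN]; field_simp
  set P : ι → E := fun j => p + r • (s j + α j • b i₀) with hPdef
  set q := p + (r * a) • b i₀ with hq
  have hPp : ∀ j, ‖P j - p‖ ≤ r * D := by
    intro j
    rw [hPdef]
    simp only [add_sub_cancel_left]
    rw [norm_smul, Real.norm_eq_abs, abs_of_pos hr0]
    refine mul_le_mul_of_nonneg_left ?_ hr0.le
    refine (norm_add_le _ _).trans ?_
    rw [norm_smul, hbn, mul_one, Real.norm_eq_abs]
    linarith [hsS j, hα j]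
  have hqp : ‖q - p‖ ≤ r * D := by
    rw [hq, add_sub_cancel_left, norm_smul, hbn, mul_one, Real.norm_eq_abs, abs_mul, abs_of_pos hr0]
    refine mul_le_mul_of_nonneg_left ?_ hr0.le
    linarith
  have hPq : ∀ j, P j - q = r • (s j + (α j - a) • b i₀) := by
    intro j
    simp only [hPdef, hq]
    rw [mul_smul, sub_smul]
    module
  have hPqn : ∀ j, ‖P j - q‖ ≤ r * D := by
    intro j
    rw [hPq, norm_smul, Real.norm_eq_abs, abs_of_pos hr0]
    refine mul_le_mul_of_nonneg_left ?_ hr0.le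
    refine (norm_add_le _ _).trans ?_
    rw [norm_smul, hbn, mul_one, Real.norm_eq_abs]
    have := abs_sub (α j) a
    linarith [hsS j, hα j]
  have hPb : ∀ j, P j ∈ ball p r₁ ∧ P j ∈ ball p r₂ := fun j => by
    rw [mem_ball, mem_ball, dist_eq_norm]
    exact ⟨(hPp j).trans_lt hrD1, (hPp j).trans_lt hrD2⟩
  have hqb : q ∈ ball p r₁ ∧ q ∈ ball p r₂ := by
    rw [mem_ball, mem_ball, dist_eq_norm]
    exact ⟨hqp.trans_lt hrD1, hqp.trans_lt hrD2⟩
  have hqK : q ∈ K := hr₁K hqb.1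
  have hPK : ∀ j, P j ∈ K := fun j => hr₁K (hPb j).1
  refine ⟨hqK, ?_⟩
  have hmean : q = (Fintype.card ι : ℝ)⁻¹ • ∑ j, P j := by
    rw [← hN]
    simp only [hPdef, Finset.sum_add_distrib, Finset.sum_const, Finset.card_univ, ← Finset.smul_sum,
      hsum, ← Finset.sum_smul, smul_add]
    rw [← Nat.cast_smul_eq_nsmul ℝ, ← hN, smul_smul, inv_mul_cancel₀ hN0.ne', one_smul, hq, ha,
      smul_zero, smul_zero, zero_add, smul_smul, smul_smul]
    congr 2; ring
  set Pm : E → E := fun x => (Fintype.card ι : ℝ)⁻¹ • ∑ j, R x (G x (P j)) (P j) with hPm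
  have hPapp : ∀ x ∈ ball x₀ (ρ / 2), ‖Pm x - R x (G x q) q‖ ≤ η * (r * D) := by
    intro x hx
    refine mean_sub_le (f := fun p => R x (G x p) p)
      (L := (fderiv ℝ (fun w : E × E => R w.1 (G w.1 w.2) w.2) (x, p)).comp
        (ContinuousLinearMap.inr ℝ E E)) hmean fun j => ?_
    exact (hP x (ball_subset_closedBall hx) _ (hPb j).1 _ hqb.1).trans
      (mul_le_mul_of_nonneg_left (hPqn j) hη0.le)
  have hGapp : ∀ x ∈ ball x₀ (ρ / 2), ∀ u, (∀ j, G x (P j) = u) → |u - G x q| ≤ η * (r * D) := by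
    intro x hx u hu
    have := mean_sub_le (f := fun p => G x p)
      (L := (fderiv ℝ (fun w : E × E => G w.1 w.2) (x, p)).comp
        (ContinuousLinearMap.inr ℝ E E)) hmean (ε := η * (r * D)) fun j =>
      (hG x (ball_subset_closedBall hx) _ (hPb j).2 _ hqb.2).trans
        (mul_le_mul_of_nonneg_left (hPqn j) hη0.le)
    simp only [hu, Finset.sum_const, Finset.card_univ, nsmul_eq_mul, smul_eq_mul, ← hN] at this
    rwa [← mul_assoc, inv_mul_cancel₀ hN0.ne', one_mul] at this
  set row : E → ι → E := fun x j =>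
    if j = i₀ then b i₀ else (r * d j)⁻¹ • (R x (G x (P j)) (P j) - Pm x) with hrow
  have hx₁' : x₁ ∈ ball x₀ (ρ / 2) := ball_subset_ball (by linarith) hx₁
  refine H.le_of_simplex b (i₀ := i₀) (p := P) hPK hqK hmean (c := fun j => r * d j)
    (fun j => mul_pos hr0 (hd j)) (ρ₁ := ρ / 2) (by linarith) (P := Pm) (fun x => rfl)
    (r := row) (fun x => by simp [hrow]) (fun x j hj => by simp [hrow, hj]) ?_ ?_ hx₁' hu₁ hpos ?_
  · intro x hx
    have hxc := ball_subset_closedBall hx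
    set L := (fderiv ℝ (fun w : E × E => R w.1 (G w.1 w.2) w.2) (x, p)).comp
        (ContinuousLinearMap.inr ℝ E E) with hL
    have hLc : ∀ y, ‖L y - y‖ ≤ 1 / 8 * ‖y‖ := fun y => H.fderiv_grad_close (hcb hxc) hp y
    refine near_identity_rows b (i₀ := i₀) (M := L - ContinuousLinearMap.id ℝ E) (fun y => hLc y)
      (by simp [hrow]) fun j hj => ?_
    have h1 : row x j = (r * d j)⁻¹ • (R x (G x (P j)) (P j) - Pm x) := by simp [hrow, hj]
    have hrd : 0 < r * d j := mul_pos hr0 (hd j)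
    have h2 : L (P j - q) = (r * d j) • L (b j) + (r * (α j - a)) • L (b i₀) := by
      rw [hPq, hs j hj, smul_add, smul_smul, smul_smul, map_add, map_smul, map_smul]
    have h3 : row x j - b j - (L - ContinuousLinearMap.id ℝ E) (b j) =
        (r * d j)⁻¹ • ((R x (G x (P j)) (P j) - R x (G x q) q - L (P j - q)) -
          (Pm x - R x (G x q) q) + (r * (α j - a)) • L (b i₀)) := by
      have h4 : L (b j) = (r * d j)⁻¹ • ((r * d j) • L (b j)) := by
        rw [smul_smul, inv_mul_cancel₀ hrd.ne', one_smul]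
      rw [h1, _root_.sub_apply, ContinuousLinearMap.id_apply, h2]
      conv_lhs => rw [h4]
      module
    have hLn : ‖L (b i₀)‖ ≤ 2 := by
      have h4 := hLc (b i₀)
      rw [hbn] at h4
      calc ‖L (b i₀)‖ = ‖(L (b i₀) - b i₀) + b i₀‖ := by congr 1; abel
        _ ≤ 1 / 8 * 1 + 1 := (norm_add_le _ _).trans (add_le_add h4 (hbn i₀).le)
        _ ≤ 2 := by norm_num
    have h5 : ‖R x (G x (P j)) (P j) - R x (G x q) q - L (P j - q)‖ ≤ η * (r * D) :=
      (hP x hxc _ (hPb j).1 _ hqb.1).trans (mul_le_mul_of_nonneg_left (hPqn j) hη0.le)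
    have h6 : ‖(r * (α j - a)) • L (b i₀)‖ ≤ r * (2 * κ₀) * 2 := by
      rw [norm_smul, Real.norm_eq_abs, abs_mul, abs_of_pos hr0]
      refine mul_le_mul (mul_le_mul_of_nonneg_left ?_ hr0.le) hLn (norm_nonneg _) (by positivity)
      have := abs_sub (α j) a
      linarith [hα j]
    rw [h3, norm_smul, norm_inv, Real.norm_eq_abs, abs_of_pos hrd, inv_mul_le_iff₀ hrd]
    have h7 := hPapp x hx
    have h8 : ‖(R x (G x (P j)) (P j) - R x (G x q) q - L (P j - q)) - (Pm x - R x (G x q) q) +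
        (r * (α j - a)) • L (b i₀)‖ ≤ η * (r * D) + η * (r * D) + r * (2 * κ₀) * 2 :=
      (norm_add_le _ _).trans (add_le_add ((norm_sub_le _ _).trans (add_le_add h5 h7)) h6)
    refine h8.trans ?_
    rw [← hN]
    calc η * (r * D) + η * (r * D) + r * (2 * κ₀) * 2 = r * (2 * (η * D) + 4 * κ₀) := by ring
      _ ≤ r * (2 * (δ / (32 * N)) + 4 * (δ / (64 * N))) :=
          mul_le_mul_of_nonneg_left (by linarith) hr0.le
      _ = r * δ * (1 / (8 * N)) := by field_simp; norm_num
      _ ≤ r * d j * (1 / (8 * N)) :=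
          mul_le_mul_of_nonneg_right (mul_le_mul_of_nonneg_left (hδd j) hr0.le) (by positivity)
  · intro x hx u hu j
    have hxB := hcb (ball_subset_closedBall hx)
    have huU : u ∈ U := hu i₀ ▸ H.G_mem x hxB _ (hPK i₀)
    have h1 := H.R_lip x hxB q hqK u huU _ (H.G_mem x hxB _ hqK)
    have h2 := hGapp x hx u hu
    have h3 := hPapp x hx
    rw [norm_sub_rev] at h3
    have h4 : ‖R x u q - R x (G x q) q‖ ≤ |C| * (η * (r * D)) :=
      h1.trans (mul_le_mul (le_abs_self C) h2 (abs_nonneg _) (abs_nonneg _))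
    rw [← hN]
    calc ‖R x u q - Pm x‖ = ‖(R x u q - R x (G x q) q) + (R x (G x q) q - Pm x)‖ := by
          congr 1; abel
      _ ≤ |C| * (η * (r * D)) + η * (r * D) := (norm_add_le _ _).trans (add_le_add h4 h3)
      _ = r * (η * D * (|C| + 1)) := by ring
      _ = r * δ / (32 * N) := by rw [hηD]; ring
      _ ≤ r * d j / (4 * N) := by
          refine div_le_div₀ (mul_pos hr0 (hd j)).le (mul_le_mul_of_nonneg_left (hδd j) hr0.le)
            (by positivity) (by linarith)
  · have h1 : ⟪b i₀, x₁ - x₀⟫ ≤ ‖x₁ - x₀‖ := by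
      have := real_inner_le_norm (b i₀) (x₁ - x₀)
      rwa [hbn, one_mul] at this
    have h2 : ‖x₁ - x₀‖ < ρ / 8 := by rwa [← dist_eq_norm]
    linarith

/-- In a local model `G x₁` is quasiconvex. -/
theorem quasiconvexOn [FiniteDimensional ℝ E] {x₁ : E} (hx₁ : x₁ ∈ ball x₀ (ρ / 8)) :
    QuasiconvexOn ℝ K (G x₁) := by
  have hρ8 : 0 < ρ / 8 := pos_of_mem_ball hx₁
  have hx₁B : x₁ ∈ ball x₀ ρ := ball_subset_ball (by linarith) hx₁
  by_cases hx : x₁ = x₀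
  · subst hx
    rw [quasiconvexOn_iff_le_max]
    refine ⟨H.convex_K, fun p hp q hq a c ha hc hac => ?_⟩
    rw [H.G_base _ hp, H.G_base _ hq, H.G_base _ (H.convex_K hp hq ha hc hac), max_self]
  -- At a touching point `p`, points `p + r (s j + α j b i₀)` are chosen on the level of `p`.
  -- Summing the touching inequalities over `j` gives `∑ α j > 0`, because the quadratic has
  -- negative sum. The mean of the points is thus `p + a b i₀` with `a > 0`, where `G x₁` exceeds
  -- its value at `p`; the simplex comparison says the opposite.
  by_contra hnq
  obtain ⟨v, hv⟩ : ∃ v, v = x₁ - x₀ := ⟨_, rfl⟩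
  have hv0 : 0 < ‖v‖ := by rw [hv, norm_pos_iff]; exact sub_ne_zero.2 hx
  have hgr : ∀ p, ∃ h : E, p ∈ K → HasFDerivAt (G x₁) (innerSL ℝ h) p ∧ ‖h - v‖ ≤ 1 / 8 * ‖v‖ := by
    intro p
    by_cases hp : p ∈ K
    · obtain ⟨h, h1, h2⟩ := H.exists_gradient hx₁B hp
      exact ⟨h, fun _ => ⟨h1, hv ▸ h2⟩⟩
    · exact ⟨0, fun h => absurd h hp⟩
  choose f' hf' using hgr
  have hf'n : ∀ p ∈ K, 7 / 8 * ‖v‖ ≤ ‖f' p‖ := by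
    intro p hp
    have h1 := (hf' p hp).2
    have h2 : ‖v‖ ≤ ‖f' p‖ + ‖f' p - v‖ := by
      calc ‖v‖ = ‖f' p - (f' p - v)‖ := by congr 1; abel
        _ ≤ _ := norm_sub_le _ _
    linarith
  obtain ⟨p, hp, q, hqc, hqr, hqt, e, he, hhe, hqe⟩ := exists_touching_of_not_quasiconvexOn H.isOpen_K
    H.convex_K (fun p hp => (hf' p hp).1) (c := 7 / 8 * ‖v‖) (by positivity) hf'n hnq
  obtain ⟨h, hh⟩ : ∃ h, h = f' p := ⟨_, rfl⟩
  obtain ⟨hfp, hhv⟩ := hf' p hp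
  have hhn := hf'n p hp
  rw [← hh] at hqt hhe hfp hhv hhn
  have hh0 : 0 < ‖h‖ := by linarith
  have hh1 : ‖‖h‖⁻¹ • h‖ = 1 := by
    rw [norm_smul, norm_inv, norm_norm, inv_mul_cancel₀ hh0.ne']
  obtain ⟨t, b, i₀, i₁, hi, hb0, hb1⟩ := exists_orthonormalBasis_of_orthonormal_pair hh1 he
    (by rw [inner_smul_left, hhe, mul_zero])
  classical
  have : Nontrivial E := ⟨⟨h, 0, norm_pos_iff.1 hh0⟩⟩
  have : Nonempty t := ⟨i₀⟩
  obtain ⟨d, s, hd, hs, hsum, hs0, hsq⟩ := exists_simplex_sum_neg b hi hqc hqr (by rw [hb1]; exact hqe)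
  have hhb : h = ‖h‖ • b i₀ := by
    rw [hb0, smul_smul, mul_inv_cancel₀ hh0.ne', one_smul]
  have hhs : ∀ j, ⟪h, s j⟫ = 0 := by
    intro j; rw [hhb, inner_smul_left, hs0, mul_zero]
  have hhb0 : ⟪h, b i₀⟫ = ‖h‖ := by
    conv_lhs => rw [hhb]
    rw [inner_smul_left, real_inner_self_eq_norm_sq, b.orthonormal.1]; simp
  have hhu : ‖h‖ ≤ 9 / 8 * ‖v‖ := by
    calc ‖h‖ = ‖(h - v) + v‖ := by congr 1; abel
      _ ≤ 1 / 8 * ‖v‖ + ‖v‖ := (norm_add_le _ _).trans (by linarith)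
      _ = 9 / 8 * ‖v‖ := by ring
  -- `b i₀` is the direction of `h`, which is within `‖v‖ / 8` of `v`; `7 / 9` is `(7 / 8) / (9 /
  -- 8)`.
  have hbv : 7 / 9 * ‖v‖ ≤ ⟪b i₀, v⟫ := by
    have h1 : ‖h‖ * ⟪b i₀, v⟫ = ‖v‖ ^ 2 + ⟪h - v, v⟫ := by
      rw [inner_sub_left, real_inner_self_eq_norm_sq]
      conv_rhs => rw [hhb]
      rw [inner_smul_left]; simp
    have h2 : |⟪h - v, v⟫| ≤ 1 / 8 * ‖v‖ * ‖v‖ :=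
      (abs_real_inner_le_norm _ _).trans (mul_le_mul_of_nonneg_right hhv (norm_nonneg _))
    have h3 := (abs_le.1 h2).1
    have h4 : 7 / 8 * ‖v‖ * ‖v‖ ≤ ‖h‖ * ⟪b i₀, v⟫ := by rw [h1]; linarith
    have h5 : 0 ≤ ⟪b i₀, v⟫ := by
      by_contra! h6
      have := mul_neg_of_pos_of_neg hh0 h6
      have : 0 ≤ 7 / 8 * ‖v‖ * ‖v‖ := by positivity
      linarith
    have h6 : ‖h‖ * ⟪b i₀, v⟫ ≤ 9 / 8 * ‖v‖ * ⟪b i₀, v⟫ := mul_le_mul_of_nonneg_right hhu h5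
    have h7 : 7 / 8 * ‖v‖ ≤ 9 / 8 * ⟪b i₀, v⟫ := by
      refine le_of_mul_le_mul_right (a := ‖v‖) ?_ hv0
      linarith
    linarith
  obtain ⟨κ₀, hκ₀, hsimp⟩ := H.le_of_small_simplex b (i₀ := i₀) hp hd hs hsum hx₁
    (by rw [← hv]; linarith)
  obtain ⟨κ₁, hκ₁, hκq⟩ : ∃ κ₁ > 0, ∀ α : t → ℝ, (∀ j, |α j| ≤ κ₁) →
      ∑ j, q (s j + α j • b i₀) < 0 := by
    have h1 : Continuous fun α : t → ℝ => ∑ j, q (s j + α j • b i₀) :=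
      continuous_finsetSum _ fun j _ => hqc.comp (by fun_prop)
    have h2 : ∀ᶠ α in 𝓝 (0 : t → ℝ), ∑ j, q (s j + α j • b i₀) < 0 :=
      h1.continuousAt.eventually (gt_mem_nhds (by simpa using hsq))
    obtain ⟨κ, hκ, hball⟩ := Metric.eventually_nhds_iff.1 h2
    refine ⟨κ / 2, by positivity, fun α hα => hball ?_⟩
    rw [dist_zero_right]
    exact ((pi_norm_le_iff_of_nonneg (by positivity)).2 hα).trans_lt (by linarith)
  have hcont : ContinuousOn (G x₁) K := fun p hp => (hf' p hp).1.continuousAt.continuousWithinAt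
  have hlev := exists_level_points H.isOpen_K hcont hp hfp (e := b i₀) (by rw [hhb0]; exact hh0)
    (b.orthonormal.1 i₀) hhs (lt_min hκ₀ hκ₁)
  obtain ⟨δ, hδ, hδt⟩ := Metric.eventually_nhds_iff.1 hqt
  have hrs : ∀ᶠ r in 𝓝[>] (0:ℝ), r < δ / (∑ j, ‖s j‖ + κ₁ + 1) := by
    refine mem_of_superset (Ioo_mem_nhdsGT ?_) fun _ h => h.2
    have : 0 ≤ ∑ j, ‖s j‖ := Finset.sum_nonneg fun j _ => norm_nonneg _
    positivity
  obtain ⟨r, ⟨⟨⟨hr1, α, hα, hαG⟩, hr2⟩, hr0⟩⟩ :=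
    (((hsimp.and hlev).and hrs).and eventually_mem_nhdsWithin).exists
  have hr0 : 0 < r := hr0
  have hα0 : ∀ j, |α j| ≤ κ₀ := fun j => (hα j).trans (min_le_left _ _)
  have hα1 : ∀ j, |α j| ≤ κ₁ := fun j => (hα j).trans (min_le_right _ _)
  obtain ⟨hqK, hle⟩ := hr1 α hα0 (G x₁ p) hαG
  have hsn : 0 ≤ ∑ j, ‖s j‖ := Finset.sum_nonneg fun j _ => norm_nonneg _
  have hpt : ∀ j, 0 ≤ r * (‖h‖ * α j) + r ^ 2 * q (s j + α j • b i₀) := by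
    intro j
    have h1 := hδt (y := p + r • (s j + α j • b i₀)) (by
      rw [dist_eq_norm, add_sub_cancel_left, norm_smul, Real.norm_eq_abs, abs_of_pos hr0]
      rw [lt_div_iff₀ (by linarith)] at hr2
      refine lt_of_le_of_lt (mul_le_mul_of_nonneg_left ?_ hr0.le) hr2
      refine (norm_add_le _ _).trans ?_
      rw [norm_smul, b.orthonormal.1, mul_one, Real.norm_eq_abs]
      have h2 : ‖s j‖ ≤ ∑ j, ‖s j‖ := Finset.single_le_sum (f := fun j => ‖s j‖)
        (fun k _ => norm_nonneg _) (Finset.mem_univ j)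
      linarith [hα1 j])
    rw [hαG j, add_sub_cancel_left, hqr, inner_smul_right, inner_add_right, inner_smul_right, hhs,
      hhb0, zero_add, mul_comm (α j)] at h1
    linarith
  have hsumα : 0 < ∑ j, α j := by
    have h1 : 0 ≤ ∑ j, (r * (‖h‖ * α j) + r ^ 2 * q (s j + α j • b i₀)) :=
      Finset.sum_nonneg fun j _ => hpt j
    rw [Finset.sum_add_distrib, ← Finset.mul_sum, ← Finset.mul_sum, ← Finset.mul_sum] at h1
    have h2 : r ^ 2 * ∑ j, q (s j + α j • b i₀) < 0 :=
      mul_neg_of_pos_of_neg (by positivity) (hκq α hα1)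
    by_contra! h3
    have h4 : r * (‖h‖ * ∑ j, α j) ≤ 0 :=
      mul_nonpos_of_nonneg_of_nonpos hr0.le (mul_nonpos_of_nonneg_of_nonpos hh0.le h3)
    linarith
  obtain ⟨a, ha⟩ : ∃ a, a = r * ((Fintype.card t : ℝ)⁻¹ * ∑ j, α j) := ⟨_, rfl⟩
  have ha0 : 0 < a := by
    have : (0:ℝ) < Fintype.card t := by exact_mod_cast Fintype.card_pos
    rw [ha]; positivity
  rw [← ha] at hqK hle
  -- The value rises by at least `a (7 / 9 - 1 / 8) ‖v‖ > 0` from `p` to the mean.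
  have hest := H.abs_G_sub_sub_inner_le hx₁B hqK hp
  rw [add_sub_cancel_left, ← hv, inner_smul_left, norm_smul, b.orthonormal.1, Real.norm_eq_abs,
    abs_of_pos ha0, mul_one, conj_trivial] at hest
  have h1 := (abs_le.1 hest).1
  have h2 : a * (7 / 9 * ‖v‖) ≤ a * ⟪b i₀, v⟫ := mul_le_mul_of_nonneg_left hbv ha0.le
  have h3 : 0 < a * ‖v‖ := by positivity
  linarith

end LocalModel
end Calculus
end GenFun


namespace GenFun
open Set Filter Topology Metric
open scoped RealInnerProductSpace

/-! ### Smoothness of inverses and partial derivatives. -/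

section Inverse

/-- Near each image point the given left inverse coincides with the local inverse of the inverse
function theorem. Used for `(Y, Z)` and for `g*`, whose values off their domains are arbitrary. -/
theorem isOpen_image_and_contDiffOn_leftInverse {E F : Type*} [NormedAddCommGroup E]
    [NormedSpace ℝ E] [FiniteDimensional ℝ E] [NormedAddCommGroup F] [NormedSpace ℝ F]
    [FiniteDimensional ℝ F] (hdim : Module.finrank ℝ E = Module.finrank ℝ F) {k : WithTop ℕ∞}
    (hk : k ≠ 0) {f : E → F} {s : Set E} (hs : IsOpen s) (hf : ContDiffOn ℝ k f s)
    (hf' : ∀ x ∈ s, Function.Injective (fderiv ℝ f x)) {f₁ : F → E} (hf₁ : ∀ x ∈ s, f₁ (f x) = x) :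
    IsOpen (f '' s) ∧ ContDiffOn ℝ k f₁ (f '' s) := by
  have := FiniteDimensional.complete ℝ E
  have key : ∀ x ∈ s, f '' s ∈ 𝓝 (f x) ∧ ContDiffAt ℝ k f₁ (f x) := by
    intro x hx
    have hc : ContDiffAt ℝ k f x := hf.contDiffAt (hs.mem_nhds hx)
    set e : E ≃L[ℝ] F := (LinearMap.linearEquivOfInjective (fderiv ℝ f x).toLinearMap
      (hf' x hx) hdim).toContinuousLinearEquiv with he
    have hd : HasFDerivAt f (e : E →L[ℝ] F) x := by
      have : (e : E →L[ℝ] F) = fderiv ℝ f x := by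
        ext v; simp [he]
      rw [this]
      exact (hc.differentiableAt hk).hasFDerivAt
    have h1 := hc.toOpenPartialHomeomorph_coe hd hk
    set φ := hc.toOpenPartialHomeomorph f hd hk with hφ
    have hxφ : x ∈ φ.source := hc.mem_toOpenPartialHomeomorph_source hd hk
    have h2 : ContDiffAt ℝ k φ.symm (f x) := hc.to_localInverse hd hk
    have h3 : φ.symm (f x) = x := by
      rw [← h1]; exact φ.left_inv hxφ
    have h4 : ∀ᶠ y in 𝓝 (f x), φ.symm y ∈ s :=
      h2.continuousAt.eventually (by rw [h3]; exact hs.mem_nhds hx)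
    have h5 : ∀ᶠ y in 𝓝 (f x), f (φ.symm y) = y := by
      have := φ.eventually_right_inverse (φ.map_source hxφ)
      rwa [h1] at this
    refine ⟨?_, h2.congr_of_eventuallyEq ?_⟩
    · filter_upwards [h4, h5] with y hy hy'
      exact ⟨_, hy, hy'⟩
    · filter_upwards [h4, h5] with y hy hy'
      rw [← hf₁ _ hy, hy']
  refine ⟨isOpen_iff_mem_nhds.2 ?_, ?_⟩
  · rintro _ ⟨x, hx, rfl⟩; exact (key x hx).1
  · rintro _ ⟨x, hx, rfl⟩; exact (key x hx).2.contDiffWithinAt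

theorem fderiv_prod₃ {E F G H : Type*} [NormedAddCommGroup E] [NormedSpace ℝ E]
    [NormedAddCommGroup F] [NormedSpace ℝ F] [NormedAddCommGroup G] [NormedSpace ℝ G]
    [NormedAddCommGroup H] [NormedSpace ℝ H] {f : E → F → G → H} {x : E} {y : F} {z : G}
    (hf : DifferentiableAt ℝ (fun w : E × F × G => f w.1 w.2.1 w.2.2) (x, y, z))
    (ξ : E) (η : F) (ζ : G) :
    fderiv ℝ (fun w : E × F × G => f w.1 w.2.1 w.2.2) (x, y, z) (ξ, η, ζ) =
      fderiv ℝ (fun x' => f x' y z) x ξ + fderiv ℝ (fun y' => f x y' z) y η +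
        fderiv ℝ (fun z' => f x y z') z ζ := by
  have h := hf.hasFDerivAt
  have h1 : HasFDerivAt (fun x' => f x' y z) _ x :=
    HasFDerivAt.comp (f := fun x' => (x', y, z)) x h
      ((hasFDerivAt_id x).prodMk (hasFDerivAt_const (y, z) x))
  have h2 : HasFDerivAt (fun y' => f x y' z) _ y :=
    HasFDerivAt.comp (f := fun y' => (x, y', z)) y h
      ((hasFDerivAt_const x y).prodMk ((hasFDerivAt_id y).prodMk (hasFDerivAt_const z y)))
  have h3 : HasFDerivAt (fun z' => f x y z') _ z :=
    HasFDerivAt.comp (f := fun z' => (x, y, z')) z h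
      ((hasFDerivAt_const x z).prodMk ((hasFDerivAt_const y z).prodMk (hasFDerivAt_id z)))
  rw [h1.fderiv, h2.fderiv, h3.fderiv]
  simp only [ContinuousLinearMap.comp_apply, ContinuousLinearMap.prod_apply, ← map_add]
  congr 1
  simp

end Inverse

/-! ### First and second derivatives of a generating function. -/

section Generating
variable {n : ℕ} {g : Pt n → Pt n → ℝ → ℝ} {Γ : Set (Pt n × Pt n × ℝ)} {x y : Pt n} {z : ℝ}

namespace IsGenerating
variable (hg : IsGenerating g Γ)
include hg

theorem contDiffAt (h : (x, y, z) ∈ Γ) :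
    ContDiffAt ℝ 2 (fun w : Pt n × Pt n × ℝ => g w.1 w.2.1 w.2.2) (x, y, z) :=
  hg.contDiffOn.contDiffAt (hg.isOpen.mem_nhds h)

theorem differentiableAt (h : (x, y, z) ∈ Γ) :
    DifferentiableAt ℝ (fun w : Pt n × Pt n × ℝ => g w.1 w.2.1 w.2.2) (x, y, z) :=
  (hg.contDiffAt h).differentiableAt two_ne_zero

theorem differentiableAt_left (h : (x, y, z) ∈ Γ) : DifferentiableAt ℝ (fun x' => g x' y z) x :=
  DifferentiableAt.comp (f := fun x' => (x', y, z)) x (hg.differentiableAt h) (by fun_prop)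

theorem differentiableAt_mid (h : (x, y, z) ∈ Γ) : DifferentiableAt ℝ (fun y' => g x y' z) y :=
  DifferentiableAt.comp (f := fun y' => (x, y', z)) y (hg.differentiableAt h) (by fun_prop)

theorem differentiableAt_right (h : (x, y, z) ∈ Γ) : DifferentiableAt ℝ (fun z' => g x y z') z :=
  DifferentiableAt.comp (f := fun z' => (x, y, z')) z (hg.differentiableAt h) (by fun_prop)

theorem hasFDerivAt_left (h : (x, y, z) ∈ Γ) :
    HasFDerivAt (fun x' => g x' y z) (innerSL ℝ (gx g x y z)) x :=
  (hg.differentiableAt_left h).hasGradientAt.hasFDerivAt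

theorem hasFDerivAt_mid (h : (x, y, z) ∈ Γ) :
    HasFDerivAt (fun y' => g x y' z) (innerSL ℝ (gy g x y z)) y :=
  (hg.differentiableAt_mid h).hasGradientAt.hasFDerivAt

theorem hasDerivAt_right (h : (x, y, z) ∈ Γ) : HasDerivAt (fun z' => g x y z') (gz g x y z) z :=
  (hg.differentiableAt_right h).hasDerivAt

theorem fderiv_eq (h : (x, y, z) ∈ Γ) (ξ η : Pt n) (ζ : ℝ) :
    fderiv ℝ (fun w : Pt n × Pt n × ℝ => g w.1 w.2.1 w.2.2) (x, y, z) (ξ, η, ζ) =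
      ⟪gx g x y z, ξ⟫ + ⟪gy g x y z, η⟫ + gz g x y z * ζ := by
  rw [fderiv_prod₃ (hg.differentiableAt h), (hg.hasFDerivAt_left h).fderiv,
    (hg.hasFDerivAt_mid h).fderiv, (hg.hasDerivAt_right h).hasFDerivAt.fderiv]
  simp [mul_comm]

theorem contDiffOn_fderiv (v : Pt n × Pt n × ℝ) : ContDiffOn ℝ 1
    (fun w => fderiv ℝ (fun w : Pt n × Pt n × ℝ => g w.1 w.2.1 w.2.2) w v) Γ :=
  (hg.contDiffOn.fderiv_of_isOpen hg.isOpen (by norm_num)).clm_apply contDiffOn_const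

theorem contDiffOn_gx :
    ContDiffOn ℝ 1 (fun w : Pt n × Pt n × ℝ => gx g w.1 w.2.1 w.2.2) Γ := by
  rw [contDiffOn_euclidean]
  refine fun i => (hg.contDiffOn_fderiv (EuclideanSpace.single i 1, 0, 0)).congr fun w hw => ?_
  rw [hg.fderiv_eq (x := w.1) (y := w.2.1) (z := w.2.2) hw]
  simp [EuclideanSpace.inner_single_right]

theorem contDiffOn_gy :
    ContDiffOn ℝ 1 (fun w : Pt n × Pt n × ℝ => gy g w.1 w.2.1 w.2.2) Γ := by
  rw [contDiffOn_euclidean]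
  refine fun i => (hg.contDiffOn_fderiv (0, EuclideanSpace.single i 1, 0)).congr fun w hw => ?_
  rw [hg.fderiv_eq (x := w.1) (y := w.2.1) (z := w.2.2) hw]
  simp [EuclideanSpace.inner_single_right]

theorem contDiffOn_gz :
    ContDiffOn ℝ 1 (fun w : Pt n × Pt n × ℝ => gz g w.1 w.2.1 w.2.2) Γ := by
  refine (hg.contDiffOn_fderiv (0, 0, 1)).congr fun w hw => ?_
  rw [hg.fderiv_eq (x := w.1) (y := w.2.1) (z := w.2.2) hw]
  simp

theorem gz_ne_zero (h : (x, y, z) ∈ Γ) : gz g x y z ≠ 0 := (hg.gz_neg _ _ _ h).ne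

theorem contDiffOn_Q :
    ContDiffOn ℝ 1 (fun w : Pt n × Pt n × ℝ => Q g w.1 w.2.1 w.2.2) Γ :=
  ((hg.contDiffOn_gz.inv fun _ hw => hg.gz_ne_zero hw).smul hg.contDiffOn_gy).neg

theorem contDiffAt_gx (h : (x, y, z) ∈ Γ) :
    ContDiffAt ℝ 1 (fun w : Pt n × Pt n × ℝ => gx g w.1 w.2.1 w.2.2) (x, y, z) :=
  hg.contDiffOn_gx.contDiffAt (hg.isOpen.mem_nhds h)

theorem contDiffAt_Q (h : (x, y, z) ∈ Γ) :
    ContDiffAt ℝ 1 (fun w : Pt n × Pt n × ℝ => Q g w.1 w.2.1 w.2.2) (x, y, z) :=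
  hg.contDiffOn_Q.contDiffAt (hg.isOpen.mem_nhds h)

theorem differentiableAt_gx (h : (x, y, z) ∈ Γ) :
    DifferentiableAt ℝ (fun w : Pt n × Pt n × ℝ => gx g w.1 w.2.1 w.2.2) (x, y, z) :=
  (hg.contDiffAt_gx h).differentiableAt one_ne_zero

theorem fderiv_gx (h : (x, y, z) ∈ Γ) (ξ η : Pt n) (ζ : ℝ) :
    fderiv ℝ (fun w : Pt n × Pt n × ℝ => gx g w.1 w.2.1 w.2.2) (x, y, z) (ξ, η, ζ) =
      gxx g x y z ξ + gxy g x y z η + ζ • gxz g x y z := by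
  rw [fderiv_prod₃ (hg.differentiableAt_gx h), gxz, ← fderiv_apply_one_eq_deriv, ← map_smul]
  simp [gxx, gxy]

theorem hasDerivAt_comp {X Y' : ℝ → Pt n} {Z' : ℝ → ℝ} {ξ η : Pt n} {ζ t : ℝ}
    (hX : HasDerivAt X ξ t) (hY : HasDerivAt Y' η t) (hZ : HasDerivAt Z' ζ t)
    (h : (X t, Y' t, Z' t) ∈ Γ) :
    HasDerivAt (fun s => g (X s) (Y' s) (Z' s)) (⟪gx g (X t) (Y' t) (Z' t), ξ⟫ +
      ⟪gy g (X t) (Y' t) (Z' t), η⟫ + gz g (X t) (Y' t) (Z' t) * ζ) t := by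
  have := HasFDerivAt.comp_hasDerivAt (f := fun s => (X s, Y' s, Z' s)) t
    (hg.differentiableAt h).hasFDerivAt (hX.prodMk (hY.prodMk hZ))
  rwa [hg.fderiv_eq h] at this

theorem hasDerivAt_gx_comp {X Y' : ℝ → Pt n} {Z' : ℝ → ℝ} {ξ η : Pt n} {ζ t : ℝ}
    (hX : HasDerivAt X ξ t) (hY : HasDerivAt Y' η t) (hZ : HasDerivAt Z' ζ t)
    (h : (X t, Y' t, Z' t) ∈ Γ) :
    HasDerivAt (fun s => gx g (X s) (Y' s) (Z' s)) (gxx g (X t) (Y' t) (Z' t) ξ +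
      gxy g (X t) (Y' t) (Z' t) η + ζ • gxz g (X t) (Y' t) (Z' t)) t := by
  have := HasFDerivAt.comp_hasDerivAt (f := fun s => (X s, Y' s, Z' s)) t
    (hg.differentiableAt_gx h).hasFDerivAt (hX.prodMk (hY.prodMk hZ))
  rwa [hg.fderiv_gx h] at this

theorem gy_eq (h : (x, y, z) ∈ Γ) : gy g x y z = -(gz g x y z) • Q g x y z := by
  rw [Q, smul_neg, neg_smul, neg_neg, smul_smul, mul_inv_cancel₀ (hg.gz_ne_zero h), one_smul]

theorem strictAntiOn (x y : Pt n) : StrictAntiOn (fun z => g x y z) {z | (x, y, z) ∈ Γ} := by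
  refine strictAntiOn_of_deriv_neg (hg.ordConnected x y).convex
    (fun z hz => (hg.differentiableAt_right hz).continuousAt.continuousWithinAt)
    fun z hz => ?_
  have h : z ∈ {z | (x, y, z) ∈ Γ} := interior_subset hz
  exact hg.gz_neg x y z h

theorem injective_fderiv_flip (h : (x, y, z) ∈ Γ) : Function.Injective (fderiv ℝ
    (fun w : Pt n × Pt n × ℝ => (w.2.1, w.1, g w.1 w.2.1 w.2.2)) (x, y, z)) := by
  have h1 : HasFDerivAt (fun w : Pt n × Pt n × ℝ => (w.2.1, w.1, g w.1 w.2.1 w.2.2)) _ (x, y, z) :=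
    (hasFDerivAt_snd.fst).prodMk (hasFDerivAt_fst.prodMk (hg.differentiableAt h).hasFDerivAt)
  rw [h1.fderiv]
  refine (injective_iff_map_eq_zero _).2 ?_
  rintro ⟨ξ, η, ζ⟩ hv
  simp only [ContinuousLinearMap.prod_apply, ContinuousLinearMap.comp_apply, Prod.mk_eq_zero,
    ContinuousLinearMap.coe_fst', ContinuousLinearMap.coe_snd', hg.fderiv_eq h] at hv
  obtain ⟨rfl, rfl, hv⟩ := hv
  simpa [hg.gz_ne_zero h] using hv

/-- In the kernel `ξ = 0`, and the row of `g` gives `ζ = -⟪g_y, η⟫ / g_z`. Substituted in the row of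
`g_x` this leaves `E η = 0`, which is how `E` arises. -/
theorem injective_fderiv_jet (hE : (matE g x y z).det ≠ 0) (h : (x, y, z) ∈ Γ) :
    Function.Injective (fderiv ℝ
      (fun w : Pt n × Pt n × ℝ => (w.1, g w.1 w.2.1 w.2.2, gx g w.1 w.2.1 w.2.2)) (x, y, z)) := by
  have h1 : HasFDerivAt (fun w : Pt n × Pt n × ℝ =>
      (w.1, g w.1 w.2.1 w.2.2, gx g w.1 w.2.1 w.2.2)) _ (x, y, z) :=
    hasFDerivAt_fst.prodMk ((hg.differentiableAt h).hasFDerivAt.prodMk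
      (hg.differentiableAt_gx h).hasFDerivAt)
  rw [h1.fderiv]
  refine (injective_iff_map_eq_zero _).2 ?_
  rintro ⟨ξ, η, ζ⟩ hv
  simp only [ContinuousLinearMap.prod_apply, Prod.mk_eq_zero,
    ContinuousLinearMap.coe_fst', hg.fderiv_eq h, hg.fderiv_gx h] at hv
  obtain ⟨rfl, h2, h3⟩ := hv
  have hz := hg.gz_ne_zero h
  have h4 : ζ = -((gz g x y z)⁻¹ * ⟪gy g x y z, η⟫) := by
    rw [inner_zero_right, zero_add] at h2
    field_simp; linarith
  have h5 : matE g x y z η = 0 := by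
    rw [map_zero, zero_add, h4] at h3
    rw [← h3, matE]
    simp [smul_smul, sub_eq_add_neg]
  have h6 : η = 0 := by
    have h7 : Function.Injective (matE g x y z) := by
      exact (LinearMap.equivOfDetNeZero (matE g x y z).toLinearMap hE).injective
    exact h7 (by rw [h5, map_zero])
  subst h6
  simp [h4]

end IsGenerating
end Generating
end GenFun


namespace GenFun
open Set Filter Topology Metric
open scoped RealInnerProductSpace

/-! ### The dual generating function and its structural conditions. -/

section Duality
variable {n : ℕ} {g : Pt n → Pt n → ℝ → ℝ} {Γ : Set (Pt n × Pt n × ℝ)} {x y : Pt n} {z u : ℝ}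
  {p : Pt n}

/-- A generating function satisfying A1, A2 and A1*. -/
structure IsRegular (g : Pt n → Pt n → ℝ → ℝ) (Γ : Set (Pt n × Pt n × ℝ)) : Prop
    extends IsGenerating g Γ where
  a1 : A1 g Γ
  a2 : A2 g Γ
  a1star : A1star g Γ

theorem mem_setU (h : (x, y, z) ∈ Γ) : (x, g x y z, gx g x y z) ∈ setU g Γ := ⟨x, y, z, h, rfl⟩

theorem mem_dualSet (h : (x, y, z) ∈ Γ) : (y, x, g x y z) ∈ dualSet g Γ := ⟨x, y, z, h, rfl⟩

theorem mem_dualSet_iff : (y, x, u) ∈ dualSet g Γ ↔ ∃ z, (x, y, z) ∈ Γ ∧ g x y z = u := by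
  constructor
  · rintro ⟨x', y', z, h, he⟩
    simp only [Prod.mk.injEq] at he
    obtain ⟨rfl, rfl, rfl⟩ := he
    exact ⟨z, h, rfl⟩
  · rintro ⟨z, h, rfl⟩; exact mem_dualSet h

theorem setU_eq_image : setU g Γ =
    (fun w : Pt n × Pt n × ℝ => (w.1, g w.1 w.2.1 w.2.2, gx g w.1 w.2.1 w.2.2)) '' Γ := by
  ext w; constructor
  · rintro ⟨x, y, z, h, rfl⟩; exact ⟨_, h, rfl⟩
  · rintro ⟨w, h, rfl⟩; exact ⟨w.1, w.2.1, w.2.2, h, rfl⟩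

theorem dualSet_eq_image : dualSet g Γ =
    (fun w : Pt n × Pt n × ℝ => (w.2.1, w.1, g w.1 w.2.1 w.2.2)) '' Γ := by
  ext w; constructor
  · rintro ⟨x, y, z, h, rfl⟩; exact ⟨_, h, rfl⟩
  · rintro ⟨w, h, rfl⟩; exact ⟨w.1, w.2.1, w.2.2, h, rfl⟩

theorem generates_YZ (h : (x, u, p) ∈ setU g Γ) : Generates g Γ x u p (YZ g Γ x u p) := by
  obtain ⟨x', y', z', h', he⟩ := h
  simp only [Prod.mk.injEq] at he
  obtain ⟨rfl, rfl, rfl⟩ := he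
  exact Classical.epsilon_spec (p := Generates g Γ x _ _) ⟨(y', z'), h', rfl, rfl⟩

theorem YZ_mem (h : (x, u, p) ∈ setU g Γ) : (x, (YZ g Γ x u p).1, (YZ g Γ x u p).2) ∈ Γ :=
  (generates_YZ h).1

theorem apply_YZ (h : (x, u, p) ∈ setU g Γ) : g x (YZ g Γ x u p).1 (YZ g Γ x u p).2 = u :=
  (generates_YZ h).2.1

theorem gx_YZ (h : (x, u, p) ∈ setU g Γ) : gx g x (YZ g Γ x u p).1 (YZ g Γ x u p).2 = p :=
  (generates_YZ h).2.2

theorem YZ_eq (h1 : A1 g Γ) (h : (x, y, z) ∈ Γ) :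
    YZ g Γ x (g x y z) (gx g x y z) = (y, z) :=
  (h1 _ _ _ (mem_setU h)).unique (generates_YZ (mem_setU h)) ⟨h, rfl, rfl⟩

namespace IsGenerating
variable (hg : IsGenerating g Γ)
include hg

theorem isOpen_setU_and_contDiffOn_YZ (h1 : A1 g Γ) (h2 : A2 g Γ) : IsOpen (setU g Γ) ∧
    ContDiffOn ℝ 1 (fun w : Pt n × ℝ × Pt n => YZ g Γ w.1 w.2.1 w.2.2) (setU g Γ) := by
  rw [setU_eq_image]
  obtain ⟨h3, h4⟩ := isOpen_image_and_contDiffOn_leftInverse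
    (f := fun w : Pt n × Pt n × ℝ => (w.1, g w.1 w.2.1 w.2.2, gx g w.1 w.2.1 w.2.2))
    (f₁ := fun w : Pt n × ℝ × Pt n => (w.1, YZ g Γ w.1 w.2.1 w.2.2)) (k := 1)
    (by simp [add_comm]) one_ne_zero hg.isOpen
    (contDiffOn_fst.prodMk ((hg.contDiffOn.of_le one_le_two).prodMk hg.contDiffOn_gx))
    (fun w hw => hg.injective_fderiv_jet (h2 _ _ _ hw) hw)
    (fun w hw => by simp only [YZ_eq h1 (x := w.1) (y := w.2.1) (z := w.2.2) hw])
  exact ⟨h3, contDiff_snd.comp_contDiffOn h4⟩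

theorem dualFun_apply (h : (x, y, z) ∈ Γ) : dualFun g Γ y x (g x y z) = z :=
  (hg.strictAntiOn x y).injOn.leftInvOn_invFunOn h

theorem dualFun_mem (h : (y, x, u) ∈ dualSet g Γ) : (x, y, dualFun g Γ y x u) ∈ Γ := by
  obtain ⟨z, hz, rfl⟩ := mem_dualSet_iff.1 h
  rwa [hg.dualFun_apply hz]

theorem apply_dualFun (h : (y, x, u) ∈ dualSet g Γ) : g x y (dualFun g Γ y x u) = u := by
  obtain ⟨z, hz, rfl⟩ := mem_dualSet_iff.1 h
  rw [hg.dualFun_apply hz]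

theorem isOpen_dualSet_and_contDiffOn_dualFun : IsOpen (dualSet g Γ) ∧
    ContDiffOn ℝ 2 (fun w : Pt n × Pt n × ℝ => dualFun g Γ w.1 w.2.1 w.2.2) (dualSet g Γ) := by
  rw [dualSet_eq_image]
  obtain ⟨h3, h4⟩ := isOpen_image_and_contDiffOn_leftInverse
    (f := fun w : Pt n × Pt n × ℝ => (w.2.1, w.1, g w.1 w.2.1 w.2.2))
    (f₁ := fun w : Pt n × Pt n × ℝ => (w.2.1, w.1, dualFun g Γ w.1 w.2.1 w.2.2)) (k := 2)
    rfl two_ne_zero hg.isOpen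
    (contDiffOn_snd.fst.prodMk (contDiffOn_fst.prodMk hg.contDiffOn))
    (fun w hw => hg.injective_fderiv_flip hw)
    (fun w hw => by simp only [hg.dualFun_apply (x := w.1) (y := w.2.1) (z := w.2.2) hw])
  exact ⟨h3, h4.snd.snd⟩

theorem hasFDerivAt_dualFun (h : (x, y, z) ∈ Γ) :
    HasFDerivAt (fun w : Pt n × Pt n × ℝ => dualFun g Γ w.1 w.2.1 w.2.2)
      (fderiv ℝ (fun w : Pt n × Pt n × ℝ => dualFun g Γ w.1 w.2.1 w.2.2) (y, x, g x y z))
      (y, x, g x y z) :=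
  ((hg.isOpen_dualSet_and_contDiffOn_dualFun.2.contDiffAt
    (hg.isOpen_dualSet_and_contDiffOn_dualFun.1.mem_nhds (mem_dualSet h))).differentiableAt
    two_ne_zero).hasFDerivAt

/-- The chain rule for `g*(x, y, g(x, y, z)) = z` along a line. The partial derivatives of `g*`
follow by choosing `ζ` so that the other components drop out. -/
theorem fderiv_dualFun (h : (x, y, z) ∈ Γ) (ξ η : Pt n) (ζ : ℝ) :
    fderiv ℝ (fun w : Pt n × Pt n × ℝ => dualFun g Γ w.1 w.2.1 w.2.2) (y, x, g x y z)
      (η, ξ, ⟪gx g x y z, ξ⟫ + ⟪gy g x y z, η⟫ + gz g x y z * ζ) = ζ := by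
  have hX : HasDerivAt (fun s : ℝ => x + s • ξ) ξ 0 := by
    simpa using ((hasDerivAt_id (0:ℝ)).smul_const ξ).const_add x
  have hY : HasDerivAt (fun s : ℝ => y + s • η) η 0 := by
    simpa using ((hasDerivAt_id (0:ℝ)).smul_const η).const_add y
  have hZ : HasDerivAt (fun s : ℝ => z + s * ζ) ζ 0 := by
    simpa using ((hasDerivAt_id (0:ℝ)).mul_const ζ).const_add z
  have h1 : HasDerivAt (fun s : ℝ => (x + s • ξ, y + s • η, z + s * ζ)) (ξ, η, ζ) 0 :=
    hX.prodMk (hY.prodMk hZ)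
  have h0 : (fun s : ℝ => (x + s • ξ, y + s • η, z + s * ζ)) 0 = (x, y, z) := by simp
  have h2 : ∀ᶠ s in 𝓝 (0:ℝ), (x + s • ξ, y + s • η, z + s * ζ) ∈ Γ :=
    h1.continuousAt.eventually (by rw [h0]; exact hg.isOpen.mem_nhds h)
  have h3 := hg.hasDerivAt_comp hX hY hZ (by simpa using h)
  simp only [zero_smul, add_zero, zero_mul] at h3
  have h4 : HasDerivAt (fun s : ℝ => dualFun g Γ (y + s • η) (x + s • ξ)
      (g (x + s • ξ) (y + s • η) (z + s * ζ))) (fderiv ℝ (fun w : Pt n × Pt n × ℝ =>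
      dualFun g Γ w.1 w.2.1 w.2.2) (y, x, g x y z)
      (η, ξ, ⟪gx g x y z, ξ⟫ + ⟪gy g x y z, η⟫ + gz g x y z * ζ)) 0 := by
    exact HasFDerivAt.comp_hasDerivAt_of_eq (f := fun s : ℝ => (y + s • η, x + s • ξ,
      g (x + s • ξ) (y + s • η) (z + s * ζ))) (0:ℝ) (hg.hasFDerivAt_dualFun h)
      (hY.prodMk (hX.prodMk h3)) (by simp)
  have h5 : (fun s : ℝ => dualFun g Γ (y + s • η) (x + s • ξ)
      (g (x + s • ξ) (y + s • η) (z + s * ζ))) =ᶠ[𝓝 0] fun s => z + s * ζ :=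
    h2.mono fun s hs => hg.dualFun_apply hs
  exact (h4.congr_of_eventuallyEq h5.symm).unique hZ

theorem gz_dualFun (h : (x, y, z) ∈ Γ) :
    gz (dualFun g Γ) y x (g x y z) = (gz g x y z)⁻¹ := by
  have h1 := hg.fderiv_dualFun h 0 0 (gz g x y z)⁻¹
  rw [fderiv_prod₃ (hg.hasFDerivAt_dualFun h).differentiableAt] at h1
  rw [mul_inv_cancel₀ (hg.gz_ne_zero h)] at h1
  rw [← h1]
  simp [gz]

theorem gx_dualFun (h : (x, y, z) ∈ Γ) :
    gx (dualFun g Γ) y x (g x y z) = Q g x y z := by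
  refine ext_inner_right ℝ fun η => ?_
  have h1 := hg.fderiv_dualFun h 0 η (⟪Q g x y z, η⟫)
  rw [fderiv_prod₃ (hg.hasFDerivAt_dualFun h).differentiableAt, hg.gy_eq h] at h1
  rw [gx, gradient, InnerProductSpace.toDual_symm_apply]
  simpa [inner_smul_left] using h1

theorem gy_dualFun (h : (x, y, z) ∈ Γ) :
    gy (dualFun g Γ) y x (g x y z) = -((gz g x y z)⁻¹ • gx g x y z) := by
  refine ext_inner_right ℝ fun ξ => ?_
  have h1 := hg.fderiv_dualFun h ξ 0 (-((gz g x y z)⁻¹ * ⟪gx g x y z, ξ⟫))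
  rw [fderiv_prod₃ (hg.hasFDerivAt_dualFun h).differentiableAt] at h1
  rw [gy, gradient, InnerProductSpace.toDual_symm_apply]
  rw [mul_neg, ← mul_assoc, mul_inv_cancel₀ (hg.gz_ne_zero h)] at h1
  simpa [inner_smul_left] using h1

theorem Q_dualFun (h : (x, y, z) ∈ Γ) :
    Q (dualFun g Γ) y x (g x y z) = gx g x y z := by
  rw [Q, hg.gz_dualFun h, hg.gy_dualFun h, inv_inv, smul_neg, neg_neg, smul_smul,
    mul_inv_cancel₀ (hg.gz_ne_zero h), one_smul]

theorem dual : IsGenerating (dualFun g Γ) (dualSet g Γ) where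
  isOpen := hg.isOpen_dualSet_and_contDiffOn_dualFun.1
  isConnected := by
    rw [dualSet_eq_image]
    exact hg.isConnected.image _
      (continuous_snd.fst.continuousOn.prodMk
        (continuous_fst.continuousOn.prodMk hg.contDiffOn.continuousOn))
  ordConnected y x := by
    have h1 : {u | (y, x, u) ∈ dualSet g Γ} = (fun z => g x y z) '' {z | (x, y, z) ∈ Γ} := by
      ext u; exact mem_dualSet_iff
    rw [h1]
    exact ((hg.ordConnected x y).isPreconnected.image _ fun z hz =>
      (hg.differentiableAt_right hz).continuousAt.continuousWithinAt).ordConnected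
  contDiffOn := hg.isOpen_dualSet_and_contDiffOn_dualFun.2
  gz_neg y x u h := by
    obtain ⟨z, hz, rfl⟩ := mem_dualSet_iff.1 h
    rw [hg.gz_dualFun hz]
    exact inv_lt_zero.2 (hg.gz_neg _ _ _ hz)

theorem dualSet_dualSet : dualSet (dualFun g Γ) (dualSet g Γ) = Γ := by
  ext ⟨x, y, z⟩
  rw [mem_dualSet_iff]
  constructor
  · rintro ⟨u, h, rfl⟩; exact hg.dualFun_mem h
  · intro h; exact ⟨_, mem_dualSet h, hg.dualFun_apply h⟩

theorem dualFun_dualFun (h : (x, y, z) ∈ Γ) :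
    dualFun (dualFun g Γ) (dualSet g Γ) x y z = g x y z := by
  have := hg.dual.dualFun_apply (mem_dualSet h)
  rwa [hg.dualFun_apply h] at this

/-- The derivative of `Q` in `x` is, up to a factor, the transpose of `E`. -/
theorem inner_fderiv_Q (h : (x, y, z) ∈ Γ) (ξ η : Pt n) :
    gz g x y z * ⟪fderiv ℝ (fun x' => Q g x' y z) x ξ, η⟫ = -⟪matE g x y z η, ξ⟫ := by
  set F := fun w : Pt n × Pt n × ℝ => g w.1 w.2.1 w.2.2
  have hsymm : ∀ v w, fderiv ℝ (fderiv ℝ F) (x, y, z) v w = fderiv ℝ (fderiv ℝ F) (x, y, z) w v :=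
    (hg.contDiffAt h).isSymmSndFDerivAt (by simp)
  have hΓ : ∀ᶠ w in 𝓝 (x, y, z), w ∈ Γ := hg.isOpen.mem_nhds h
  have hF : HasFDerivAt (fderiv ℝ F) (fderiv ℝ (fderiv ℝ F) (x, y, z)) (x, y, z) :=
    (((hg.contDiffAt h).fderiv_right (m := 1) (by norm_num)).differentiableAt one_ne_zero).hasFDerivAt
  have hF' : ∀ v, HasFDerivAt (fun w => fderiv ℝ F w v)
      ((fderiv ℝ (fderiv ℝ F) (x, y, z)).flip v) (x, y, z) := fun v => by
    have := hF.clm_apply (hasFDerivAt_const v (x, y, z))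
    refine this.congr_fderiv ?_
    ext w <;> simp
  have hx : ∀ w, ⟪fderiv ℝ (fun w : Pt n × Pt n × ℝ => gx g w.1 w.2.1 w.2.2) (x, y, z) w, ξ⟫ =
      fderiv ℝ (fderiv ℝ F) (x, y, z) w (ξ, 0, 0) := by
    intro w
    have h1 := ((hg.differentiableAt_gx h).hasFDerivAt.inner ℝ (hasFDerivAt_const ξ (x, y, z)))
    have h2 := (hF' (ξ, 0, 0)).congr_of_eventuallyEq (f₁ := fun w => ⟪gx g w.1 w.2.1 w.2.2, ξ⟫) (by
      filter_upwards [hΓ] with w hw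
      rw [hg.fderiv_eq (x := w.1) (y := w.2.1) (z := w.2.2) hw]
      simp)
    have h3 := congrArg (fun L => L w) (h1.unique h2)
    simpa using h3
  have hQ := ((hg.contDiffAt_Q h).differentiableAt one_ne_zero).hasFDerivAt
  have hdz : DifferentiableAt ℝ (fun w : Pt n × Pt n × ℝ => gz g w.1 w.2.1 w.2.2) (x, y, z) :=
    (hg.contDiffOn_gz.contDiffAt (hg.isOpen.mem_nhds h)).differentiableAt one_ne_zero
  have hz : ∀ w, fderiv ℝ (fun w : Pt n × Pt n × ℝ => gz g w.1 w.2.1 w.2.2) (x, y, z) w =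
      fderiv ℝ (fderiv ℝ F) (x, y, z) w (0, 0, 1) := by
    intro w
    have h2 := (hF' (0, 0, 1)).congr_of_eventuallyEq (f₁ := fun w => gz g w.1 w.2.1 w.2.2) (by
      filter_upwards [hΓ] with w hw
      rw [hg.fderiv_eq (x := w.1) (y := w.2.1) (z := w.2.2) hw]
      simp)
    rw [h2.fderiv]; rfl
  -- The derivative of `-g_z ⟪Q, η⟫ = ⟪g_y, η⟫` in the direction `ξ`, with both sides written
  -- through the symmetric second derivative of `g`.
  have hy : gz g x y z * ⟪fderiv ℝ (fun w : Pt n × Pt n × ℝ => Q g w.1 w.2.1 w.2.2) (x, y, z)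
      (ξ, 0, 0), η⟫ + ⟪Q g x y z, η⟫ * fderiv ℝ (fderiv ℝ F) (x, y, z) (ξ, 0, 0) (0, 0, 1) =
      - fderiv ℝ (fderiv ℝ F) (x, y, z) (ξ, 0, 0) (0, η, 0) := by
    have h1 := (hdz.hasFDerivAt.mul (hQ.inner ℝ (hasFDerivAt_const η (x, y, z)))).neg
    have h2 := (hF' (0, η, 0)).congr_of_eventuallyEq
      (f₁ := fun w => -(gz g w.1 w.2.1 w.2.2 * ⟪Q g w.1 w.2.1 w.2.2, η⟫)) (by
      filter_upwards [hΓ] with w hw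
      rw [hg.fderiv_eq (x := w.1) (y := w.2.1) (z := w.2.2) hw,
        hg.gy_eq (x := w.1) (y := w.2.1) (z := w.2.2) hw]
      simp [inner_smul_left])
    have h3 := congrArg (fun L => L (ξ, 0, 0)) (h1.unique h2)
    simp only [← hz]
    simp at h3
    linarith
  have hQx : fderiv ℝ (fun x' => Q g x' y z) x ξ =
      fderiv ℝ (fun w : Pt n × Pt n × ℝ => Q g w.1 w.2.1 w.2.2) (x, y, z) (ξ, 0, 0) := by
    rw [fderiv_prod₃ hQ.differentiableAt]; simp
  have h4 := hx (0, η, 0)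
  have h5 := hx (0, 0, 1)
  rw [hg.fderiv_gx h, hsymm] at h4 h5
  rw [hQx, matE]
  simp only [map_zero, zero_add, add_zero, zero_smul, one_smul] at h4 h5
  simp only [_root_.sub_apply, _root_.smul_apply, ContinuousLinearMap.smulRight_apply,
    innerSL_apply_apply, inner_sub_left, inner_smul_left, h4, h5, hg.gy_eq h, conj_trivial]
  have := hg.gz_ne_zero h
  field_simp
  linarith

/-- Differentiates the identity `g*_y(x, y, g(x, y, z)) = Q(x, y, z)` in `x`, with `y` and `z`
fixed. -/
theorem matE_dualFun (h : (x, y, z) ∈ Γ) (ξ : Pt n) :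
    matE (dualFun g Γ) y x (g x y z) ξ = fderiv ℝ (fun x' => Q g x' y z) x ξ := by
  have h1 : HasDerivAt (fun s : ℝ => x + s • ξ) ξ 0 := by
    simpa using ((hasDerivAt_id (0:ℝ)).smul_const ξ).const_add x
  have h2 : ∀ᶠ s in 𝓝 (0:ℝ), (x + s • ξ, y, z) ∈ Γ :=
    (h1.continuousAt.prodMk (continuousAt_const (y := (y, z)))).eventually
      (by simpa using hg.isOpen.mem_nhds h)
  have h3 : HasDerivAt (fun s : ℝ => g (x + s • ξ) y z) ⟪gx g x y z, ξ⟫ 0 := by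
    have := hg.hasDerivAt_comp h1 (hasDerivAt_const (0:ℝ) y) (hasDerivAt_const (0:ℝ) z)
      (by simpa using h)
    simpa using this
  have h4 := hg.dual.hasDerivAt_gx_comp (hasDerivAt_const (0:ℝ) y) h1 h3
    (by simpa using mem_dualSet h)
  have h5 : DifferentiableAt ℝ (fun x' => Q g x' y z) x :=
    DifferentiableAt.comp (f := fun x' => (x', y, z)) x
      ((hg.contDiffAt_Q h).differentiableAt one_ne_zero) (by fun_prop)
  have h6 : HasDerivAt (fun s : ℝ => Q g (x + s • ξ) y z)
      (fderiv ℝ (fun x' => Q g x' y z) x ξ) 0 := by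
    exact HasFDerivAt.comp_hasDerivAt_of_eq (f := fun s : ℝ => x + s • ξ) (0:ℝ) h5.hasFDerivAt h1
      (by simp)
  have h7 := (h4.congr_of_eventuallyEq (h2.mono fun s hs => (hg.gx_dualFun hs).symm)).unique h6
  rw [← h7, matE]
  have h8 : (gz (dualFun g Γ) y x (g x y z))⁻¹ • gy (dualFun g Γ) y x (g x y z) = -gx g x y z := by
    have := hg.Q_dualFun h
    rw [← this, Q, neg_neg]
  have h9 : (gz (dualFun g Γ) y x (g x y z))⁻¹ * ⟪gy (dualFun g Γ) y x (g x y z), ξ⟫ =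
      -⟪gx g x y z, ξ⟫ := by
    rw [← inner_neg_left, ← h8, inner_smul_left, conj_trivial]
  simp [smul_smul, h9]

end IsGenerating

/-- The gradient of `g*` in its first variable is `Q`, and the `Q` of `g*` is `g_x`. Duality
therefore exchanges A1 and A1*, and preserves A2 because the new `E` is a nonzero multiple of the
transpose of the old one. -/
theorem IsRegular.dual (hg : IsRegular g Γ) : IsRegular (dualFun g Γ) (dualSet g Γ) where
  toIsGenerating := hg.toIsGenerating.dual
  a1 := by
    rintro y z q ⟨y', x, u, h, he⟩
    simp only [Prod.mk.injEq] at he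
    obtain ⟨rfl, rfl, rfl⟩ := he
    refine ⟨(x, u), ⟨h, rfl, rfl⟩, ?_⟩
    rintro ⟨x', u'⟩ ⟨h', hz, hq⟩
    obtain ⟨z, hz1, rfl⟩ := mem_dualSet_iff.1 h
    obtain ⟨z', hz2, hu⟩ := mem_dualSet_iff.1 h'
    simp only at hu hz2
    subst hu
    simp only [hg.dualFun_apply hz1, hg.dualFun_apply hz2, hg.gx_dualFun hz1,
      hg.gx_dualFun hz2] at hz hq
    subst hz
    obtain rfl := hg.a1star _ _ hz2 hz1 hq
    rfl
  a2 := by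
    intro y x u h hdet
    obtain ⟨z, hz, rfl⟩ := mem_dualSet_iff.1 h
    obtain ⟨ξ, hξ, hξ0⟩ := (Submodule.ne_bot_iff _).1
      (LinearMap.bot_lt_ker_of_det_eq_zero (f := (matE (dualFun g Γ) y x (g x y z)).toLinearMap)
        hdet).ne'
    obtain ⟨η, hη⟩ := (LinearMap.equivOfDetNeZero (matE g x y z).toLinearMap
      (hg.a2 _ _ _ hz)).surjective ξ
    have hη : matE g x y z η = ξ := hη
    have hξ : matE (dualFun g Γ) y x (g x y z) ξ = 0 := hξ
    have h1 := hg.inner_fderiv_Q hz ξ η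
    rw [← hg.matE_dualFun hz, hξ, inner_zero_left, mul_zero, hη, zero_eq_neg] at h1
    exact hξ0 (inner_self_eq_zero.1 h1)
  a1star := by
    intro x u y h y' h' hQ
    obtain ⟨z, hz, rfl⟩ := mem_dualSet_iff.1 h
    obtain ⟨z', hz', hu⟩ := mem_dualSet_iff.1 h'
    have h1 := hg.Q_dualFun hz'
    have h2 := hg.Q_dualFun hz
    rw [hu] at h1
    simp only [h1, h2] at hQ
    have h3 := YZ_eq hg.a1 hz
    have h4 := YZ_eq hg.a1 hz'
    rw [hu, ← hQ, h3] at h4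
    exact congrArg Prod.fst h4

/-! ### Functions that agree on `Γ` -/

section Congr
variable {f : Pt n → Pt n → ℝ → ℝ} (hΓ : IsOpen Γ)
  (hfg : ∀ x y z, (x, y, z) ∈ Γ → f x y z = g x y z)
include hΓ hfg

theorem gx_congr (h : (x, y, z) ∈ Γ) : gx f x y z = gx g x y z := by
  refine Filter.EventuallyEq.gradient_eq ?_
  have : ContinuousAt (fun x' => (x', y, z)) x := by fun_prop
  exact (this.eventually (hΓ.mem_nhds h)).mono fun x' hx' => hfg _ _ _ hx'

theorem gxx_congr (h : (x, y, z) ∈ Γ) : gxx f x y z = gxx g x y z := by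
  refine Filter.EventuallyEq.fderiv_eq ?_
  have : ContinuousAt (fun x' => (x', y, z)) x := by fun_prop
  exact (this.eventually (hΓ.mem_nhds h)).mono fun x' hx' => gx_congr hΓ hfg hx'

theorem setU_congr : setU f Γ = setU g Γ := by
  rw [setU_eq_image, setU_eq_image]
  refine image_congr fun w hw => ?_
  rw [gx_congr hΓ hfg hw, hfg _ _ _ hw]

theorem YZ_congr (u : ℝ) (p : Pt n) : YZ f Γ x u p = YZ g Γ x u p := by
  rw [YZ, YZ]
  congr 1
  ext w
  refine and_congr_right fun h => ?_
  rw [gx_congr hΓ hfg h, hfg _ _ _ h]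

/-- Needed because `g**` is known to agree with `g` on `Γ` only; since `Γ` is open, the derivatives
agree there too. -/
theorem A3w_congr : A3w f Γ ↔ A3w g Γ := by
  have h1 : ∀ x u p₀ p₁, SegmentIn f Γ x u p₀ p₁ ↔ SegmentIn g Γ x u p₀ p₁ := by
    intro x u p₀ p₁
    rw [SegmentIn, SegmentIn, setU_congr hΓ hfg]
  rw [A3w, A3w]
  refine forall₅_congr fun ξ x u p₀ p₁ => ?_
  rw [h1]
  refine imp_congr_right fun h => imp_congr_right fun _ => ?_
  have h2 : EqOn (fun p => inner ℝ (matA f Γ x u p ξ) ξ) (fun p => inner ℝ (matA g Γ x u p ξ) ξ)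
      (segment ℝ p₀ p₁) := by
    intro p hp
    simp only [matA, Y, Z, YZ_congr hΓ hfg, gxx_congr hΓ hfg (YZ_mem (h p hp))]
  exact ⟨fun h => h.congr h2, fun h => h.congr h2.symm⟩

end Congr

theorem IsRegular.A3w_dual_dual (hg : IsRegular g Γ) :
    A3w (dualFun (dualFun g Γ) (dualSet g Γ)) (dualSet (dualFun g Γ) (dualSet g Γ)) ↔ A3w g Γ := by
  rw [hg.dualSet_dualSet]
  exact A3w_congr hg.isOpen fun x y z h => hg.dualFun_dualFun h

end Duality
end GenFun


namespace GenFun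
open Set Filter Topology Metric
open scoped RealInnerProductSpace NNReal

/-! ### Uniform estimates near a compact set of parameters. -/

section Uniform

theorem eventually_mem_of_continuousAt {α β : Type*} [TopologicalSpace α] [TopologicalSpace β]
    {f : α → β} {a : α} {s : Set β} (hf : ContinuousAt f a) (hs : IsOpen s) (h : f a ∈ s) :
    ∀ᶠ b in 𝓝 a, f b ∈ s :=
  hf.eventually (hs.mem_nhds h)

/-- By compactness, one `δ` serves both for the parameters near `w₀` and for a full neighbourhood of
`S`. -/
theorem exists_ball_thickening_of_eventually {W E : Type*} [PseudoMetricSpace W]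
    [PseudoMetricSpace E] {S : Set E} (hS : IsCompact S) {w₀ : W} {P : W → E → Prop}
    (hP : ∀ p ∈ S, ∀ᶠ v in 𝓝 (w₀, p), P v.1 v.2) :
    ∃ δ > 0, ∀ w ∈ ball w₀ δ, ∀ p ∈ thickening δ S, P w p := by
  have h1 : ({w₀} : Set W) ×ˢ S ⊆ interior {v : W × E | P v.1 v.2} := by
    rintro ⟨w, p⟩ ⟨rfl, hp⟩
    exact mem_interior_iff_mem_nhds.2 (hP p hp)
  obtain ⟨δ, hδ, h2⟩ := (isCompact_singleton.prod hS).exists_thickening_subset_open isOpen_interior h1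
  refine ⟨δ, hδ, fun w hw p hp => ?_⟩
  obtain ⟨q, hq, hpq⟩ := mem_thickening_iff.1 hp
  have h3 : (w, p) ∈ thickening δ (({w₀} : Set W) ×ˢ S) :=
    mem_thickening_iff.2 ⟨(w₀, q), ⟨rfl, hq⟩, by
      rw [Prod.dist_eq]
      exact max_lt (mem_ball.1 hw) hpq⟩
  have h4 := interior_subset (h2 h3)
  exact h4

/-- At `(w₀, p)` the partial derivative is exactly the identity, and it is continuous. -/
theorem eventually_fderiv_comp_inr_close {W E : Type*} [NormedAddCommGroup W] [NormedSpace ℝ W]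
    [NormedAddCommGroup E] [NormedSpace ℝ E] {F : W × E → E} {w₀ : W} {p : E}
    (hF : ContDiffAt ℝ 1 F (w₀, p)) (h0 : ∀ᶠ q in 𝓝 p, F (w₀, q) = q) {ε : ℝ} (hε : 0 < ε) :
    ∀ᶠ v in 𝓝 (w₀, p), ContDiffAt ℝ 1 F v ∧
      ‖(fderiv ℝ F v).comp (ContinuousLinearMap.inr ℝ W E) - ContinuousLinearMap.id ℝ E‖ < ε := by
  refine (hF.eventually (by simp)).and ?_
  have h1 : ContinuousAt (fderiv ℝ F) (w₀, p) :=
    (hF.fderiv_right (m := 0) (by norm_num)).continuousAt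
  have h2 : HasFDerivAt (fun q => F (w₀, q))
      ((fderiv ℝ F (w₀, p)).comp (ContinuousLinearMap.inr ℝ W E)) p :=
    HasFDerivAt.comp (f := fun q => (w₀, q)) p (hF.differentiableAt one_ne_zero).hasFDerivAt
      (hasFDerivAt_prodMk_right w₀ p)
  have h3 := h2.unique ((hasFDerivAt_id p).congr_of_eventuallyEq h0)
  have h4 : ContinuousAt (fun v => ‖(fderiv ℝ F v).comp (ContinuousLinearMap.inr ℝ W E) -
      ContinuousLinearMap.id ℝ E‖) (w₀, p) :=
    ((h1.clm_comp continuousAt_const).sub continuousAt_const).norm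
  refine h4.eventually (gt_mem_nhds ?_)
  simpa [h3] using hε

theorem norm_sub_sub_le_of_fderiv_comp_inr_close {W E : Type*} [NormedAddCommGroup W]
    [NormedSpace ℝ W] [NormedAddCommGroup E] [NormedSpace ℝ E] {F : W × E → E} {w : W}
    {K : Set E} (hK : Convex ℝ K) {ε : ℝ} (h : ∀ p ∈ K, DifferentiableAt ℝ F (w, p) ∧
      ‖(fderiv ℝ F (w, p)).comp (ContinuousLinearMap.inr ℝ W E) - ContinuousLinearMap.id ℝ E‖ ≤ ε)
    {p p' : E} (hp : p ∈ K) (hp' : p' ∈ K) :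
    ‖F (w, p) - F (w, p') - (p - p')‖ ≤ ε * ‖p - p'‖ := by
  have h1 : ∀ q ∈ K, HasFDerivWithinAt (fun q => F (w, q))
      ((fderiv ℝ F (w, q)).comp (ContinuousLinearMap.inr ℝ W E)) K q := fun q hq =>
    (HasFDerivAt.comp (f := fun q => (w, q)) q (h q hq).1.hasFDerivAt
      (hasFDerivAt_prodMk_right w q)).hasFDerivWithinAt
  exact hK.norm_image_sub_le_of_norm_hasFDerivWithin_le' h1 (fun q hq => (h q hq).2) hp' hp

end Uniform

/-! ### A3w implies local quasiconvexity. -/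

section Quasiconvexity
variable {n : ℕ} {g : Pt n → Pt n → ℝ → ℝ} {Γ : Set (Pt n × Pt n × ℝ)} {x x₀ : Pt n} {u u₀ : ℝ}
  {p : Pt n}

/-- `g(x, Y(x₀, u₀, p), Z(x₀, u₀, p))`. -/
noncomputable def focal (g : Pt n → Pt n → ℝ → ℝ) (Γ : Set (Pt n × Pt n × ℝ)) (x₀ : Pt n) (u₀ : ℝ)
    (x p : Pt n) : ℝ :=
  g x (YZ g Γ x₀ u₀ p).1 (YZ g Γ x₀ u₀ p).2

/-- `g_x(x, Y(x₀, u₀, p), Z(x₀, u₀, p))`. -/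
noncomputable def focalGrad (g : Pt n → Pt n → ℝ → ℝ) (Γ : Set (Pt n × Pt n × ℝ)) (x₀ : Pt n) (u₀ : ℝ)
    (x p : Pt n) : Pt n :=
  gx g x (YZ g Γ x₀ u₀ p).1 (YZ g Γ x₀ u₀ p).2

/-- `g_x(x, y, g*(x, y, u))` at `y = Y(x₀, u₀, p)`. -/
noncomputable def levelGrad (g : Pt n → Pt n → ℝ → ℝ) (Γ : Set (Pt n × Pt n × ℝ)) (x₀ : Pt n) (u₀ : ℝ)
    (x : Pt n) (u : ℝ) (p : Pt n) : Pt n :=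
  gx g x (YZ g Γ x₀ u₀ p).1 (dualFun g Γ (YZ g Γ x₀ u₀ p).1 x u)

theorem focalGrad_base (h : (x₀, u₀, p) ∈ setU g Γ) : focalGrad g Γ x₀ u₀ x₀ p = p := gx_YZ h

theorem convexOn_matA (hA : A3w g Γ) {K : Set (Pt n)} (hK : Convex ℝ K)
    (h : ∀ p ∈ K, (x, u, p) ∈ setU g Γ) (ξ : Pt n) (c : ℝ) :
    ConvexOn ℝ (K ∩ {p | ⟪p, ξ⟫ = c}) fun p => ⟪matA g Γ x u p ξ, ξ⟫ := by
  refine ⟨hK.inter ?_, ?_⟩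
  · intro a ha b hb s t hs ht hst
    have ha : ⟪a, ξ⟫ = c := ha
    have hb : ⟪b, ξ⟫ = c := hb
    change ⟪s • a + t • b, ξ⟫ = c
    rw [inner_add_left, inner_smul_left, inner_smul_left, ha, hb, conj_trivial, conj_trivial,
      ← add_mul, hst, one_mul]
  · rintro a ⟨haK, ha⟩ b ⟨hbK, hb⟩ s t hs ht hst
    have ha : ⟪a, ξ⟫ = c := ha
    have hb : ⟪b, ξ⟫ = c := hb
    exact (hA ξ x u a b (fun q hq => h q (hK.segment_subset haK hbK hq)) (by
      rw [inner_sub_right, real_inner_comm, hb, real_inner_comm, ha, sub_self])).2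
      (left_mem_segment ℝ a b) (right_mem_segment ℝ a b) hs ht hst

namespace IsRegular
variable (hg : IsRegular g Γ)
include hg

theorem isOpen_setU : IsOpen (setU g Γ) := (hg.isOpen_setU_and_contDiffOn_YZ hg.a1 hg.a2).1

theorem contDiffAt_YZ (h : (x, u, p) ∈ setU g Γ) :
    ContDiffAt ℝ 1 (fun w : Pt n × ℝ × Pt n => YZ g Γ w.1 w.2.1 w.2.2) (x, u, p) :=
  (hg.isOpen_setU_and_contDiffOn_YZ hg.a1 hg.a2).2.contDiffAt (hg.isOpen_setU.mem_nhds h)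

theorem contDiffAt_dualFun {y : Pt n} (h : (y, x, u) ∈ dualSet g Γ) :
    ContDiffAt ℝ 2 (fun w : Pt n × Pt n × ℝ => dualFun g Γ w.1 w.2.1 w.2.2) (y, x, u) :=
  hg.dual.contDiffAt h

theorem contDiffAt_YZ_joint {w : (Pt n × ℝ × Pt n × ℝ) × Pt n} (h : (w.1.1, w.1.2.1, w.2) ∈ setU g Γ) :
    ContDiffAt ℝ 1 (fun w : (Pt n × ℝ × Pt n × ℝ) × Pt n => YZ g Γ w.1.1 w.1.2.1 w.2) w :=
  ContDiffAt.comp (f := fun w : (Pt n × ℝ × Pt n × ℝ) × Pt n => (w.1.1, w.1.2.1, w.2)) w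
    (hg.contDiffAt_YZ h) (by fun_prop)

theorem contDiffAt_focal {w : (Pt n × ℝ × Pt n × ℝ) × Pt n} (h : (w.1.1, w.1.2.1, w.2) ∈ setU g Γ)
    (h' : (w.1.2.2.1, (YZ g Γ w.1.1 w.1.2.1 w.2).1, (YZ g Γ w.1.1 w.1.2.1 w.2).2) ∈ Γ) :
    ContDiffAt ℝ 1 (fun w : (Pt n × ℝ × Pt n × ℝ) × Pt n =>
      focal g Γ w.1.1 w.1.2.1 w.1.2.2.1 w.2) w :=
  ContDiffAt.comp (f := fun w : (Pt n × ℝ × Pt n × ℝ) × Pt n => (w.1.2.2.1, YZ g Γ w.1.1 w.1.2.1 w.2))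
    w ((hg.contDiffAt h').of_le one_le_two) (ContDiffAt.prodMk (by fun_prop) (hg.contDiffAt_YZ_joint h))

theorem contDiffAt_focalGrad {w : (Pt n × ℝ × Pt n × ℝ) × Pt n}
    (h : (w.1.1, w.1.2.1, w.2) ∈ setU g Γ)
    (h' : (w.1.2.2.1, (YZ g Γ w.1.1 w.1.2.1 w.2).1, (YZ g Γ w.1.1 w.1.2.1 w.2).2) ∈ Γ) :
    ContDiffAt ℝ 1 (fun w : (Pt n × ℝ × Pt n × ℝ) × Pt n =>
      focalGrad g Γ w.1.1 w.1.2.1 w.1.2.2.1 w.2) w :=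
  ContDiffAt.comp (f := fun w : (Pt n × ℝ × Pt n × ℝ) × Pt n => (w.1.2.2.1, YZ g Γ w.1.1 w.1.2.1 w.2))
    w (hg.contDiffAt_gx h') (ContDiffAt.prodMk (by fun_prop) (hg.contDiffAt_YZ_joint h))

theorem contDiffAt_levelGrad {w : (Pt n × ℝ × Pt n × ℝ) × Pt n}
    (h : (w.1.1, w.1.2.1, w.2) ∈ setU g Γ)
    (h' : ((YZ g Γ w.1.1 w.1.2.1 w.2).1, w.1.2.2.1, w.1.2.2.2) ∈ dualSet g Γ) :
    ContDiffAt ℝ 1 (fun w : (Pt n × ℝ × Pt n × ℝ) × Pt n =>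
      levelGrad g Γ w.1.1 w.1.2.1 w.1.2.2.1 w.1.2.2.2 w.2) w := by
  have h1 := (hg.contDiffAt_YZ_joint h).fst
  have h2 : ContDiffAt ℝ 1 (fun w : (Pt n × ℝ × Pt n × ℝ) × Pt n =>
      dualFun g Γ (YZ g Γ w.1.1 w.1.2.1 w.2).1 w.1.2.2.1 w.1.2.2.2) w :=
    ContDiffAt.comp (f := fun w : (Pt n × ℝ × Pt n × ℝ) × Pt n =>
      ((YZ g Γ w.1.1 w.1.2.1 w.2).1, w.1.2.2.1, w.1.2.2.2)) w
      ((hg.contDiffAt_dualFun h').of_le one_le_two) (h1.prodMk (by fun_prop))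
  exact ContDiffAt.comp (f := fun w : (Pt n × ℝ × Pt n × ℝ) × Pt n =>
      (w.1.2.2.1, (YZ g Γ w.1.1 w.1.2.1 w.2).1,
        dualFun g Γ (YZ g Γ w.1.1 w.1.2.1 w.2).1 w.1.2.2.1 w.1.2.2.2)) w
    (hg.contDiffAt_gx (hg.dualFun_mem h')) (ContDiffAt.prodMk (by fun_prop) (h1.prodMk h2))

theorem levelGrad_focal (h' : (x, (YZ g Γ x₀ u₀ p).1, (YZ g Γ x₀ u₀ p).2) ∈ Γ) :
    levelGrad g Γ x₀ u₀ x (focal g Γ x₀ u₀ x p) p = focalGrad g Γ x₀ u₀ x p := by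
  rw [levelGrad, focal, hg.dualFun_apply h', focalGrad]

theorem levelGrad_base (h : (x₀, u₀, p) ∈ setU g Γ) : levelGrad g Γ x₀ u₀ x₀ u₀ p = p := by
  have := hg.levelGrad_focal (YZ_mem h)
  rwa [focal, apply_YZ h, focalGrad_base h] at this

/-- If `x` moves along `ξ` and `u` follows `g(·, y, z)`, then `z` stays fixed and `levelGrad` is
`g_x(·, y, z)`. Its derivative is `g_xx ξ`, which is `A ξ` at the corresponding gradient. -/
theorem fderiv_levelGrad
    (hd : DifferentiableAt ℝ (fun w : Pt n × ℝ × Pt n => levelGrad g Γ x₀ u₀ w.1 w.2.1 w.2.2)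
      (x, u, p)) (h' : ((YZ g Γ x₀ u₀ p).1, x, u) ∈ dualSet g Γ) (ξ : Pt n) :
    fderiv ℝ (fun w : Pt n × ℝ × Pt n => levelGrad g Γ x₀ u₀ w.1 w.2.1 w.2.2) (x, u, p)
      (ξ, ⟪levelGrad g Γ x₀ u₀ x u p, ξ⟫, 0) = matA g Γ x u (levelGrad g Γ x₀ u₀ x u p) ξ := by
  set y := (YZ g Γ x₀ u₀ p).1 with hy
  set z := dualFun g Γ y x u with hz
  have hΓ : (x, y, z) ∈ Γ := hg.dualFun_mem h'
  have hu : g x y z = u := hg.apply_dualFun h'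
  have hL : levelGrad g Γ x₀ u₀ x u p = gx g x y z := rfl
  have hX : HasDerivAt (fun s : ℝ => x + s • ξ) ξ 0 := by
    simpa using ((hasDerivAt_id (0:ℝ)).smul_const ξ).const_add x
  have hu' : HasDerivAt (fun s : ℝ => g (x + s • ξ) y z) ⟪gx g x y z, ξ⟫ 0 := by
    simpa using hg.hasDerivAt_comp hX (hasDerivAt_const (0:ℝ) y) (hasDerivAt_const (0:ℝ) z)
      (by simpa using hΓ)
  have h1 : HasDerivAt (fun s : ℝ => levelGrad g Γ x₀ u₀ (x + s • ξ) (g (x + s • ξ) y z) p)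
      (fderiv ℝ (fun w : Pt n × ℝ × Pt n => levelGrad g Γ x₀ u₀ w.1 w.2.1 w.2.2) (x, u, p)
        (ξ, ⟪gx g x y z, ξ⟫, 0)) 0 :=
    HasFDerivAt.comp_hasDerivAt_of_eq (f := fun s : ℝ => (x + s • ξ, g (x + s • ξ) y z, p)) (0:ℝ)
      hd.hasFDerivAt (hX.prodMk (hu'.prodMk (hasDerivAt_const (0:ℝ) p))) (by simp [hu])
  have h2 : HasDerivAt (fun s : ℝ => gx g (x + s • ξ) y z) (gxx g x y z ξ) 0 := by
    simpa using hg.hasDerivAt_gx_comp hX (hasDerivAt_const (0:ℝ) y) (hasDerivAt_const (0:ℝ) z)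
      (by simpa using hΓ)
  have h3 : ∀ᶠ s in 𝓝 (0:ℝ), (x + s • ξ, y, z) ∈ Γ :=
    (hX.continuousAt.prodMk (continuousAt_const (y := (y, z)))).eventually
      (by simpa using hg.isOpen.mem_nhds hΓ)
  have h4 := (h2.congr_of_eventuallyEq (h3.mono fun s hs => by
    rw [levelGrad, ← hy, hg.dualFun_apply hs])).unique h1
  rw [hL, ← h4, matA, Y, Z]
  have h5 := YZ_eq hg.a1 hΓ
  rw [hu] at h5
  rw [h5]

end IsRegular

/-- Uniform local quasiconvexity of `p ↦ g(x, Y(x₀, u₀, p), Z(x₀, u₀, p))` near the segments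
contained in `𝒰`. -/
def FocalQuasiconvex (g : Pt n → Pt n → ℝ → ℝ) (Γ : Set (Pt n × Pt n × ℝ)) : Prop :=
  ∀ x u p₀ p₁, SegmentIn g Γ x u p₀ p₁ → ∃ δ > 0, ∀ x₀ ∈ ball x δ, ∀ u₀ ∈ ball u δ,
    ∀ x₁ ∈ ball x δ, (∀ p ∈ thickening δ (segment ℝ p₀ p₁), (x₀, u₀, p) ∈ setU g Γ ∧
      (x₁, (YZ g Γ x₀ u₀ p).1, (YZ g Γ x₀ u₀ p).2) ∈ Γ) ∧
      QuasiconvexOn ℝ (thickening δ (segment ℝ p₀ p₁)) (focal g Γ x₀ u₀ x₁)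

theorem _root_.QuasiconvexOn.mono_set {E : Type*} [AddCommMonoid E] [Module ℝ E] {s t : Set E}
    {f : E → ℝ} (hf : QuasiconvexOn ℝ s f) (hts : t ⊆ s) (ht : Convex ℝ t) :
    QuasiconvexOn ℝ t f := fun r => by
  have : {x ∈ t | f x ≤ r} = t ∩ {x ∈ s | f x ≤ r} := by
    ext x; exact ⟨fun h => ⟨h.1, hts h.1, h.2⟩, fun h => ⟨h.1, h.2.2⟩⟩
  rw [this]
  exact ht.inter (hf r)

theorem isCompact_segment {E : Type*} [AddCommGroup E] [Module ℝ E] [TopologicalSpace E]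
    [IsTopologicalAddGroup E] [ContinuousSMul ℝ E] (a b : E) : IsCompact (segment ℝ a b) := by
  rw [segment_eq_image]
  exact isCompact_Icc.image (by fun_prop)

/-- At the parameter `(x, u, x, u)` both `levelGrad` and `focalGrad` are the identity in `p`. The
estimates of `LocalModel` are thus open conditions that hold along the segment; compactness makes
them uniform, and `LocalModel.quasiconvexOn` applies. -/
theorem IsRegular.focalQuasiconvex (hg : IsRegular g Γ) (hA : A3w g Γ) :
    FocalQuasiconvex g Γ := by
  intro x u p₀ p₁ hseg
  set S := segment ℝ p₀ p₁ with hS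
  have hSc : IsCompact S := isCompact_segment _ _
  have hSx : Convex ℝ S := convex_segment _ _
  set w₀ : Pt n × ℝ × Pt n × ℝ := (x, u, x, u) with hw₀
  set F : (Pt n × ℝ × Pt n × ℝ) × Pt n → Pt n := fun w =>
    levelGrad g Γ w.1.1 w.1.2.1 w.1.2.2.1 w.1.2.2.2 w.2 with hF
  set F' : (Pt n × ℝ × Pt n × ℝ) × Pt n → Pt n := fun w =>
    focalGrad g Γ w.1.1 w.1.2.1 w.1.2.2.1 w.2 with hF'
  have hdS : ∀ p ∈ S, ((YZ g Γ x u p).1, x, u) ∈ dualSet g Γ := fun p hp => by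
    have h1 := mem_dualSet (g := g) (YZ_mem (hseg p hp))
    rwa [apply_YZ (hseg p hp)] at h1
  have hFc : ∀ p ∈ S, ContDiffAt ℝ 1 F (w₀, p) := fun p hp =>
    hg.contDiffAt_levelGrad (w := (w₀, p)) (hseg p hp) (hdS p hp)
  have hFc' : ∀ p ∈ S, ContDiffAt ℝ 1 F' (w₀, p) := fun p hp =>
    hg.contDiffAt_focalGrad (w := (w₀, p)) (hseg p hp) (YZ_mem (hseg p hp))
  have hUev : ∀ p ∈ S, ∀ᶠ q in 𝓝 p, (x, u, q) ∈ setU g Γ := fun p hp =>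
    eventually_mem_of_continuousAt (f := fun q => (x, u, q)) (by fun_prop)
      hg.isOpen_setU (hseg p hp)
  -- the set `K'`
  obtain ⟨δ₁, hδ₁, h₁⟩ := exists_ball_thickening_of_eventually hSc (w₀ := w₀)
    (P := fun w p => (w.2.2.1, w.2.2.2, p) ∈ setU g Γ) fun p hp =>
      eventually_mem_of_continuousAt
        (f := fun v : (Pt n × ℝ × Pt n × ℝ) × Pt n => (v.1.2.2.1, v.1.2.2.2, v.2)) (by fun_prop)
        hg.isOpen_setU (hseg p hp)
  -- a bound for the derivative
  obtain ⟨C, hC⟩ : ∃ C, ∀ p ∈ S, ‖fderiv ℝ F (w₀, p)‖ < C := by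
    have h1 : ContinuousOn (fun p => ‖fderiv ℝ F (w₀, p)‖) S := fun p hp => by
      have h2 : ContinuousAt (fderiv ℝ F) (w₀, p) :=
        ((hFc p hp).fderiv_right (m := 0) (by norm_num)).continuousAt
      exact (ContinuousAt.comp (f := fun p => (w₀, p)) h2 (by fun_prop)).norm.continuousWithinAt
    obtain ⟨C, hC⟩ := hSc.bddAbove_image h1
    exact ⟨C + 1, fun p hp => (hC (mem_image_of_mem _ hp)).trans_lt (lt_add_one C)⟩
  obtain ⟨δ₂, hδ₂, h₂⟩ := exists_ball_thickening_of_eventually hSc (w₀ := w₀)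
    (P := fun w p => ((w.1, w.2.1, p) ∈ setU g Γ ∧
      (w.2.2.1, (YZ g Γ w.1 w.2.1 p).1, (YZ g Γ w.1 w.2.1 p).2) ∈ Γ ∧
      ((YZ g Γ w.1 w.2.1 p).1, w.2.2.1, w.2.2.2) ∈ dualSet g Γ) ∧
      (ContDiffAt ℝ 1 F (w, p) ∧ ‖(fderiv ℝ F (w, p)).comp (ContinuousLinearMap.inr ℝ _ _) -
        ContinuousLinearMap.id ℝ (Pt n)‖ < 1 / 8) ∧
      (ContDiffAt ℝ 1 F' (w, p) ∧ ‖(fderiv ℝ F' (w, p)).comp (ContinuousLinearMap.inr ℝ _ _) -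
        ContinuousLinearMap.id ℝ (Pt n)‖ < 1 / 8) ∧
      ‖fderiv ℝ F (w, p)‖ < C ∧ F (w, p) ∈ thickening δ₁ S) (by
    intro p hp
    have hYc := (hg.contDiffAt_YZ_joint (w := (w₀, p)) (hseg p hp)).continuousAt
    refine (Filter.Eventually.and ?_ (Filter.Eventually.and ?_ ?_)).and
      ((eventually_fderiv_comp_inr_close (hFc p hp) ?_ (by norm_num)).and
      ((eventually_fderiv_comp_inr_close (hFc' p hp) ?_ (by norm_num)).and
      (Filter.Eventually.and ?_ ?_)))
    · exact eventually_mem_of_continuousAt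
        (f := fun v : (Pt n × ℝ × Pt n × ℝ) × Pt n => (v.1.1, v.1.2.1, v.2)) (by fun_prop)
        hg.isOpen_setU (hseg p hp)
    · exact eventually_mem_of_continuousAt (f := fun v : (Pt n × ℝ × Pt n × ℝ) × Pt n =>
        (v.1.2.2.1, YZ g Γ v.1.1 v.1.2.1 v.2)) (ContinuousAt.prodMk (by fun_prop) hYc)
        hg.isOpen (YZ_mem (hseg p hp))
    · exact eventually_mem_of_continuousAt (f := fun v : (Pt n × ℝ × Pt n × ℝ) × Pt n =>
        ((YZ g Γ v.1.1 v.1.2.1 v.2).1, v.1.2.2.1, v.1.2.2.2))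
        (ContinuousAt.prodMk hYc.fst (by fun_prop)) hg.dual.isOpen (hdS p hp)
    · exact (hUev p hp).mono fun q hq => hg.levelGrad_base hq
    · exact (hUev p hp).mono fun q hq => focalGrad_base hq
    · exact ((hFc p hp).fderiv_right (m := 0) (by norm_num)).continuousAt.norm.eventually
        (gt_mem_nhds (hC p hp))
    · refine (hFc p hp).continuousAt.eventually (isOpen_thickening.mem_nhds ?_)
      rw [show F (w₀, p) = p from hg.levelGrad_base (hseg p hp)]
      exact self_subset_thickening hδ₁ S hp)
  obtain ⟨δ₃, hδ₃, h₃⟩ := exists_ball_thickening_of_eventually hSc (w₀ := w₀)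
    (P := fun w p => focal g Γ w.1 w.2.1 w.2.2.1 p ∈ ball u (min δ₁ δ₂)) (fun p hp => by
      refine (hg.contDiffAt_focal (w := (w₀, p)) (hseg p hp)
        (YZ_mem (hseg p hp))).continuousAt.eventually (isOpen_ball.mem_nhds ?_)
      have h1 : focal g Γ x u x p = u := apply_YZ (hseg p hp)
      simp only [hw₀, h1]
      exact mem_ball_self (lt_min hδ₁ hδ₂))
  set ρ := min δ₁ (min δ₂ δ₃) / 2 with hρ
  have hρ0 : 0 < ρ := by positivity
  have hρ1 : 2 * ρ ≤ δ₁ := by rw [hρ]; linarith [min_le_left δ₁ (min δ₂ δ₃)]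
  have hρ2 : 2 * ρ ≤ δ₂ := by
    rw [hρ]; linarith [(min_le_right δ₁ (min δ₂ δ₃)).trans (min_le_left _ _)]
  have hρ3 : 2 * ρ ≤ δ₃ := by
    rw [hρ]; linarith [(min_le_right δ₁ (min δ₂ δ₃)).trans (min_le_right _ _)]
  -- `x₀` and `x₁`, each within `ρ / 16` of `x`, are within `ρ / 8` of each other, as
  -- `LocalModel.quasiconvexOn` requires.
  refine ⟨ρ / 16, by positivity, ?_⟩
  intro x₀ hx₀ u₀ hu₀ x₁ hx₁
  set U := ball u (min δ₁ δ₂) with hU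
  set K := thickening ρ S with hK
  have hball : ∀ x' ∈ ball x₀ ρ, dist x' x < 2 * ρ := fun x' hx' => by
    have h1 := dist_triangle x' x₀ x
    rw [mem_ball] at hx' hx₀
    linarith
  rw [mem_ball] at hx₀ hu₀ hx₁
  have hw : ∀ x' ∈ ball x₀ ρ, ∀ u' ∈ U, (x₀, u₀, x', u') ∈ ball w₀ δ₂ ∧
      (x₀, u₀, x', u') ∈ ball w₀ δ₁ := by
    intro x' hx' u' hu'
    have h1 := hball x' hx'
    have h2 : dist u' u < min δ₁ δ₂ := hu'
    have h3 := h2.trans_le (min_le_left _ _)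
    have h4 := h2.trans_le (min_le_right _ _)
    constructor
    all_goals
      simp only [mem_ball, hw₀, Prod.dist_eq, max_lt_iff]
      refine ⟨?_, ?_, ?_, ?_⟩ <;> linarith
  have hu₀U : u₀ ∈ U := by
    rw [hU, mem_ball]
    exact lt_min (by linarith) (by linarith)
  have hwu : ∀ x' ∈ ball x₀ ρ, (x₀, u₀, x', u₀) ∈ ball w₀ δ₃ := by
    intro x' hx'
    have h1 := hball x' hx'
    simp only [mem_ball, hw₀, Prod.dist_eq, max_lt_iff]
    refine ⟨?_, ?_, ?_, ?_⟩ <;> linarith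
  have hK1 : K ⊆ thickening δ₁ S := thickening_mono (by linarith) S
  have hK2 : K ⊆ thickening δ₂ S := thickening_mono (by linarith) S
  have hK3 : K ⊆ thickening δ₃ S := thickening_mono (by linarith) S
  have hKx : Convex ℝ K := hSx.thickening ρ
  have H2 : ∀ x' ∈ ball x₀ ρ, ∀ u' ∈ U, ∀ p ∈ K, _ := fun x' hx' u' hu' p hp =>
    h₂ _ (hw x' hx' u' hu').1 p (hK2 hp)
  have hx₀b : x₀ ∈ ball x₀ ρ := mem_ball_self hρ0
  have H : LocalModel x₀ u₀ ρ C U K (thickening δ₁ S) (focal g Γ x₀ u₀) (levelGrad g Γ x₀ u₀)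
      (matA g Γ) := by
    constructor
    · exact isOpen_ball
    · exact isOpen_thickening
    · exact hKx
    · rintro ⟨x', p⟩ ⟨hx', hp⟩
      have h1 := H2 x' hx' u₀ hu₀U p hp
      exact (ContDiffAt.comp (f := fun w : Pt n × Pt n => ((x₀, u₀, w.1, u₀), w.2)) (x', p)
        (hg.contDiffAt_focal (w := ((x₀, u₀, x', u₀), p)) h1.1.1 h1.1.2.1)
        (by fun_prop)).contDiffWithinAt
    · rintro ⟨x', u', p⟩ ⟨hx', hu', hp⟩
      exact (ContDiffAt.comp (f := fun w : Pt n × ℝ × Pt n => ((x₀, u₀, w.1, w.2.1), w.2.2))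
        (x', u', p) (H2 x' hx' u' hu' p hp).2.1.1 (by fun_prop)).contDiffWithinAt
    · intro x' hx' p hp
      exact h₃ _ (hwu x' hx') p (hK3 hp)
    · intro x' hx' p hp
      have h1 := (H2 x' hx' u₀ hu₀U p hp).1.2.1
      rw [hg.levelGrad_focal h1]
      exact hg.hasFDerivAt_left h1
    · intro p hp
      exact apply_YZ (H2 x₀ hx₀b u₀ hu₀U p hp).1.1
    · intro p hp
      exact hg.levelGrad_base (H2 x₀ hx₀b u₀ hu₀U p hp).1.1
    · intro x' hx' p hp p' hp'
      rw [hg.levelGrad_focal (H2 x' hx' u₀ hu₀U p hp).1.2.1,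
        hg.levelGrad_focal (H2 x' hx' u₀ hu₀U p' hp').1.2.1]
      exact norm_sub_sub_le_of_fderiv_comp_inr_close (F := F') (w := (x₀, u₀, x', u₀)) hKx
        (fun q hq => ⟨(H2 x' hx' u₀ hu₀U q hq).2.2.1.1.differentiableAt one_ne_zero,
          (H2 x' hx' u₀ hu₀U q hq).2.2.1.2.le⟩) hp hp'
    · intro x' hx' u' hu' p hp p' hp'
      exact norm_sub_sub_le_of_fderiv_comp_inr_close (F := F) (w := (x₀, u₀, x', u')) hKx
        (fun q hq => ⟨(H2 x' hx' u' hu' q hq).2.1.1.differentiableAt one_ne_zero,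
          (H2 x' hx' u' hu' q hq).2.1.2.le⟩) hp hp'
    · intro x' hx' p hp u' hu' u'' hu''
      have h1 : ∀ v ∈ U, HasDerivWithinAt (fun v => levelGrad g Γ x₀ u₀ x' v p)
          (fderiv ℝ F ((x₀, u₀, x', v), p) ((0, 0, 0, 1), 0)) U v := fun v hv => by
        refine HasDerivAt.hasDerivWithinAt ?_
        exact HasFDerivAt.comp_hasDerivAt (f := fun v : ℝ => ((x₀, u₀, x', v), p)) v
          ((H2 x' hx' v hv p hp).2.1.1.differentiableAt one_ne_zero).hasFDerivAt
          (((hasDerivAt_const v x₀).prodMk ((hasDerivAt_const v u₀).prodMk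
            ((hasDerivAt_const v x').prodMk (hasDerivAt_id v)))).prodMk (hasDerivAt_const v p))
      have h2 := (convex_ball u (min δ₁ δ₂)).norm_image_sub_le_of_norm_hasDerivWithin_le (C := C)
        h1 (fun v hv => by
          have h3 := (fderiv ℝ F ((x₀, u₀, x', v), p)).le_opNorm ((0, 0, 0, 1), 0)
          have h4 := (H2 x' hx' v hv p hp).2.2.2.1.le
          refine h3.trans (le_trans (le_of_eq ?_) h4)
          simp [Prod.norm_def]) hu'' hu'
      simpa using h2
    · intro x' hx' u' hu' p hp
      exact (H2 x' hx' u' hu' p hp).2.2.2.2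
    · intro x' hx' u' hu' p hp ξ
      exact hg.fderiv_levelGrad ((ContDiffAt.comp
        (f := fun w : Pt n × ℝ × Pt n => ((x₀, u₀, w.1, w.2.1), w.2.2))
        (x', u', p) (H2 x' hx' u' hu' p hp).2.1.1 (by fun_prop)).differentiableAt one_ne_zero)
        (H2 x' hx' u' hu' p hp).1.2.2 ξ
    · intro x' hx' u' hu' ξ c
      exact convexOn_matA hA (hSx.thickening δ₁)
        (fun p hp => h₁ _ (hw x' hx' u' hu').2 p hp) ξ c
  have hx₁b : x₁ ∈ ball x₀ (ρ / 8) := by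
    rw [mem_ball]
    have h1 := dist_triangle_right x₁ x₀ x
    linarith
  have hx₁b' : x₁ ∈ ball x₀ ρ := ball_subset_ball (by linarith) hx₁b
  have hKs : thickening (ρ / 16) S ⊆ K := thickening_mono (by linarith) S
  refine ⟨fun p hp => ?_, (H.quasiconvexOn hx₁b).mono_set hKs (hSx.thickening _)⟩
  have h1 := H2 x₁ hx₁b' u₀ hu₀U p (hKs hp)
  exact ⟨h1.1.1, h1.1.2.1⟩

end Quasiconvexity
end GenFun


namespace GenFun
open Set Filter Topology Metric
open scoped RealInnerProductSpace

/-! ### Separation in the coordinates `Q`, A3w(2), and convexity of sections. -/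

section Sections
variable {n : ℕ} {g : Pt n → Pt n → ℝ → ℝ} {Γ : Set (Pt n × Pt n × ℝ)} {x y : Pt n} {z u : ℝ}
  {p q : Pt n}

/-- The inverse of `Q(·, y, z)`. -/
noncomputable def Qinv (g : Pt n → Pt n → ℝ → ℝ) (Γ : Set (Pt n × Pt n × ℝ)) (y : Pt n) (z : ℝ)
    (q : Pt n) : Pt n :=
  (YZ (dualFun g Γ) (dualSet g Γ) y z q).1

namespace IsRegular
variable (hg : IsRegular g Γ)
include hg

theorem mem_setU_dual (h : (x, y, z) ∈ Γ) :
    (y, z, Q g x y z) ∈ setU (dualFun g Γ) (dualSet g Γ) := by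
  have := mem_setU (g := dualFun g Γ) (mem_dualSet (g := g) h)
  rwa [hg.dualFun_apply h, hg.gx_dualFun h] at this

theorem YZ_dual_Q (h : (x, y, z) ∈ Γ) :
    YZ (dualFun g Γ) (dualSet g Γ) y z (Q g x y z) = (x, g x y z) := by
  have := YZ_eq hg.dual.a1 (mem_dualSet h)
  rwa [hg.dualFun_apply h, hg.gx_dualFun h] at this

theorem Qinv_Q (h : (x, y, z) ∈ Γ) : Qinv g Γ y z (Q g x y z) = x := by
  rw [Qinv, hg.YZ_dual_Q h]

theorem exists_of_mem_setU_dual (h : (y, z, q) ∈ setU (dualFun g Γ) (dualSet g Γ)) :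
    ∃ x, (x, y, z) ∈ Γ ∧ Q g x y z = q := by
  obtain ⟨y', x, u, h', he⟩ := h
  simp only [Prod.mk.injEq] at he
  obtain ⟨rfl, rfl, rfl⟩ := he
  obtain ⟨z, hz, rfl⟩ := mem_dualSet_iff.1 h'
  rw [hg.dualFun_apply hz]
  exact ⟨x, hz, (hg.gx_dualFun hz).symm⟩

theorem Qinv_mem (h : (y, z, q) ∈ setU (dualFun g Γ) (dualSet g Γ)) :
    (Qinv g Γ y z q, y, z) ∈ Γ := by
  obtain ⟨x, hx, rfl⟩ := hg.exists_of_mem_setU_dual h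
  rwa [hg.Qinv_Q hx]

theorem Q_Qinv (h : (y, z, q) ∈ setU (dualFun g Γ) (dualSet g Γ)) :
    Q g (Qinv g Γ y z q) y z = q := by
  obtain ⟨x, hx, rfl⟩ := hg.exists_of_mem_setU_dual h
  rw [hg.Qinv_Q hx]

theorem contDiffAt_Qinv (h : (y, z, q) ∈ setU (dualFun g Γ) (dualSet g Γ)) :
    ContDiffAt ℝ 1 (Qinv g Γ y z) q :=
  (ContDiffAt.comp (f := fun q => (y, z, q)) q (hg.dual.contDiffAt_YZ h) (by fun_prop)).fst

theorem eventually_mem_setU_dual (h : (y, z, q) ∈ setU (dualFun g Γ) (dualSet g Γ)) :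
    ∀ᶠ q' in 𝓝 q, (y, z, q') ∈ setU (dualFun g Γ) (dualSet g Γ) :=
  eventually_mem_of_continuousAt (f := fun q => (y, z, q)) (by fun_prop) hg.dual.isOpen_setU h

theorem matE_injective (h : (x, y, z) ∈ Γ) : Function.Injective (matE g x y z) :=
  (LinearMap.equivOfDetNeZero (matE g x y z).toLinearMap (hg.a2 _ _ _ h)).injective

theorem hasFDerivAt_Q_left (h : (x, y, z) ∈ Γ) :
    HasFDerivAt (fun x' => Q g x' y z) (fderiv ℝ (fun x' => Q g x' y z) x) x :=
  (DifferentiableAt.comp (f := fun x' => (x', y, z)) x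
    ((hg.contDiffAt_Q h).differentiableAt one_ne_zero) (by fun_prop)).hasFDerivAt

/-- A set `{g(·, y₁, z₁) < g(·, y₀, z₀)}` near which `p ↦ g(x, Y, Z)` is quasiconvex has no
`g`-segment that reaches a point of equality. -/
theorem Q_notMem_segment {K B : Set (Pt n)} {y₀ y₁ a b : Pt n} {z₀ z₁ : ℝ} (hB : IsOpen B)
    (hx₀ : (x, y₀, z₀) ∈ Γ) (hx₁ : (x, y₁, z₁) ∈ Γ) (heq : g x y₁ z₁ = g x y₀ z₀)
    (hK₀ : gx g x y₀ z₀ ∈ K) (hK₁ : gx g x y₁ z₁ ∈ K)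
    (hq : ∀ x' ∈ B, QuasiconvexOn ℝ K (focal g Γ x (g x y₀ z₀) x'))
    (ha : a ∈ B) (ha₀ : (a, y₀, z₀) ∈ Γ) (ha₁ : (a, y₁, z₁) ∈ Γ) (hag : g a y₁ z₁ < g a y₀ z₀)
    (hb : b ∈ B) (hb₀ : (b, y₀, z₀) ∈ Γ) (hb₁ : (b, y₁, z₁) ∈ Γ) (hbg : g b y₁ z₁ < g b y₀ z₀) :
    Q g x y₀ z₀ ∉ segment ℝ (Q g a y₀ z₀) (Q g b y₀ z₀) := by
  set u := g x y₀ z₀ with hu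
  set p := gx g x y₀ z₀ with hp
  set η := gx g x y₁ z₁ - p with hη
  have hpU : (x, u, p) ∈ setU g Γ := mem_setU hx₀
  have hYZ₀ : YZ g Γ x u p = (y₀, z₀) := YZ_eq hg.a1 hx₀
  have hYZ₁ : YZ g Γ x u (p + η) = (y₁, z₁) := by
    have := YZ_eq hg.a1 hx₁
    rwa [heq, show gx g x y₁ z₁ = p + η by rw [hη]; abel] at this
  -- The curve of parameters `(y, z)` whose gradients at `x` run along the segment from `(y₀, z₀)`
  -- to `(y₁, z₁)`. Its initial velocity `(y', z')` defines the separating hyperplane `⟪·, y'⟫ =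
  -- z'`.
  set c : ℝ → Pt n × ℝ := fun s => YZ g Γ x u (p + s • η) with hc
  have hl : HasDerivAt (fun s : ℝ => p + s • η) η 0 := by
    simpa using ((hasDerivAt_id (0:ℝ)).smul_const η).const_add p
  have hcd : DifferentiableAt ℝ c 0 := by
    have h1 : DifferentiableAt ℝ (fun s : ℝ => (x, u, p + s • η)) 0 := by fun_prop
    have h2 : DifferentiableAt ℝ (fun w : Pt n × ℝ × Pt n => YZ g Γ w.1 w.2.1 w.2.2)
        (x, u, p + (0:ℝ) • η) := by
      simpa using (hg.contDiffAt_YZ hpU).differentiableAt one_ne_zero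
    exact DifferentiableAt.comp (f := fun s : ℝ => (x, u, p + s • η)) (0:ℝ) h2 h1
  obtain ⟨⟨y', z'⟩, hc'⟩ : ∃ v, HasDerivAt c v 0 := ⟨_, hcd.hasDerivAt⟩
  have hc0 : c 0 = (y₀, z₀) := by simp [hc, hYZ₀]
  have hY : HasDerivAt (fun s => (c s).1) y' 0 := hc'.fst
  have hZ : HasDerivAt (fun s => (c s).2) z' 0 := hc'.snd
  have hev : ∀ᶠ s in 𝓝 (0:ℝ), (x, u, p + s • η) ∈ setU g Γ :=
    eventually_mem_of_continuousAt (f := fun s : ℝ => (x, u, p + s • η)) (by fun_prop)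
      hg.isOpen_setU (by simpa using hpU)
  have hder : ∀ x', (x', y₀, z₀) ∈ Γ → HasDerivAt (fun s : ℝ => focal g Γ x u x' (p + s • η))
      (-(gz g x' y₀ z₀) * (⟪Q g x' y₀ z₀, y'⟫ - z')) 0 := fun x' hx' => by
    have h1 := hg.hasDerivAt_comp (hasDerivAt_const (0:ℝ) x') hY hZ (by rw [hc0]; exact hx')
    refine h1.congr_deriv ?_
    rw [hc0]
    simp only [inner_zero_right, zero_add, hg.gy_eq hx', inner_smul_left, conj_trivial]
    ring
  -- the point of equality
  have hx' : ⟪Q g x y₀ z₀, y'⟫ = z' := by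
    have h1 := (hder x hx₀).unique ((hasDerivAt_const (0:ℝ) u).congr_of_eventuallyEq
      (hev.mono fun s hs => apply_YZ hs))
    have h2 := mul_eq_zero.1 h1
    rcases h2 with h2 | h2
    · exact absurd (neg_eq_zero.1 h2) (hg.gz_ne_zero hx₀)
    · linarith
  -- If `y' = 0` then `z' = 0`, so `g_x` is stationary along `c`. Since it equals `p + s • η`, this
  -- gives `η = 0` and identical parameters.
  have hy' : y' ≠ 0 := by
    rintro rfl
    have hz' : z' = 0 := by rw [← hx', inner_zero_right]
    subst hz'
    have h1 := hg.hasDerivAt_gx_comp (hasDerivAt_const (0:ℝ) x) hY hZ (by rw [hc0]; exact hx₀)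
    have h2 := h1.unique (hl.congr_of_eventuallyEq (hev.mono fun s hs => gx_YZ hs))
    simp only [map_zero, zero_smul, add_zero] at h2
    rw [← h2, add_zero, hYZ₀, Prod.mk.injEq] at hYZ₁
    rw [hYZ₁.1, hYZ₁.2] at hag
    exact lt_irrefl _ hag
  -- By quasiconvexity the value at `x'` along `c` never exceeds its initial value `g x' y₀ z₀`, so
  -- its initial derivative cannot be positive.
  have hle : ∀ x' ∈ B, (x', y₀, z₀) ∈ Γ → g x' y₁ z₁ < g x' y₀ z₀ →
      ⟪Q g x' y₀ z₀, y'⟫ ≤ z' := by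
    intro x' hx'B hx'₀ hlt
    have h1 := hder x' hx'₀
    by_contra! h2
    have h3 : 0 < -(gz g x' y₀ z₀) * (⟪Q g x' y₀ z₀, y'⟫ - z') :=
      mul_pos (neg_pos.2 (hg.gz_neg _ _ _ hx'₀)) (sub_pos.2 h2)
    obtain ⟨s, hs, hs1⟩ := ((eventually_lt_of_deriv_pos h1.hasFDerivAt (w := (1:ℝ)) (by simpa using h3)).and
      (Ioo_mem_nhdsGT (zero_lt_one' ℝ))).exists
    have h4 := (quasiconvexOn_iff_le_max.1 (hq x' hx'B)).2 hK₀ hK₁ (show 0 ≤ 1 - s by linarith [hs1.2])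
      hs1.1.le (by ring)
    have h5 : (1 - s) • gx g x y₀ z₀ + s • gx g x y₁ z₁ = p + s • η := by
      rw [hη, ← hp]; module
    have h6 : focal g Γ x u x' (gx g x y₁ z₁) = g x' y₁ z₁ := by
      rw [focal, show gx g x y₁ z₁ = p + η by rw [hη]; abel, hYZ₁]
    have h7 : focal g Γ x u x' p = g x' y₀ z₀ := by rw [focal, hYZ₀]
    rw [h5, h6, h7, max_eq_left hlt.le] at h4
    simp only [zero_smul, add_zero, zero_add, smul_eq_mul, mul_one, h7] at hs
    linarith
  -- Equality would make `x'` a local maximum of `⟪Q, y'⟫`, so the transpose of the derivative of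
  -- `Q`, a multiple of `E`, would annihilate `y' ≠ 0`.
  have hlt : ∀ x' ∈ B, (x', y₀, z₀) ∈ Γ → (x', y₁, z₁) ∈ Γ → g x' y₁ z₁ < g x' y₀ z₀ →
      ⟪Q g x' y₀ z₀, y'⟫ < z' := by
    intro x' hx'B hx'₀ hx'₁ hlt
    refine lt_of_le_of_ne (hle x' hx'B hx'₀ hlt) fun h0 => hy' ?_
    have h1 : ∀ᶠ v in 𝓝 x', ⟪Q g v y₀ z₀, y'⟫ ≤ ⟪Q g x' y₀ z₀, y'⟫ := by
      have h2 : ∀ᶠ v in 𝓝 x', (v, y₀, z₀) ∈ Γ :=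
        eventually_mem_of_continuousAt (f := fun v => (v, y₀, z₀)) (by fun_prop) hg.isOpen hx'₀
      have h3 : ∀ᶠ v in 𝓝 x', g v y₁ z₁ < g v y₀ z₀ :=
        (hg.hasFDerivAt_left hx'₁).continuousAt.eventually_lt
          (hg.hasFDerivAt_left hx'₀).continuousAt hlt
      filter_upwards [h2, h3, hB.mem_nhds hx'B] with v hv2 hv3 hvB
      rw [h0]; exact hle v hvB hv2 hv3
    have h2 := (hg.hasFDerivAt_Q_left hx'₀).inner ℝ (hasFDerivAt_const y' x')
    have h3 := IsLocalMax.hasFDerivAt_eq_zero (f := fun v => ⟪Q g v y₀ z₀, y'⟫) h1 h2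
    refine hg.matE_injective hx'₀ ?_
    rw [map_zero]
    refine ext_inner_right ℝ fun ξ => ?_
    have h4 := hg.inner_fderiv_Q hx'₀ ξ y'
    have h5 := congrArg (fun L => L ξ) h3
    simp at h5
    rw [inner_zero_left, ← neg_eq_zero, ← h4, h5, mul_zero]
  rintro ⟨s, t, hs, ht, hst, hst'⟩
  have h1 := hlt a ha ha₀ ha₁ hag
  have h2 := hlt b hb hb₀ hb₁ hbg
  rw [← hst', inner_add_left, inner_smul_left, inner_smul_left, conj_trivial, conj_trivial] at hx'
  have h3 : s * (z' - ⟪Q g a y₀ z₀, y'⟫) + t * (z' - ⟪Q g b y₀ z₀, y'⟫) = 0 := by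
    have : s * z' + t * z' = z' := by rw [← add_mul, hst, one_mul]
    linarith
  rcases hs.eq_or_lt with rfl | hs
  · rw [zero_add] at hst
    subst hst
    linarith
  · have := mul_pos hs (sub_pos.2 h1)
    have := mul_nonneg ht (sub_pos.2 h2).le
    linarith

end IsRegular

theorem pθ_zero (p₀ p₁ : Pt n) : pθ p₀ p₁ 0 = p₀ := by simp [pθ]

theorem pθ_one (p₀ p₁ : Pt n) : pθ p₀ p₁ 1 = p₁ := by simp [pθ]

theorem pθ_mem {p₀ p₁ : Pt n} {θ : ℝ} (hθ : θ ∈ Icc (0:ℝ) 1) : pθ p₀ p₁ θ ∈ segment ℝ p₀ p₁ :=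
  ⟨1 - θ, θ, by linarith [hθ.2], hθ.1, by ring, rfl⟩

theorem FocalQuasiconvex.a3w2 (hV : FocalQuasiconvex g Γ) : A3w2 g Γ := by
  intro x₀ u₀ p₀ p₁ hseg
  obtain ⟨δ, hδ, h⟩ := hV x₀ u₀ p₀ p₁ hseg
  refine ⟨ball x₀ δ, isOpen_ball, mem_ball_self hδ, fun x hx θ hθ => ?_⟩
  obtain ⟨h1, h2⟩ := h x₀ (mem_ball_self hδ) u₀ (mem_ball_self hδ) x hx
  have hsub := self_subset_thickening hδ (segment ℝ p₀ p₁)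
  refine ⟨(h1 _ (hsub (pθ_mem hθ))).2, ?_⟩
  have h3 := (quasiconvexOn_iff_le_max.1 h2).2 (hsub (left_mem_segment ℝ p₀ p₁))
    (hsub (right_mem_segment ℝ p₀ p₁)) 
    (show 0 ≤ 1 - θ by linarith [hθ.2]) hθ.1 (by ring)
  have h4 : YZ g Γ x₀ u₀ (pθ p₀ p₁ 0) = YZ g Γ x₀ u₀ p₀ := by rw [pθ_zero]
  have h5 : YZ g Γ x₀ u₀ (pθ p₀ p₁ 1) = YZ g Γ x₀ u₀ p₁ := by rw [pθ_one]
  simp only [yθ, zθ, Y, Z, h4, h5]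
  exact h3

theorem IsRegular.eventually_segmentIn (hg : IsRegular g Γ) {p₀ p₁ : Pt n}
    (h : SegmentIn g Γ x u p₀ p₁) : ∀ᶠ x' in 𝓝 x, SegmentIn g Γ x' u p₀ p₁ := by
  obtain ⟨δ, hδ, h1⟩ := exists_ball_thickening_of_eventually (isCompact_segment p₀ p₁) (w₀ := x)
    (P := fun x' p => (x', u, p) ∈ setU g Γ) fun p hp =>
      eventually_mem_of_continuousAt (f := fun v : Pt n × Pt n => (v.1, u, v.2)) (by fun_prop)
        hg.isOpen_setU (h p hp)
  filter_upwards [ball_mem_nhds x hδ] with x' hx' p hp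
  exact h1 x' hx' p (self_subset_thickening hδ _ hp)

/-- A segment in the coordinates `Q` that joins two points of the section and leaves it contains a
point of equality, which `Q_notMem_segment` excludes. That point is the base point of the
quasiconvexity used, hence the uniformity in `x` and `u`. -/
theorem IsRegular.exists_convex_image_section (hg : IsRegular g Γ) {x₀ p₀ p₁ y₀ y₁ : Pt n}
    {u₀ z₀ z₁ δ : ℝ} (hδ : 0 < δ) (hseg : SegmentIn g Γ x₀ u₀ p₀ p₁)
    (hVδ : ∀ x ∈ ball x₀ δ, ∀ u ∈ ball u₀ δ, ∀ x₁ ∈ ball x₀ δ,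
      QuasiconvexOn ℝ (thickening δ (segment ℝ p₀ p₁)) (focal g Γ x u x₁))
    (hm₀ : (x₀, y₀, z₀) ∈ Γ) (hm₁ : (x₀, y₁, z₁) ∈ Γ) (hu₀ : g x₀ y₀ z₀ = u₀)
    (hG₀ : gx g x₀ y₀ z₀ = p₀) (hG₁ : gx g x₀ y₁ z₁ = p₁) :
    LocallyGConvexAt g Γ {x | SegmentIn g Γ x u₀ p₀ p₁ ∧ (x, y₁, z₁) ∈ Γ ∧
      (x, y₀, z₀) ∈ Γ ∧ g x y₁ z₁ - g x y₀ z₀ < 0} x₀ y₀ z₀ := by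
  set K := thickening δ (segment ℝ p₀ p₁) with hK
  have hsub := self_subset_thickening hδ (segment ℝ p₀ p₁)
  set q₀ := Q g x₀ y₀ z₀ with hq₀
  have hqU : (y₀, z₀, q₀) ∈ setU (dualFun g Γ) (dualSet g Γ) := hg.mem_setU_dual hm₀
  set X := Qinv g Γ y₀ z₀ with hX
  have hX₀ : X q₀ = x₀ := hg.Qinv_Q hm₀
  have hXc : ContinuousAt X q₀ := (hg.contDiffAt_Qinv hqU).continuousAt
  have hgood : ∀ᶠ x in 𝓝 x₀, (x ∈ ball x₀ δ ∧ SegmentIn g Γ x u₀ p₀ p₁ ∧ (x, y₁, z₁) ∈ Γ) ∧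
      g x y₀ z₀ ∈ ball u₀ δ ∧ gx g x y₀ z₀ ∈ K ∧ gx g x y₁ z₁ ∈ K := by
    have hgx : ∀ {y z}, (x₀, y, z) ∈ Γ → ContinuousAt (fun x => gx g x y z) x₀ := fun h =>
      ContinuousAt.comp (f := fun x => (x, _, _)) (hg.contDiffAt_gx h).continuousAt (by fun_prop)
    refine (Filter.Eventually.and (ball_mem_nhds x₀ hδ)
      ((hg.eventually_segmentIn hseg).and ?_)).and (Filter.Eventually.and ?_ (Filter.Eventually.and ?_ ?_))
    · exact eventually_mem_of_continuousAt (f := fun v => (v, y₁, z₁)) (by fun_prop) hg.isOpen hm₁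
    · exact eventually_mem_of_continuousAt (hg.hasFDerivAt_left hm₀).continuousAt isOpen_ball
        (by rw [hu₀]; exact mem_ball_self hδ)
    · exact eventually_mem_of_continuousAt (hgx hm₀) isOpen_thickening
        (by rw [hG₀]; exact hsub (left_mem_segment ℝ p₀ p₁))
    · exact eventually_mem_of_continuousAt (hgx hm₁) isOpen_thickening
        (by rw [hG₁]; exact hsub (right_mem_segment ℝ p₀ p₁))
  obtain ⟨r, hr, hball⟩ := Metric.eventually_nhds_iff_ball.1
    ((hg.eventually_mem_setU_dual hqU).and (hXc.eventually (by rw [hX₀]; exact hgood)))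
  -- The neighbourhood is a ball in the coordinates `Q`, so segments between images of its points do
  -- not leave it.
  obtain ⟨N, hNo, hN⟩ : ∃ N : Set (Pt n), IsOpen N ∧
      ∀ x, x ∈ N ↔ (x, y₀, z₀) ∈ Γ ∧ Q g x y₀ z₀ ∈ ball q₀ r := by
    refine ⟨{x | (x, y₀, z₀) ∈ Γ} ∩ (fun x => Q g x y₀ z₀) ⁻¹' ball q₀ r, ?_, fun x => Iff.rfl⟩
    refine ContinuousOn.isOpen_inter_preimage (fun x hx => ?_)
      (hg.isOpen.preimage (f := fun x => (x, y₀, z₀)) (by fun_prop)) isOpen_ball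
    exact (hg.hasFDerivAt_Q_left hx).continuousAt.continuousWithinAt
  refine ⟨N, hNo, (hN _).2 ⟨hm₀, mem_ball_self hr⟩, fun x hx => ((hN x).1 hx.2).1, ?_⟩
  · have himage : ∀ q, q ∈ ball q₀ r → g (X q) y₁ z₁ < g (X q) y₀ z₀ →
        q ∈ (fun x => Q g x y₀ z₀) '' ({x | SegmentIn g Γ x u₀ p₀ p₁ ∧ (x, y₁, z₁) ∈ Γ ∧
          (x, y₀, z₀) ∈ Γ ∧ g x y₁ z₁ - g x y₀ z₀ < 0} ∩ N) := by
      intro q hq hlt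
      obtain ⟨h1, ⟨h2, h3, h4⟩, -⟩ := hball q hq
      have h5 := hg.Q_Qinv h1
      refine ⟨X q, ⟨⟨h3, h4, hg.Qinv_mem h1, by linarith⟩, (hN _).2 ⟨hg.Qinv_mem h1, ?_⟩⟩, h5⟩
      rw [h5]; exact hq
    rw [convex_iff_segment_subset]
    rintro _ ⟨a, ⟨⟨-, ha₁, ha₀, hag⟩, har⟩, rfl⟩ _ ⟨b, ⟨⟨-, hb₁, hb₀, hbg⟩, hbr⟩, rfl⟩ q hq
    have hag : g a y₁ z₁ < g a y₀ z₀ := by linarith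
    have hbg : g b y₁ z₁ < g b y₀ z₀ := by linarith
    have har : Q g a y₀ z₀ ∈ ball q₀ r := ((hN a).1 har).2
    have hbr : Q g b y₀ z₀ ∈ ball q₀ r := ((hN b).1 hbr).2
    have hsegr := (convex_ball q₀ r).segment_subset har hbr
    refine himage q (hsegr hq) ?_
    by_contra! hge
    have hXa : X (Q g a y₀ z₀) = a := hg.Qinv_Q ha₀
    have hXb : X (Q g b y₀ z₀) = b := hg.Qinv_Q hb₀
    have hcont : ContinuousOn (fun q => g (X q) y₁ z₁ - g (X q) y₀ z₀)
        (segment ℝ (Q g a y₀ z₀) (Q g b y₀ z₀)) := by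
      intro q hq
      obtain ⟨h1, ⟨h2, h3, h4⟩, -⟩ := hball q (hsegr hq)
      have h5 := (hg.contDiffAt_Qinv h1).continuousAt
      exact ((ContinuousAt.comp (g := fun x => g x y₁ z₁) (hg.hasFDerivAt_left h4).continuousAt
        h5).sub (ContinuousAt.comp (g := fun x => g x y₀ z₀)
        (hg.hasFDerivAt_left (hg.Qinv_mem h1)).continuousAt h5)).continuousWithinAt
    obtain ⟨q', hq', h0⟩ := (convex_segment _ _).isPreconnected.intermediate_value
      (left_mem_segment ℝ _ _) hq hcont (show (0:ℝ) ∈ Icc _ _ from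
        ⟨by simp only [hXa]; linarith, by linarith⟩)
    obtain ⟨h1, ⟨h2, -, h4⟩, h5, h6, h7⟩ := hball q' (hsegr hq')
    have hBa : a ∈ ball x₀ δ := by
      have := (hball _ har).2.1.1
      rwa [hXa] at this
    have hBb : b ∈ ball x₀ δ := by
      have := (hball _ hbr).2.1.1
      rwa [hXb] at this
    refine hg.Q_notMem_segment isOpen_ball (hg.Qinv_mem h1) h4 (by simp only at h0; linarith) h6 h7
      (fun x' hx' => hVδ _ h2 _ h5 x' hx') hBa ha₀ ha₁ hag hBb hb₀ hb₁ hbg ?_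
    rw [hg.Q_Qinv h1]
    exact hq'

theorem IsRegular.a3w1_of_focalQuasiconvex (hg : IsRegular g Γ) (hV : FocalQuasiconvex g Γ) :
    A3w1 g Γ := by
  intro x₀ u₀ p₀ p₁ hseg
  obtain ⟨δ, hδ, hVδ⟩ := hV x₀ u₀ p₀ p₁ hseg
  have hp₀ : (x₀, u₀, p₀) ∈ setU g Γ := hseg _ (left_mem_segment ℝ p₀ p₁)
  have hp₁ : (x₀, u₀, p₁) ∈ setU g Γ := hseg _ (right_mem_segment ℝ p₀ p₁)
  have h := hg.exists_convex_image_section hδ hseg (fun x hx u hu x₁ hx₁ => (hVδ x hx u hu x₁ hx₁).2)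
    (YZ_mem hp₀) (YZ_mem hp₁) (apply_YZ hp₀) (gx_YZ hp₀) (gx_YZ hp₁)
  simpa only [section_Sθ, hθ, yθ, zθ, Y, Z, pθ_zero, pθ_one] using h

end Sections
end GenFun


namespace GenFun
open Set Filter Topology Metric
open scoped RealInnerProductSpace

/-! ### Second derivatives and local convexity on an interval. -/

section LocalToGlobal

theorem eventually_neg_of_second_deriv_neg {φ φ' : ℝ → ℝ} {c : ℝ}
    (h : ∀ᶠ t in 𝓝 0, HasDerivAt φ (φ' t) t) (h0 : φ 0 = 0) (h1 : φ' 0 = 0)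
    (h2 : HasDerivAt φ' c 0) (hc : c < 0) : ∀ᶠ t in 𝓝[>] (0:ℝ), φ t < 0 := by
  have h3 : ∀ᶠ t in 𝓝[>] (0:ℝ), φ' t < 0 := by
    have := eventually_lt_of_deriv_pos h2.neg.hasFDerivAt (w := (1:ℝ)) (by simpa using hc)
    filter_upwards [this] with t ht
    simpa [h1] using ht
  obtain ⟨r₁, hr₁, hb₁⟩ := Metric.eventually_nhds_iff.1 h
  obtain ⟨r₂, hr₂, hb₂⟩ := mem_nhdsGT_iff_exists_Ioo_subset.1 h3
  have hr₂ : 0 < r₂ := hr₂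
  filter_upwards [Ioo_mem_nhdsGT (lt_min hr₁ hr₂)] with t ht
  have ht1 : t < r₁ := ht.2.trans_le (min_le_left _ _)
  have ht2 : t < r₂ := ht.2.trans_le (min_le_right _ _)
  have hd : ∀ s ∈ Icc 0 t, HasDerivAt φ (φ' s) s := fun s hs => hb₁ (by
    rw [Real.dist_eq, sub_zero, abs_of_nonneg hs.1]; linarith [hs.2])
  have hanti : StrictAntiOn φ (Icc 0 t) := by
    refine strictAntiOn_of_deriv_neg (convex_Icc 0 t)
      (fun s hs => (hd s hs).continuousAt.continuousWithinAt) fun s hs => ?_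
    rw [interior_Icc] at hs
    rw [(hd s (Ioo_subset_Icc_self hs)).deriv]
    exact hb₂ ⟨hs.1, hs.2.trans ht2⟩
  have := hanti (left_mem_Icc.2 ht.1.le) (right_mem_Icc.2 ht.1.le) ht.1
  rwa [h0] at this

/-- A continuous function on `[0, 1]` that is locally convex lies below its chord. -/
theorem le_chord_of_locally_convex {φ : ℝ → ℝ} (hc : ContinuousOn φ (Icc 0 1))
    (hl : ∀ t ∈ Icc (0:ℝ) 1, ∃ r > 0, ∀ a ∈ Icc (0:ℝ) 1 ∩ ball t r, ∀ b ∈ Icc (0:ℝ) 1 ∩ ball t r,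
      φ ((a + b) / 2) ≤ (φ a + φ b) / 2) {t : ℝ} (ht : t ∈ Icc (0:ℝ) 1) :
    φ t ≤ (1 - t) * φ 0 + t * φ 1 := by
  set ψ : ℝ → ℝ := fun t => φ t - ((1 - t) * φ 0 + t * φ 1) with hψ
  have hψc : ContinuousOn ψ (Icc 0 1) := hc.sub (by fun_prop)
  obtain ⟨m, hm, hmax⟩ := isCompact_Icc.exists_isMaxOn (nonempty_Icc.2 zero_le_one) hψc
  have hmax' : ∀ s ∈ Icc (0:ℝ) 1, ψ s ≤ ψ m := fun s hs => hmax hs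
  by_contra! hlt
  have hpos : 0 < ψ m := (sub_pos.2 hlt).trans_le (hmax' t ht)
  have hcomp : IsCompact (Icc (0:ℝ) 1 ∩ ψ ⁻¹' {ψ m}) :=
    isCompact_Icc.of_isClosed_subset
      (hψc.preimage_isClosed_of_isClosed isClosed_Icc isClosed_singleton) inter_subset_left
  -- At the smallest maximum point the values to the left are strictly smaller, which contradicts
  -- local midpoint convexity.
  obtain ⟨c, ⟨hcI, hcm⟩, hcmin⟩ := hcomp.exists_isLeast ⟨m, hm, rfl⟩
  have hcm : ψ c = ψ m := hcm
  have hc0 : c ≠ 0 := by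
    rintro rfl
    have : ψ 0 = 0 := by simp [hψ]
    linarith
  have hc1 : c ≠ 1 := by
    rintro rfl
    have : ψ 1 = 0 := by simp [hψ]
    linarith
  have hc0' : 0 < c := lt_of_le_of_ne hcI.1 hc0.symm
  have hc1' : c < 1 := lt_of_le_of_ne hcI.2 hc1
  obtain ⟨r, hr, hconv⟩ := hl c hcI
  set ε := min (r / 2) (min c (1 - c)) with hε
  have hε0 : 0 < ε := lt_min (by linarith) (lt_min hc0' (by linarith))
  have hεr : ε < r := (min_le_left _ _).trans_lt (by linarith)
  have hεc : ε ≤ c := (min_le_right _ _).trans (min_le_left _ _)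
  have hεc' : ε ≤ 1 - c := (min_le_right _ _).trans (min_le_right _ _)
  have ha : c - ε ∈ Icc (0:ℝ) 1 := ⟨by linarith, by linarith⟩
  have hb : c + ε ∈ Icc (0:ℝ) 1 := ⟨by linarith, by linarith⟩
  have h1 := hconv (c - ε) ⟨ha, by rw [mem_ball, Real.dist_eq]; simpa [abs_of_pos hε0] using hεr⟩
    (c + ε) ⟨hb, by rw [mem_ball, Real.dist_eq]; simpa [abs_of_pos hε0] using hεr⟩
  rw [show (c - ε + (c + ε)) / 2 = c by ring] at h1
  have h2 : ψ (c - ε) < ψ m := by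
    refine lt_of_le_of_ne (hmax' _ ha) fun h => ?_
    have : c ≤ c - ε := hcmin ⟨ha, h⟩
    linarith
  have h3 := hmax' _ hb
  have h4 : ψ c ≤ (ψ (c - ε) + ψ (c + ε)) / 2 := by
    simp only [hψ]; linarith
  linarith

end LocalToGlobal

/-! ### From inequalities between values back to A3w, and duality. -/

section Expansion
variable {n : ℕ} {g : Pt n → Pt n → ℝ → ℝ} {Γ : Set (Pt n × Pt n × ℝ)} {x y : Pt n} {z u : ℝ}

theorem pθ_sub (p₀ p₁ : Pt n) (θ : ℝ) : pθ p₀ p₁ θ - p₀ = θ • (p₁ - p₀) := by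
  rw [pθ]; module

theorem sub_pθ (p₀ p₁ : Pt n) (θ : ℝ) : p₁ - pθ p₀ p₁ θ = (1 - θ) • (p₁ - p₀) := by
  rw [pθ]; module

/-- Along `x + tξ + ct²η` two functions `g(·, y, z)` with the same value at `x` are compared through
second derivatives. -/
theorem IsGenerating.eventually_lt_along_parabola (hg : IsGenerating g Γ) {y y' : Pt n} {z z' : ℝ}
    (h : (x, y, z) ∈ Γ) (h' : (x, y', z') ∈ Γ) (hu : g x y z = g x y' z') {ξ η : Pt n} {c : ℝ}
    (hξ : ⟪gx g x y z - gx g x y' z', ξ⟫ = 0)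
    (hneg : ⟪gxx g x y z ξ, ξ⟫ - ⟪gxx g x y' z' ξ, ξ⟫ +
      2 * c * ⟪gx g x y z - gx g x y' z', η⟫ < 0) :
    ∀ᶠ t in 𝓝[>] (0:ℝ), g (x + t • ξ + (c * t ^ 2) • η) y z < g (x + t • ξ + (c * t ^ 2) • η) y' z' := by
  set X : ℝ → Pt n := fun t => x + t • ξ + (c * t ^ 2) • η with hX
  set X' : ℝ → Pt n := fun t => ξ + (2 * c * t) • η with hX'
  have hX0 : X 0 = x := by simp [hX]
  have hX'0 : X' 0 = ξ := by simp [hX']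
  have hXd : ∀ t, HasDerivAt X (X' t) t := by
    intro t
    have h1 : HasDerivAt (fun t : ℝ => x + t • ξ) ((1:ℝ) • ξ) t :=
      ((hasDerivAt_id t).smul_const ξ).const_add x
    have h2 : HasDerivAt (fun t : ℝ => (c * t ^ 2) • η) ((c * (2 * t)) • η) t := by
      have := ((hasDerivAt_pow 2 t).const_mul c).smul_const η
      simpa using this
    refine (h1.add h2).congr_deriv ?_
    simp only [hX', one_smul]; congr 2; ring
  have hX'd : HasDerivAt X' ((2 * c) • η) 0 := by
    refine ((((hasDerivAt_id (0:ℝ)).const_mul (2 * c)).smul_const η).const_add ξ).congr_deriv ?_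
    rw [mul_one]
  have hmem : ∀ {y z}, (x, y, z) ∈ Γ → ∀ᶠ t in 𝓝 (0:ℝ), (X t, y, z) ∈ Γ := fun {y z} h =>
    eventually_mem_of_continuousAt (f := fun t => (X t, y, z))
      ((hXd 0).continuousAt.prodMk continuousAt_const) hg.isOpen (by rw [hX0]; exact h)
  have hd : ∀ {y z t}, (X t, y, z) ∈ Γ →
      HasDerivAt (fun t => g (X t) y z) ⟪gx g (X t) y z, X' t⟫ t := fun {y z t} h => by
    have := hg.hasDerivAt_comp (hXd t) (hasDerivAt_const t y) (hasDerivAt_const t z) h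
    simpa using this
  have hd2 : ∀ {y z}, (x, y, z) ∈ Γ → HasDerivAt (fun t => gx g (X t) y z) (gxx g x y z ξ) 0 :=
    fun {y z} h => by
    have := hg.hasDerivAt_gx_comp (hXd 0) (hasDerivAt_const (0:ℝ) y) (hasDerivAt_const (0:ℝ) z)
      (by rw [hX0]; exact h)
    rw [hX0, hX'0] at this
    simpa using this
  have key := eventually_neg_of_second_deriv_neg (φ := fun t => g (X t) y z - g (X t) y' z')
    (φ' := fun t => ⟪gx g (X t) y z - gx g (X t) y' z', X' t⟫)
    (c := ⟪gx g (X 0) y z - gx g (X 0) y' z', (2 * c) • η⟫ +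
      ⟪gxx g x y z ξ - gxx g x y' z' ξ, X' 0⟫) (by
      filter_upwards [hmem h, hmem h'] with t ht ht'
      rw [inner_sub_left]
      exact (hd ht).sub (hd ht'))
    (by simp only [hX0, hu, sub_self]) (by simp only [hX0, hX'0, hξ])
    (((hd2 h).sub (hd2 h')).inner ℝ hX'd) (by
      rw [hX0, hX'0, inner_smul_right, inner_sub_left (gxx g x y z ξ)]
      linarith)
  exact key.mono fun t ht => sub_neg.1 ht

/-- The inequality of A3w(2) at one `θ` implies that of A3w at this `θ`. -/
theorem IsRegular.inner_matA_le (hg : IsRegular g Γ) {p₀ p₁ ξ : Pt n} {θ : ℝ}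
    (hθ : θ ∈ Icc (0:ℝ) 1) (hseg : SegmentIn g Γ x u p₀ p₁) (hξ : ⟪ξ, p₁ - p₀⟫ = 0)
    (hle : ∀ᶠ x' in 𝓝 x, focal g Γ x u x' (pθ p₀ p₁ θ) ≤
      max (focal g Γ x u x' p₀) (focal g Γ x u x' p₁)) :
    ⟪matA g Γ x u (pθ p₀ p₁ θ) ξ, ξ⟫ ≤
      (1 - θ) * ⟪matA g Γ x u p₀ ξ, ξ⟫ + θ * ⟪matA g Γ x u p₁ ξ, ξ⟫ := by
  rcases eq_or_ne p₁ p₀ with rfl | hne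
  · have : pθ p₁ p₁ θ = p₁ := by rw [← sub_eq_zero, pθ_sub, sub_self, smul_zero]
    rw [this]; linarith
  set η := p₁ - p₀ with hη
  have hη0 : 0 < ⟪η, η⟫ := by
    rw [real_inner_self_eq_norm_sq]
    have := norm_pos_iff.2 (sub_ne_zero.2 hne)
    positivity
  have hp₀ := hseg _ (left_mem_segment ℝ p₀ p₁)
  have hp₁ := hseg _ (right_mem_segment ℝ p₀ p₁)
  have hpθ := hseg _ (pθ_mem hθ)
  by_contra! hlt
  set a := fun p => ⟪matA g Γ x u p ξ, ξ⟫ with ha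
  have hlt : (1 - θ) * a p₀ + θ * a p₁ < a (pθ p₀ p₁ θ) := hlt
  -- This bending of the curve gives `p₀` and `p₁` the same second order coefficient relative to
  -- `p_θ`, namely `(1 - θ) a p₀ + θ a p₁ - a p_θ < 0`. Both functions then drop below that of
  -- `p_θ`.
  set c := (a p₀ - a p₁) / (2 * ⟪η, η⟫) with hc
  have hcη : 2 * c * ⟪η, η⟫ = a p₀ - a p₁ := by rw [hc]; field_simp
  have key : ∀ p s, (x, u, p) ∈ setU g Γ → p - pθ p₀ p₁ θ = s • η →
      a p - a (pθ p₀ p₁ θ) + s * (a p₀ - a p₁) < 0 → ∀ᶠ t in 𝓝[>] (0:ℝ),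
      focal g Γ x u (x + t • ξ + (c * t ^ 2) • η) p <
        focal g Γ x u (x + t • ξ + (c * t ^ 2) • η) (pθ p₀ p₁ θ) := by
    intro p s hp hs hneg
    refine hg.eventually_lt_along_parabola (YZ_mem hp) (YZ_mem hpθ)
      (by rw [apply_YZ hp, apply_YZ hpθ]) ?_ ?_
    · rw [gx_YZ hp, gx_YZ hpθ, hs, inner_smul_left, real_inner_comm, hξ, mul_zero]
    · rw [gx_YZ hp, gx_YZ hpθ, hs, inner_smul_left, conj_trivial,
        show 2 * c * (s * ⟪η, η⟫) = s * (2 * c * ⟪η, η⟫) by ring, hcη]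
      exact hneg
  have h0 := key p₀ (-θ) hp₀ (by rw [← neg_sub, pθ_sub, neg_smul]) (by linarith)
  have h1 := key p₁ (1 - θ) hp₁ (sub_pθ _ _ _) (by linarith)
  have hcont : Tendsto (fun t : ℝ => x + t • ξ + (c * t ^ 2) • η) (𝓝[>] 0) (𝓝 x) := by
    have : ContinuousAt (fun t : ℝ => x + t • ξ + (c * t ^ 2) • η) 0 := by fun_prop
    have h2 := this.tendsto
    simp only [zero_smul, add_zero, ne_eq, OfNat.ofNat_ne_zero, not_false_eq_true, zero_pow,
      mul_zero] at h2
    exact h2.mono_left nhdsWithin_le_nhds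
  obtain ⟨t, ⟨ht0, ht1⟩, ht⟩ := ((h0.and h1).and (hcont.eventually hle)).exists
  exact absurd ht (not_le.2 (max_lt ht0 ht1))

theorem a3w_of_inner_matA_le
    (h : ∀ (ξ x : Pt n) (u : ℝ) (p₀ p₁ : Pt n), SegmentIn g Γ x u p₀ p₁ → ⟪ξ, p₁ - p₀⟫ = 0 →
      ∀ θ ∈ Icc (0:ℝ) 1, ⟪matA g Γ x u (pθ p₀ p₁ θ) ξ, ξ⟫ ≤
        (1 - θ) * ⟪matA g Γ x u p₀ ξ, ξ⟫ + θ * ⟪matA g Γ x u p₁ ξ, ξ⟫) : A3w g Γ := by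
  intro ξ x u p₀ p₁ hseg hξ
  refine ⟨convex_segment _ _, fun a ha b hb s t hs ht hst => ?_⟩
  have hsub : segment ℝ a b ⊆ segment ℝ p₀ p₁ := (convex_segment _ _).segment_subset ha hb
  have hba : ∀ a ∈ segment ℝ p₀ p₁, ⟪ξ, a⟫ = ⟪ξ, p₀⟫ := by
    rintro _ ⟨s, t, -, -, hst, rfl⟩
    rw [inner_sub_right, sub_eq_zero] at hξ
    rw [inner_add_right, inner_smul_right, inner_smul_right, hξ, ← add_mul, hst, one_mul]
  have h1 := h ξ x u a b (fun p hp => hseg p (hsub hp))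
    (by rw [inner_sub_right, hba a ha, hba b hb, sub_self]) t ⟨ht, by linarith⟩
  obtain rfl : s = 1 - t := by linarith
  exact h1

/-- A3w follows if the inequality of A3w(2) holds for each `θ` in a neighbourhood that may depend
on `θ`. -/
theorem IsRegular.a3w_of_eventually_le_max (hg : IsRegular g Γ)
    (h : ∀ x u p₀ p₁, SegmentIn g Γ x u p₀ p₁ → ∀ θ ∈ Icc (0:ℝ) 1,
      ∀ᶠ x' in 𝓝 x, focal g Γ x u x' (pθ p₀ p₁ θ) ≤
        max (focal g Γ x u x' p₀) (focal g Γ x u x' p₁)) : A3w g Γ :=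
  a3w_of_inner_matA_le fun _ x u p₀ p₁ hseg hξ θ hθ => hg.inner_matA_le hθ hseg hξ
    (h x u p₀ p₁ hseg θ hθ)

theorem IsRegular.a3w_of_a3w2 (hg : IsRegular g Γ) (h : A3w2 g Γ) : A3w g Γ := by
  refine hg.a3w_of_eventually_le_max fun x u p₀ p₁ hseg θ hθ => ?_
  obtain ⟨N, hN, hxN, hle⟩ := h x u p₀ p₁ hseg
  filter_upwards [hN.mem_nhds hxN] with x' hx'
  have := (hle x' hx' θ hθ).2
  simpa only [yθ, zθ, Y, Z, pθ_zero, pθ_one, focal] using this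

/-- Continuity is what allows the passage from local midpoint convexity of `A` to convexity. -/
theorem IsRegular.continuousAt_matA (hg : IsRegular g Γ) {p : Pt n} (hp : (x, u, p) ∈ setU g Γ) :
    ContinuousAt (fun p => matA g Γ x u p) p := by
  have hYZ : ContinuousAt (fun p => (x, YZ g Γ x u p)) p := by
    have h1 := (hg.contDiffAt_YZ hp).continuousAt
    exact continuousAt_const.prodMk (ContinuousAt.comp (f := fun p => (x, u, p)) h1 (by fun_prop))
  have hD : ContinuousAt (fderiv ℝ (fun w : Pt n × Pt n × ℝ => gx g w.1 w.2.1 w.2.2))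
      (x, YZ g Γ x u p) :=
    ((hg.contDiffAt_gx (YZ_mem hp)).fderiv_right (m := 0) (by norm_num)).continuousAt
  have h2 : ContinuousAt (fun p => (fderiv ℝ (fun w : Pt n × Pt n × ℝ => gx g w.1 w.2.1 w.2.2)
      (x, YZ g Γ x u p)).comp (ContinuousLinearMap.inl ℝ _ _)) p :=
    (ContinuousAt.comp (f := fun p => (x, YZ g Γ x u p)) hD hYZ).clm_comp continuousAt_const
  refine h2.congr ?_
  have h3 : ∀ᶠ p' in 𝓝 p, (x, u, p') ∈ setU g Γ :=
    eventually_mem_of_continuousAt (f := fun p => (x, u, p)) (by fun_prop) hg.isOpen_setU hp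
  filter_upwards [h3] with p' hp'
  ext1 ξ
  have := hg.fderiv_gx (YZ_mem hp') ξ 0 0
  simp only [map_zero, add_zero, zero_smul] at this
  rw [matA, Y, Z, ← this]
  rfl

/-- The inequality of A3w(2) at the midpoint of short segments is enough for A3w. -/
theorem IsRegular.a3w_of_locally_le_max (hg : IsRegular g Γ)
    (h : ∀ x u p, (x, u, p) ∈ setU g Γ → ∃ r > 0, ∀ p₀ ∈ ball p r, ∀ p₁ ∈ ball p r,
      ∀ᶠ x' in 𝓝 x, focal g Γ x u x' (pθ p₀ p₁ (1 / 2)) ≤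
        max (focal g Γ x u x' p₀) (focal g Γ x u x' p₁)) : A3w g Γ := by
  refine a3w_of_inner_matA_le fun ξ x u p₀ p₁ hseg hξ θ hθ => ?_
  have hP : Continuous fun t : ℝ => pθ p₀ p₁ t := by unfold pθ; fun_prop
  have h1 := le_chord_of_locally_convex (φ := fun t => ⟪matA g Γ x u (pθ p₀ p₁ t) ξ, ξ⟫) ?_ ?_ hθ
  · simpa only [pθ_zero, pθ_one] using h1
  · intro t ht
    have h2 := ContinuousAt.comp (f := fun t => pθ p₀ p₁ t)
      (hg.continuousAt_matA (hseg _ (pθ_mem ht))) hP.continuousAt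
    exact ((h2.clm_apply continuousAt_const).inner continuousAt_const).continuousWithinAt
  · intro t ht
    obtain ⟨r, hr, hr'⟩ := h x u _ (hseg _ (pθ_mem ht))
    obtain ⟨δ, hδ, hball⟩ := Metric.continuousAt_iff.1 (hP.continuousAt (x := t)) r hr
    refine ⟨δ, hδ, fun a ha b hb => ?_⟩
    have hab : pθ p₀ p₁ ((a + b) / 2) = pθ (pθ p₀ p₁ a) (pθ p₀ p₁ b) (1 / 2) := by
      simp only [pθ]; module
    have hsub : segment ℝ (pθ p₀ p₁ a) (pθ p₀ p₁ b) ⊆ segment ℝ p₀ p₁ :=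
      (convex_segment _ _).segment_subset (pθ_mem ha.1) (pθ_mem hb.1)
    have hd : pθ p₀ p₁ b - pθ p₀ p₁ a = (b - a) • (p₁ - p₀) := by simp only [pθ]; module
    have h3 := hg.inner_matA_le (θ := 1 / 2) (ξ := ξ) (by norm_num)
      (fun p hp => hseg p (hsub hp)) (by rw [hd, inner_smul_right, hξ, mul_zero])
      (hr' _ (hball ha.2) _ (hball hb.2))
    simp only [hab]
    linarith

/-- Since `g_z < 0`, an inequality between values of `g*` at `(a, y)` reverses to one between values
of `g`. Failure of the midpoint inequality for `g*` thus puts `Q` of a point of equality between `Q`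
of two points of a section, against `Q_notMem_segment`. -/
theorem IsRegular.a3w_dual_of_focalQuasiconvex (hg : IsRegular g Γ) (hV : FocalQuasiconvex g Γ) :
    A3w (dualFun g Γ) (dualSet g Γ) := by
  refine hg.dual.a3w_of_locally_le_max fun y₀ z₀ q₀ hq₀ => ?_
  obtain ⟨x₀, hx₀, rfl⟩ := hg.exists_of_mem_setU_dual hq₀
  -- The degenerate segment suffices, because only short segments in the dual variable are needed.
  obtain ⟨δ, hδ, hVδ⟩ := hV x₀ (g x₀ y₀ z₀) (gx g x₀ y₀ z₀) (gx g x₀ y₀ z₀) (by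
    intro p hp
    rw [segment_same] at hp
    rw [mem_singleton_iff.1 hp]
    exact mem_setU hx₀)
  set K := thickening δ (segment ℝ (gx g x₀ y₀ z₀) (gx g x₀ y₀ z₀)) with hK
  have hpK : gx g x₀ y₀ z₀ ∈ K := self_subset_thickening hδ _ (left_mem_segment ℝ _ _)
  have hgx : ∀ {x y z}, (x, y, z) ∈ Γ → ContinuousAt (fun x => gx g x y z) x := fun h =>
    ContinuousAt.comp (f := fun x => (x, _, _)) (hg.contDiffAt_gx h).continuousAt (by fun_prop)
  have hgood : ∀ᶠ x in 𝓝 x₀, x ∈ ball x₀ δ ∧ g x y₀ z₀ ∈ ball (g x₀ y₀ z₀) δ ∧ gx g x y₀ z₀ ∈ K :=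
    Filter.Eventually.and (ball_mem_nhds x₀ hδ) (Filter.Eventually.and
      (eventually_mem_of_continuousAt (hg.hasFDerivAt_left hx₀).continuousAt isOpen_ball
        (mem_ball_self hδ))
      (eventually_mem_of_continuousAt (hgx hx₀) isOpen_thickening hpK))
  have hX₀ : Qinv g Γ y₀ z₀ (Q g x₀ y₀ z₀) = x₀ := hg.Qinv_Q hx₀
  obtain ⟨r, hr, hball⟩ := Metric.eventually_nhds_iff_ball.1
    ((hg.eventually_mem_setU_dual hq₀).and
      ((hg.contDiffAt_Qinv hq₀).continuousAt.eventually (by rw [hX₀]; exact hgood)))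
  refine ⟨r, hr, fun qa hqa qb hqb => ?_⟩
  set q := pθ qa qb (1 / 2) with hq
  have hqseg : q ∈ segment ℝ qa qb := pθ_mem (by norm_num)
  obtain ⟨hUa, hBa, -, -⟩ := hball qa hqa
  obtain ⟨hUb, hBb, -, -⟩ := hball qb hqb
  obtain ⟨hU, hB, hBu, hBK⟩ := hball q ((convex_ball _ r).segment_subset hqa hqb hqseg)
  obtain ⟨a, ha, hqa'⟩ := hg.exists_of_mem_setU_dual hUa
  obtain ⟨b, hb, hqb'⟩ := hg.exists_of_mem_setU_dual hUb
  obtain ⟨x, hx, hqx⟩ := hg.exists_of_mem_setU_dual hU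
  simp only [focal]
  have hYa := hg.YZ_dual_Q ha
  have hYb := hg.YZ_dual_Q hb
  have hYx := hg.YZ_dual_Q hx
  rw [hqa'] at hYa
  rw [hqb'] at hYb
  rw [hqx] at hYx
  rw [hYa, hYb, hYx]
  have hXa : Qinv g Γ y₀ z₀ qa = a := by rw [Qinv, hYa]
  have hXb : Qinv g Γ y₀ z₀ qb = b := by rw [Qinv, hYb]
  have hXx : Qinv g Γ y₀ z₀ q = x := by rw [Qinv, hYx]
  rw [hXa] at hBa
  rw [hXb] at hBb
  rw [hXx] at hB hBu hBK
  -- the neighbourhood of `y₀`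
  have hcont : ∀ {x}, (x, y₀, z₀) ∈ Γ →
      ContinuousAt (fun y => dualFun g Γ y x (g x y₀ z₀)) y₀ := fun {x} h =>
    ContinuousAt.comp (f := fun y => (y, x, g x y₀ z₀))
      (hg.contDiffAt_dualFun (mem_dualSet h)).continuousAt (by fun_prop)
  have hz : dualFun g Γ y₀ x (g x y₀ z₀) = z₀ := hg.dualFun_apply hx
  have hdual : ∀ {x}, (x, y₀, z₀) ∈ Γ → ∀ᶠ y in 𝓝 y₀, (y, x, g x y₀ z₀) ∈ dualSet g Γ := fun {x} h =>
    eventually_mem_of_continuousAt (f := fun y => (y, x, g x y₀ z₀)) (by fun_prop) hg.dual.isOpen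
      (mem_dualSet h)
  have hΓ : ∀ {x'}, (x', y₀, z₀) ∈ Γ → ∀ᶠ y in 𝓝 y₀, (x', y, dualFun g Γ y x (g x y₀ z₀)) ∈ Γ :=
    fun {x'} h => eventually_mem_of_continuousAt
      (f := fun y => (x', y, dualFun g Γ y x (g x y₀ z₀)))
      (continuousAt_const.prodMk (continuousAt_id.prodMk (hcont hx))) hg.isOpen
      (by simp only [hz]; exact h)
  have hgK : ∀ᶠ y in 𝓝 y₀, gx g x y (dualFun g Γ y x (g x y₀ z₀)) ∈ K := by
    have h1 : ContinuousAt (fun y => gx g x y (dualFun g Γ y x (g x y₀ z₀))) y₀ := by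
      refine ContinuousAt.comp_of_eq (f := fun y => (x, y, dualFun g Γ y x (g x y₀ z₀)))
        (hg.contDiffAt_gx hx).continuousAt
        (continuousAt_const.prodMk (continuousAt_id.prodMk (hcont hx))) ?_
      simp only [hz]
    exact eventually_mem_of_continuousAt h1 isOpen_thickening (by simp only [hz]; exact hBK)
  filter_upwards [hΓ ha, hΓ hb, hΓ hx, hdual ha, hdual hb, hdual hx, hgK] with
    y hya hyb hyx hda hdb hdx hyK
  by_contra! hlt
  obtain ⟨hlta, hltb⟩ := max_lt_iff.1 hlt
  -- With this `z`, equality `g x y z = g x y₀ z₀` holds at `x`, while `hanti` gives the strict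
  -- inequality at `a` and `b`.
  set z := dualFun g Γ y x (g x y₀ z₀) with hzdef
  have hanti : ∀ {a}, (a, y, z) ∈ Γ → (y, a, g a y₀ z₀) ∈ dualSet g Γ →
      dualFun g Γ y a (g a y₀ z₀) < z → g a y z < g a y₀ z₀ := fun {a} h1 h2 h3 => by
    have h4 := hg.strictAntiOn a y (hg.dualFun_mem h2) h1 h3
    simp only [hg.apply_dualFun h2] at h4
    exact h4
  refine hg.Q_notMem_segment isOpen_ball hx hyx (hg.apply_dualFun hdx) hBK hyK
    (fun x' hx' => (hVδ _ hB _ hBu x' hx').2) hBa ha hya (hanti hya hda hlta)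
    hBb hb hyb (hanti hyb hdb hltb) ?_
  rw [hqa', hqb', hqx]
  exact hqseg

end Expansion
end GenFun


namespace GenFun
open Set Filter Topology Metric
open scoped RealInnerProductSpace

/-! ### A3w(1) implies A3w. -/

section HalfSpace
variable {n : ℕ} {g : Pt n → Pt n → ℝ → ℝ} {Γ : Set (Pt n × Pt n × ℝ)} {x : Pt n} {u : ℝ}
  {p₀ p₁ : Pt n}

namespace IsRegular
variable (hg : IsRegular g Γ)
include hg

/-- A `g`-convex section `{g(·, y₁, z₁) < g(·, y₀, z₀)}` lies, in the coordinates `Q(·, y₀, z₀)`, in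
the half-space given by its tangent plane. -/
theorem section_subset_halfSpace (hseg : SegmentIn g Γ x u p₀ p₁)
    (h : LocallyGConvexAt g Γ (section_Sθ g Γ x u p₀ p₁ 1) x
      (yθ g Γ x u p₀ p₁ 0) (zθ g Γ x u p₀ p₁ 0)) :
    ∀ᶠ x' in 𝓝 x, focal g Γ x u x' p₁ < focal g Γ x u x' p₀ →
      ⟪p₁ - p₀, fderiv ℝ (Qinv g Γ (YZ g Γ x u p₀).1 (YZ g Γ x u p₀).2)
        (Q g x (YZ g Γ x u p₀).1 (YZ g Γ x u p₀).2)
        (Q g x' (YZ g Γ x u p₀).1 (YZ g Γ x u p₀).2 -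
          Q g x (YZ g Γ x u p₀).1 (YZ g Γ x u p₀).2)⟫ ≤ 0 := by
  have hp₀ : (x, u, p₀) ∈ setU g Γ := hseg _ (left_mem_segment ℝ p₀ p₁)
  have hp₁ : (x, u, p₁) ∈ setU g Γ := hseg _ (right_mem_segment ℝ p₀ p₁)
  have hm₀ := YZ_mem hp₀
  have hm₁ := YZ_mem hp₁
  have hu : g x (YZ g Γ x u p₁).1 (YZ g Γ x u p₁).2 = g x (YZ g Γ x u p₀).1 (YZ g Γ x u p₀).2 := by
    rw [apply_YZ hp₀, apply_YZ hp₁]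
  have hG₀ := gx_YZ hp₀
  have hG₁ := gx_YZ hp₁
  simp only [section_Sθ, hθ, yθ, zθ, Y, Z, pθ_zero, pθ_one] at h
  simp only [focal]
  generalize (YZ g Γ x u p₀).1 = y₀ at *
  generalize (YZ g Γ x u p₀).2 = z₀ at *
  generalize (YZ g Γ x u p₁).1 = y₁ at *
  generalize (YZ g Γ x u p₁).2 = z₁ at *
  obtain ⟨N, hN, hxN, hNΓ, hconv⟩ := h
  have hΓ₀ : ∀ᶠ x' in 𝓝 x, (x', y₀, z₀) ∈ Γ :=
    eventually_mem_of_continuousAt (f := fun v => (v, y₀, z₀)) (by fun_prop) hg.isOpen hm₀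
  have hΓ₁ : ∀ᶠ x' in 𝓝 x, (x', y₁, z₁) ∈ Γ :=
    eventually_mem_of_continuousAt (f := fun v => (v, y₁, z₁)) (by fun_prop) hg.isOpen hm₁
  have hgood := (hg.eventually_segmentIn hseg).and (hΓ₁.and (hΓ₀.and (hN.mem_nhds hxN)))
  set q₀ := Q g x y₀ z₀ with hq₀
  have hqU : (y₀, z₀, q₀) ∈ setU (dualFun g Γ) (dualSet g Γ) := hg.mem_setU_dual hm₀
  set X := Qinv g Γ y₀ z₀ with hX
  have hX₀ : X q₀ = x := hg.Qinv_Q hm₀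
  have hXd : HasFDerivAt X (fderiv ℝ X q₀) q₀ :=
    ((hg.contDiffAt_Qinv hqU).differentiableAt one_ne_zero).hasFDerivAt
  filter_upwards [hgood] with x' hx' hlt
  -- If `q₀ + v` is in the section but beyond the tangent plane, then `q₀ - s v` is in it for small
  -- `s > 0`, since `-v` points into the section. Convexity then puts `q₀` itself in the section,
  -- although `x` is a point of equality.
  by_contra! hpos
  obtain ⟨hseg', hx'₁, hx'₀, hx'N⟩ := hx'
  set v := Q g x' y₀ z₀ - q₀ with hv
  have hl : HasDerivAt (fun s : ℝ => q₀ - s • v) (-v) 0 := by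
    refine (((hasDerivAt_id (0:ℝ)).smul_const v).const_sub q₀).congr_deriv (by simp)
  have hXl : HasDerivAt (fun s : ℝ => X (q₀ - s • v)) (fderiv ℝ X q₀ (-v)) 0 :=
    HasFDerivAt.comp_hasDerivAt_of_eq (f := fun s : ℝ => q₀ - s • v) (0:ℝ) hXd hl (by simp)
  have h0 : X (q₀ - (0:ℝ) • v) = x := by simp [hX₀]
  have hd : HasDerivAt (fun s : ℝ => g (X (q₀ - s • v)) y₀ z₀ - g (X (q₀ - s • v)) y₁ z₁)
      ⟪p₁ - p₀, fderiv ℝ X q₀ v⟫ 0 := by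
    have h1 := hg.hasDerivAt_comp hXl (hasDerivAt_const (0:ℝ) y₀) (hasDerivAt_const (0:ℝ) z₀)
      (by rw [h0]; exact hm₀)
    have h2 := hg.hasDerivAt_comp hXl (hasDerivAt_const (0:ℝ) y₁) (hasDerivAt_const (0:ℝ) z₁)
      (by rw [h0]; exact hm₁)
    refine (h1.sub h2).congr_deriv ?_
    rw [h0, hG₀, hG₁]
    simp only [map_neg, inner_neg_right, inner_zero_right, mul_zero, add_zero, inner_sub_left]
    ring
  have hev := eventually_lt_of_deriv_pos hd.hasFDerivAt (w := (1:ℝ)) (by simpa using hpos)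
  have hXt : Tendsto (fun s : ℝ => X (q₀ - s • v)) (𝓝[>] 0) (𝓝 x) := by
    have := hXl.continuousAt.tendsto
    rw [h0] at this
    exact this.mono_left nhdsWithin_le_nhds
  have hlt0 : Tendsto (fun s : ℝ => q₀ - s • v) (𝓝[>] 0) (𝓝 q₀) := by
    have := hl.continuousAt.tendsto
    simp only [zero_smul, sub_zero] at this
    exact this.mono_left nhdsWithin_le_nhds
  obtain ⟨s, ⟨⟨hs1, hs2⟩, hs3⟩, hs0⟩ := (((hev.and (hXt.eventually hgood)).and
    (hlt0.eventually (hg.eventually_mem_setU_dual hqU))).and eventually_mem_nhdsWithin).exists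
  have hs0 : 0 < s := hs0
  simp only [zero_add, smul_eq_mul, mul_one, h0, hu, sub_self] at hs1
  have hmem₁ : q₀ - s • v ∈ (fun x => Q g x y₀ z₀) '' ({x | SegmentIn g Γ x u p₀ p₁ ∧
      (x, y₁, z₁) ∈ Γ ∧ (x, y₀, z₀) ∈ Γ ∧ g x y₁ z₁ - g x y₀ z₀ < 0} ∩ N) :=
    ⟨X (q₀ - s • v), ⟨⟨hs2.1, hs2.2.1, hs2.2.2.1, by linarith⟩, hs2.2.2.2⟩, hg.Q_Qinv hs3⟩
  have hmem₂ : q₀ + v ∈ (fun x => Q g x y₀ z₀) '' ({x | SegmentIn g Γ x u p₀ p₁ ∧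
      (x, y₁, z₁) ∈ Γ ∧ (x, y₀, z₀) ∈ Γ ∧ g x y₁ z₁ - g x y₀ z₀ < 0} ∩ N) :=
    ⟨x', ⟨⟨hseg', hx'₁, hx'₀, by linarith⟩, hx'N⟩, by simp [hv]⟩
  have hs1' : 0 < 1 + s := by linarith
  obtain ⟨w, ⟨⟨-, -, hw₀, hwlt⟩, -⟩, hw⟩ := hconv hmem₁ hmem₂ (a := 1 / (1 + s)) (b := s / (1 + s))
    (by positivity) (by positivity) (by field_simp)
  have hwq : (1 / (1 + s)) • (q₀ - s • v) + (s / (1 + s)) • (q₀ + v) = q₀ := by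
    have : (1 / (1 + s)) + (s / (1 + s)) = 1 := by field_simp
    calc (1 / (1 + s)) • (q₀ - s • v) + (s / (1 + s)) • (q₀ + v)
        = ((1 / (1 + s)) + (s / (1 + s))) • q₀ := by module
      _ = q₀ := by rw [this, one_smul]
  rw [hwq] at hw
  obtain rfl := hg.a1star _ _ hw₀ hm₀ hw
  rw [hu, sub_self] at hwlt
  exact lt_irrefl _ hwlt

theorem fderiv_Qinv_fderiv_Q {y : Pt n} {z : ℝ} (h : (x, y, z) ∈ Γ) (ξ : Pt n) :
    fderiv ℝ (Qinv g Γ y z) (Q g x y z) (fderiv ℝ (fun x' => Q g x' y z) x ξ) = ξ := by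
  have h1 : HasFDerivAt (Qinv g Γ y z) (fderiv ℝ (Qinv g Γ y z) (Q g x y z)) (Q g x y z) :=
    ((hg.contDiffAt_Qinv (hg.mem_setU_dual h)).differentiableAt one_ne_zero).hasFDerivAt
  have h2 := HasFDerivAt.comp (f := fun x' => Q g x' y z) x h1 (hg.hasFDerivAt_Q_left h)
  have h3 : ∀ᶠ x' in 𝓝 x, (x', y, z) ∈ Γ :=
    eventually_mem_of_continuousAt (f := fun v => (v, y, z)) (by fun_prop) hg.isOpen h
  have h4 := h2.unique ((hasFDerivAt_id x).congr_of_eventuallyEq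
    (h3.mono fun x' hx' => hg.Qinv_Q hx'))
  exact congrArg (fun L => L ξ) h4

/-- Seen from `p_θ`, the sections towards `p₁` and `p₀` lie in half-spaces with opposite normals.
They can meet only in the common hyperplane, but their intersection is open near `x`; so it is empty
there, which is the inequality of A3w(2) at `θ`. -/
theorem a3w_of_a3w1 (h : A3w1 g Γ) : A3w g Γ := by
  refine hg.a3w_of_eventually_le_max fun x u p₀ p₁ hseg θ hθ => ?_
  rcases eq_or_ne p₁ p₀ with rfl | hne
  · refine Eventually.of_forall fun x' => ?_
    have : pθ p₁ p₁ θ = p₁ := by rw [← sub_eq_zero, pθ_sub, sub_self, smul_zero]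
    rw [this, max_self]
  rcases hθ.1.eq_or_lt with rfl | hθ0
  · exact Eventually.of_forall fun x' => by rw [pθ_zero]; exact le_max_left _ _
  rcases hθ.2.eq_or_lt with rfl | hθ1
  · exact Eventually.of_forall fun x' => by rw [pθ_one]; exact le_max_right _ _
  set p := pθ p₀ p₁ θ with hp
  have hpseg : p ∈ segment ℝ p₀ p₁ := pθ_mem hθ
  have hseg₁ : SegmentIn g Γ x u p p₁ := fun q hq =>
    hseg q ((convex_segment _ _).segment_subset hpseg (right_mem_segment ℝ _ _) hq)
  have hseg₀ : SegmentIn g Γ x u p p₀ := fun q hq =>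
    hseg q ((convex_segment _ _).segment_subset hpseg (left_mem_segment ℝ _ _) hq)
  have hm := YZ_mem (hseg p hpseg)
  set y := (YZ g Γ x u p).1
  set z := (YZ g Γ x u p).2
  have H₁ := hg.section_subset_halfSpace hseg₁ (h x u p p₁ hseg₁)
  have H₀ := hg.section_subset_halfSpace hseg₀ (h x u p p₀ hseg₀)
  set q₀ := Q g x y z with hq₀
  set M := fderiv ℝ (Qinv g Γ y z) q₀ with hM
  set η := p₁ - p₀ with hη
  rw [sub_pθ] at H₁
  rw [← neg_sub p p₀, pθ_sub] at H₀
  have hboth : ∀ᶠ x' in 𝓝 x, focal g Γ x u x' p₁ < focal g Γ x u x' p →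
      focal g Γ x u x' p₀ < focal g Γ x u x' p → ⟪η, M (Q g x' y z - q₀)⟫ = 0 := by
    filter_upwards [H₁, H₀] with x' h1 h0 hlt1 hlt0
    have h1 := h1 hlt1
    have h0 := h0 hlt0
    rw [inner_smul_left, conj_trivial] at h1
    rw [inner_neg_left, inner_smul_left, conj_trivial] at h0
    refine le_antisymm ?_ ?_
    · exact nonpos_of_mul_nonpos_right h1 (by linarith)
    · exact nonneg_of_mul_nonneg_right (by linarith) hθ0
  have hcont : ∀ {q}, (x, u, q) ∈ setU g Γ → ∀ᶠ x' in 𝓝 x, ContinuousAt (fun x' => focal g Γ x u x' q) x' :=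
    fun {q} hq => (eventually_mem_of_continuousAt
      (f := fun v => (v, (YZ g Γ x u q).1, (YZ g Γ x u q).2)) (by fun_prop) hg.isOpen
      (YZ_mem hq)).mono fun v hv => (hg.hasFDerivAt_left hv).continuousAt
  have hΓ : ∀ᶠ x' in 𝓝 x, (x', y, z) ∈ Γ :=
    eventually_mem_of_continuousAt (f := fun v => (v, y, z)) (by fun_prop) hg.isOpen hm
  filter_upwards [hboth.eventually_nhds, hcont (hseg p hpseg),
    hcont (hseg p₀ (left_mem_segment ℝ _ _)), hcont (hseg p₁ (right_mem_segment ℝ _ _)), hΓ] with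
    x' hb hc hc₀ hc₁ hx'
  by_contra! hlt
  obtain ⟨hlt0, hlt1⟩ := max_lt_iff.1 hlt
  -- An affine function of `Q` that vanishes near a point has zero linear part; evaluated at the
  -- derivative of `Q` in direction `η`, it gives `⟪η, η⟫ = 0`.
  have hzero : ∀ᶠ w in 𝓝 x', ⟪η, M (Q g w y z - q₀)⟫ = 0 := by
    filter_upwards [hb, hc₁.eventually_lt hc hlt1, hc₀.eventually_lt hc hlt0] with w hw h1 h0
    exact hw h1 h0
  set q' := Q g x' y z with hq'
  have hqU : (y, z, q') ∈ setU (dualFun g Γ) (dualSet g Γ) := hg.mem_setU_dual hx'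
  have hX : ContinuousAt (Qinv g Γ y z) q' := (hg.contDiffAt_Qinv hqU).continuousAt
  have hXq : Qinv g Γ y z q' = x' := hg.Qinv_Q hx'
  have hzero' : ∀ᶠ q in 𝓝 q', ⟪η, M (q - q₀)⟫ = 0 := by
    filter_upwards [hX.eventually (by rw [hXq]; exact hzero), hg.eventually_mem_setU_dual hqU] with
      q h1 h2
    rwa [hg.Q_Qinv h2] at h1
  have hd : HasFDerivAt (fun q => ⟪η, M (q - q₀)⟫) ((innerSL ℝ η).comp M) q' :=
    (((innerSL ℝ η).comp M).hasFDerivAt.comp q' ((hasFDerivAt_id q').sub_const q₀)).congr_fderiv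
      (by ext; simp)
  have h1 := hd.unique ((hasFDerivAt_const (0:ℝ) q').congr_of_eventuallyEq hzero')
  have h2 := congrArg (fun L => L (fderiv ℝ (fun x' => Q g x' y z) x η)) h1
  simp only [ContinuousLinearMap.comp_apply, innerSL_apply_apply, hM, hq₀,
    hg.fderiv_Qinv_fderiv_Q hm, _root_.zero_apply] at h2
  exact hne (sub_eq_zero.1 (inner_self_eq_zero.1 h2))

end IsRegular

end HalfSpace
end GenFun

theorem theorem2p1 (n : ℕ) (g : GenFun.Pt n → GenFun.Pt n → ℝ → ℝ)
    (Γ : Set (GenFun.Pt n × GenFun.Pt n × ℝ))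
    (hg : GenFun.IsGenerating g Γ)
    (hA1 : GenFun.A1 g Γ) (hA2 : GenFun.A2 g Γ) (hA1star : GenFun.A1star g Γ) :
    (GenFun.A3w g Γ ↔ GenFun.A3w (GenFun.dualFun g Γ) (GenFun.dualSet g Γ)) ∧
    (GenFun.A3w g Γ ↔ GenFun.A3w1 g Γ) ∧
    (GenFun.A3w g Γ ↔ GenFun.A3w2 g Γ) := by
  have H : GenFun.IsRegular g Γ := ⟨hg, hA1, hA2, hA1star⟩
  refine ⟨⟨fun h => H.a3w_dual_of_focalQuasiconvex (H.focalQuasiconvex h), fun h => ?_⟩,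
    ⟨fun h => H.a3w1_of_focalQuasiconvex (H.focalQuasiconvex h), H.a3w_of_a3w1⟩,
    ⟨fun h => (H.focalQuasiconvex h).a3w2, H.a3w_of_a3w2⟩⟩
  -- The converse is the direct implication for `g*`, followed by the return from `g**` to `g`.
  exact H.A3w_dual_dual.1 (H.dual.a3w_dual_of_focalQuasiconvex (H.dual.focalQuasiconvex h))
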